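/- Let $d\ge 1$, let $v$ be an indeterminate, and work over $\mathbb{C}(v)$; write $[m]=\frac{v^m-v^{-m}}{v-v^{-1}}$. **The algebra $MU_v(2)$** is the unital $\mathbb{C}(v)$-algebra with generators $e,f,k,k^{-1},\ell$ ($k^{-1}$ being a two-sided inverse of $k$) and relations $kek^{-1}=v^2e$, $kfk^{-1}=v^{-2}f$, $ef-fe=\frac{k-k^{-1}}{v-v^{-1}}$, $\ell^2=\ell$, $k\ell=\ell k$, $\ell e\ell=\ell e$, $\ell f\ell=f\ell$, $[2]e\ell e=v^{-1}e^2\ell+v\ell e^2$, $[2]f\ell f=v^{-1}\ell f^2+vf^2\ell$. **Its modules.** For $n\ge 0$ and $\epsilon\in\{0,1\}$, $L^+(n,\epsilon)$ is the simple $U_v(\mathfrak{sl}_2)$-module $L^+(n)$ of highest weight $v^n$ on which $\ell$ acts as the scalar $\epsilon$. For $n\ge 1$, $L^+(n,01)$ has basis $m_{i,0}$ ($0\le i\le n-1$), $m_{j,1}$ ($1\le j\le n$) with $k\,m_{i,\epsilon}=v^{n-2i}m_{i,\epsilon}$, $\ell\, m_{i,\epsilon}=\epsilon\, m_{i,\epsilon}$,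 $f\,m_{i,0}=m_{i+1,0}+\frac{v^i}{[i+1]}m_{i+1,1}$, $f\,m_{i,1}=v^{-1}\frac{[i]}{[i+1]}m_{i+1,1}$, $e\,m_{i,0}=v[i][n-i]m_{i-1,0}$, $e\,m_{i,1}=[i][n+1-i]m_{i-1,1}+v^{i-n}[i]m_{i-1,0}$ (vectors with indices out of range are $0$). **The tensor space.** Over a finite field $\mathbb{F}_q$, the $GL_d(\mathbb{F}_q)$-orbits on triples ($2$-step flag $F$, $2$-step flag $F'$, vector $x$) in $\mathbb{F}_q^d$ are indexed by the pairs $(A,\Delta)$ of a matrix $A\in M_2(\mathbb{N})$ with entries summing to $d$ and a set $\Delta$ of positions of positive entries of $A$ such that the columns strictly decrease as the rows strictly increase. The triple lies in the orbit of $(A,\Delta)$ when there is a basis $e_{ijl}$ ($1\le l\le a_{ij}$) with $F_r=\langle e_{ijl}: i\le r\rangle$, $F'_s=\langle e_{ijl}: j\le s\rangle$ and $x=\sum_{(i,j)\in\Delta}e_{ij1}$. In the same way the orbits on triples ($2$-step flag, complete flag, vector) are indexed by the analogous pairs with $A$ a $2\times d$ matrix all of whose column sums are $1$, equivalently by pairs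 $(\underline{i},J)$ with $\underline{i}\in\{1,2\}^d$, $J\subseteq\{1,\dots,d\}$ and $i_a>i_b$ for all $a<b$ in $J$. Let $T$ denote the characteristic functions of the orbits. Convolution $$(\alpha*\gamma)(F,F',x)=\sum_{H,\,u}\alpha(F,H,u)\,\gamma(H,F',x-u)$$ ($H$ running over the $2$-step flags and $u$ over $\mathbb{F}_q^d$) has structure constants that are polynomials in $q$. The mirabolic tensor space $MT_v(2,d)$ is the $\mathbb{C}(v)$-vector space with basis $T_{\underline{i},J}$, on which the elements $T_{A,\Delta}$ act through these polynomials with $q=v^2$. With $e_r=T_{\left(\begin{smallmatrix}r&1\\0&d-r-1\end{smallmatrix}\right),\emptyset}$, $f_r=T_{\left(\begin{smallmatrix}r&0\\1&d-r-1\end{smallmatrix}\right),\emptyset}$, $1_r=T_{\mathrm{diag}(r,d-r),\emptyset}$ and $x_r=T_{\mathrm{diag}(r,d-r),\{(1,1)\}}$, the generators of $MU_v(2)$ act on it by $$e=\sum_{r=0}^{d-1}v^{-r}e_r,\quad f=\sum_{r=0}^{d-1}v^{1+r-d}f_r,\quad k^{\pm1}=\sum_{r=0}^{d}v^{\pm(2r-d)}1_r,\quad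 \ell=1_0+\sum_{r=1}^d v^{-2r}(1_r+x_r).$$ **Theorem.** These operators make $MT_v(2,d)$ a left $MU_v(2)$-module, and there is an isomorphism of left $MU_v(2)$-modules $$MT_v(2,d)\;\cong\;\bigoplus_{(\lambda,1^s)}L^+_{(\lambda,1^s)}\otimes_{\mathbb{C}(v)} M^{(\lambda,1^s)},$$ where $(\lambda,1^s)$ runs over the bipartitions of $d$ (that is, $\lambda_1+\lambda_2+s=d$) with $\lambda=(\lambda_1\ge\lambda_2\ge0)$ and $0\le s\le2$. Here $L^+_{(\lambda,1^s)}$ is $L^+(\lambda_1-\lambda_2,1)$, $L^+(\lambda_1-\lambda_2+1,01)$ or $L^+(\lambda_1-\lambda_2,0)$ according as $s=0,1,2$. The algebra $MU_v(2)$ acts on the first tensor factor, and the multiplicity space $M^{(\lambda,1^s)}$ is the $\mathbb{C}(v)$-vector space with basis the pairs of an $s$-element subset of $\{1,\dots,d\}$ and a standard Young tableau of shape $\lambda$, so it has dimension $\binom{d}{s}f_\lambda$, where $f_\lambda$ is the number of standard Young tableaux of shape $\lambda$ (this is the dimension of the irreducible representation of the mirabolic Hecke algebra attached to $(\lambda,1^s)$).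 -/

import Mathlib

open scoped DirectSum TensorProduct

namespace Mirabolic

/-! ### The ground field and quantum integers -/

/-- The field `ℂ(v)`. -/
abbrev K : Type := RatFunc ℂ

/-- The indeterminate `v`. -/
noncomputable def v : K := RatFunc.X

/-- The symmetric quantum integer `[m] = (v ^ m - v ^ (-m)) / (v - v⁻¹)`. -/
noncomputable def qint (m : ℤ) : K := (v ^ m - v ^ (-m)) / (v - v⁻¹)

theorem v_ne_zero : v ≠ 0 := RatFunc.X_ne_zero

theorem v_pow_ne_one (n : ℕ) (hn : 0 < n) : v ^ n ≠ 1 := by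
  intro h
  have h2 : algebraMap (Polynomial ℂ) K (Polynomial.X ^ n) = algebraMap (Polynomial ℂ) K 1 := by
    simpa [v, RatFunc.algebraMap_X] using h
  have h3 := congrArg Polynomial.natDegree (RatFunc.algebraMap_injective ℂ h2)
  simp at h3
  omega

theorem v_sub_inv_ne_zero : v - v⁻¹ ≠ 0 := by
  intro h
  have h0 := v_ne_zero
  field_simp at h
  exact v_pow_ne_one 2 (by norm_num) (by linear_combination h)

theorem qint_zero : qint 0 = 0 := by simp [qint]

theorem qint_succ_ne_zero (i : ℕ) : qint ((i : ℤ) + 1) ≠ 0 := by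
  have h0 := v_ne_zero
  have h1 := v_sub_inv_ne_zero
  unfold qint
  refine div_ne_zero ?_ h1
  intro h
  have h2 : v ^ ((i : ℤ) + 1) * v ^ ((i : ℤ) + 1) = 1 := by
    have : v ^ ((i : ℤ) + 1) = v ^ (-((i : ℤ) + 1)) := sub_eq_zero.mp h
    nth_rewrite 2 [this]
    rw [← zpow_add₀ h0]
    simp
  rw [← zpow_add₀ h0] at h2
  refine v_pow_ne_one (2 * i + 2) (by omega) ?_
  rw [← h2, ← zpow_natCast]
  congr 1
  push_cast
  ring

/-! ### Partial flags, decorated matrices and orbits -/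

/-- An `n`-step partial flag `0 = F 0 ⊆ F 1 ⊆ ⋯ ⊆ F n = V`. -/
structure Flag (k V : Type) [Field k] [AddCommGroup V] [Module k V] (n : ℕ) where
  F : Fin (n + 1) → Submodule k V
  mono : Monotone F
  bot : F 0 = ⊥
  top : F (Fin.last n) = ⊤

/-- `Δ` decorates `A`: its entries `(i₁, j₁), …, (iₖ, jₖ)` satisfy `i₁ < ⋯ < iₖ`, `jₖ < ⋯ < j₁`,
and `A` is positive at each of them. -/
def IsDecoration {m n : ℕ} (A : Matrix (Fin m) (Fin n) ℕ) (Δ : Finset (Fin m × Fin n)) : Prop :=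
  (∀ p ∈ Δ, 0 < A p.1 p.2) ∧
    ∀ p ∈ Δ, ∀ p' ∈ Δ, p ≠ p' → (p.1 < p'.1 ∧ p'.2 < p.2) ∨ (p'.1 < p.1 ∧ p.2 < p'.2)

/-- The triple `(F, F', x)` lies in the orbit `O_{A,Δ}`: there is a basis `e i j l`, `l < A i j`,
with `F r = ⟨e i j l | i ≤ r⟩`, `F' s = ⟨e i j l | j ≤ s⟩` (indices counted from `1`; below they
are counted from `0`) and `x = ∑_{(i,j) ∈ Δ} e i j 1`. -/
def InOrbit {k V : Type} [Field k] [AddCommGroup V] [Module k V] {m n : ℕ}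
    (A : Matrix (Fin m) (Fin n) ℕ) (Δ : Finset (Fin m × Fin n))
    (F : Flag k V m) (F' : Flag k V n) (x : V) : Prop :=
  ∃ e : Module.Basis (Σ p : Fin m × Fin n, Fin (A p.1 p.2)) k V,
    (∀ r, F.F r = Submodule.span k {y | ∃ c, (c.1.1 : ℕ) < (r : ℕ) ∧ e c = y}) ∧
    (∀ s, F'.F s = Submodule.span k {y | ∃ c, (c.1.2 : ℕ) < (s : ℕ) ∧ e c = y}) ∧
    x = ∑ p ∈ Δ, if h : 0 < A p.1 p.2 then e ⟨p, ⟨0, h⟩⟩ else 0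

/-- `Ξ_{n,d}`: decorated `n × n` matrices with entries summing to `d`. They index the orbits of
`GL_d` on triples of two `n`-step flags and a vector. -/
abbrev XiMU (n d : ℕ) : Type :=
  {X : Matrix (Fin n) (Fin n) ℕ × Finset (Fin n × Fin n) //
    (∑ i, ∑ j, X.1 i j) = d ∧ IsDecoration X.1 X.2}

/-- `Ξ_{n,1^d}`, as pairs `(i, J)` of a sequence `i` in `{1,…,n}^d` and a set
`J = {j₁ < ⋯ < jₖ}` of positions with `i_{j₁} > ⋯ > i_{jₖ}`. They index the orbits of `GL_d` on
triples of an `n`-step flag, a complete flag and a vector. -/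
abbrev XiMT (n d : ℕ) : Type :=
  {Y : (Fin d → Fin n) × Finset (Fin d) // ∀ a ∈ Y.2, ∀ b ∈ Y.2, a < b → Y.1 b < Y.1 a}

/-- The `n × d` matrix of `(i, J)`: column `r` has its only non-zero entry, a `1`, in row `i r`. -/
def XiMT.mat {n d : ℕ} (Y : XiMT n d) : Matrix (Fin n) (Fin d) ℕ :=
  fun m r => if Y.1.1 r = m then 1 else 0

/-- The decoration of `(i, J)`: the positions `(i j, j)` for `j ∈ J`. -/
def XiMT.dec {n d : ℕ} (Y : XiMT n d) : Finset (Fin n × Fin d) :=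
  Y.1.2.image fun j => (Y.1.1 j, j)

/-! ### Generic convolution -/

/-- `P` is the polynomial giving the coefficient of `T_Z` in the convolution `T_X * T_Y` over all
finite fields: for each finite field with `q` elements and each `(F, F', x)` in the orbit of `Z`,
`∑_{H, u} T_X (F, H, u) T_Y (H, F', x - u) = P q`. -/
def IsStructurePolynomial {n d : ℕ} (X : XiMU n d) (Y Z : XiMT n d) (P : Polynomial ℤ) : Prop :=
  ∀ (k : Type) [Field k] [Finite k] (F : Flag k (Fin d → k) n) (F' : Flag k (Fin d → k) d)
    (x : Fin d → k), InOrbit Z.mat Z.dec F F' x →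
      (Nat.card {c : Flag k (Fin d → k) n × (Fin d → k) //
        InOrbit X.1.1 X.1.2 F c.1 c.2 ∧ InOrbit Y.mat Y.dec c.1 F' (x - c.2)} : ℤ) =
      P.eval (Nat.card k : ℤ)

open Classical in
/-- The (unique) structure polynomial. -/
noncomputable def structurePolynomial {n d : ℕ} (X : XiMU n d) (Y Z : XiMT n d) : Polynomial ℤ :=
  if h : ∃ P, IsStructurePolynomial X Y Z P then h.choose else 0

/-- The underlying space of the generic mirabolic quantum Schur algebra `MU_v(n,d)`, with basis
`T_{A,Δ}`. -/
abbrev MUSchur (n d : ℕ) : Type := XiMU n d →₀ K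

/-- The generic mirabolic tensor space `MT_v(n,d)`, with basis `T_{i,J}`. -/
abbrev MT (n d : ℕ) : Type := XiMT n d →₀ K

/-- The left action of `MU_v(n,d)` on `MT_v(n,d)`: convolution, with `q` specialized to `v ^ 2`. -/
noncomputable def act (n d : ℕ) : MUSchur n d →ₗ[K] Module.End K (MT n d) :=
  Finsupp.linearCombination K fun X =>
    Finsupp.linearCombination K fun Y =>
      ∑ Z : XiMT n d, Finsupp.single Z (Polynomial.aeval (v ^ 2) (structurePolynomial X Y Z))

/-! ### The Chevalley generators of `MU_v(2,d)` -/

/-- `e_r`, the basis element of `((r, 1), (0, d - r - 1))` with empty decoration. -/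
noncomputable def eBasis (d : ℕ) (r : Fin d) : MUSchur 2 d :=
  Finsupp.single ⟨(!![(r : ℕ), 1; 0, d - r - 1], ∅), by
    refine ⟨?_, by simp [IsDecoration]⟩
    have := r.2
    simp [Fin.sum_univ_two]
    omega⟩ 1

/-- `f_r`, the basis element of `((r, 0), (1, d - r - 1))` with empty decoration. -/
noncomputable def fBasis (d : ℕ) (r : Fin d) : MUSchur 2 d :=
  Finsupp.single ⟨(!![(r : ℕ), 0; 1, d - r - 1], ∅), by
    refine ⟨?_, by simp [IsDecoration]⟩
    have := r.2
    simp [Fin.sum_univ_two]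
    omega⟩ 1

/-- `1_r`, the basis element of `diag (r, d - r)` with empty decoration. -/
noncomputable def oneBasis (d : ℕ) (r : Fin (d + 1)) : MUSchur 2 d :=
  Finsupp.single ⟨(!![(r : ℕ), 0; 0, d - r], ∅), by
    refine ⟨?_, by simp [IsDecoration]⟩
    have := r.2
    simp [Fin.sum_univ_two]
    omega⟩ 1

/-- `x_{r+1}`, the basis element of `diag (r + 1, d - r - 1)` decorated at `(1,1)`. -/
noncomputable def xBasis (d : ℕ) (r : Fin d) : MUSchur 2 d :=
  Finsupp.single ⟨(!![(r : ℕ) + 1, 0; 0, d - (r + 1)], {(0, 0)}), by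
    refine ⟨?_, by simp [IsDecoration]⟩
    have := r.2
    simp [Fin.sum_univ_two]⟩ 1

noncomputable def chevE (d : ℕ) : MUSchur 2 d :=
  ∑ r : Fin d, v ^ (-(r : ℤ)) • eBasis d r

noncomputable def chevF (d : ℕ) : MUSchur 2 d :=
  ∑ r : Fin d, v ^ (1 + (r : ℤ) - (d : ℤ)) • fBasis d r

noncomputable def chevK (d : ℕ) : MUSchur 2 d :=
  ∑ r : Fin (d + 1), v ^ (2 * (r : ℤ) - (d : ℤ)) • oneBasis d r

noncomputable def chevKinv (d : ℕ) : MUSchur 2 d :=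
  ∑ r : Fin (d + 1), v ^ ((d : ℤ) - 2 * (r : ℤ)) • oneBasis d r

noncomputable def chevL (d : ℕ) : MUSchur 2 d :=
  oneBasis d 0 + ∑ r : Fin d, v ^ (-2 * ((r : ℤ) + 1)) • (oneBasis d r.succ + xBasis d r)

/-! ### Mirabolic quantum `sl₂` -/

/-- The generators `e`, `f`, `k`, `k⁻¹`, `ℓ`. -/
inductive Gen : Type
  | e | f | k | kinv | l

namespace Free

noncomputable def e : FreeAlgebra K Gen := FreeAlgebra.ι K Gen.e
noncomputable def f : FreeAlgebra K Gen := FreeAlgebra.ι K Gen.f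
noncomputable def k : FreeAlgebra K Gen := FreeAlgebra.ι K Gen.k
noncomputable def kinv : FreeAlgebra K Gen := FreeAlgebra.ι K Gen.kinv
noncomputable def l : FreeAlgebra K Gen := FreeAlgebra.ι K Gen.l

end Free

open Free in
/-- The defining relations of `MU_v(2)`. -/
inductive Rel : FreeAlgebra K Gen → FreeAlgebra K Gen → Prop
  | k_kinv : Rel (k * kinv) 1
  | kinv_k : Rel (kinv * k) 1
  | k_e : Rel (k * e * kinv) (v ^ 2 • e)
  | k_f : Rel (k * f * kinv) (v ^ (-2 : ℤ) • f)
  | e_f : Rel (e * f - f * e) ((v - v⁻¹)⁻¹ • (k - kinv))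
  | l_l : Rel (l * l) l
  | k_l : Rel (k * l) (l * k)
  | l_e_l : Rel (l * e * l) (l * e)
  | l_f_l : Rel (l * f * l) (f * l)
  | e_l_e : Rel (qint 2 • (e * l * e)) (v⁻¹ • (e * e * l) + v • (l * e * e))
  | f_l_f : Rel (qint 2 • (f * l * f)) (v⁻¹ • (l * f * f) + v • (f * f * l))

/-- Mirabolic quantum `sl₂`, the algebra `MU_v(2)`. -/
abbrev MU2 : Type := RingQuot Rel

/-- The image of a generator in `MU_v(2)`. -/
noncomputable def MU2.gen (g : Gen) : MU2 := RingQuot.mkAlgHom K Rel (FreeAlgebra.ι K g)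

/-- Representations of `MU_v(2)` from operators satisfying the defining relations. -/
noncomputable def MU2.lift {A : Type} [Ring A] [Algebra K A] (φ : Gen → A)
    (h : ∀ ⦃a b⦄, Rel a b → FreeAlgebra.lift K φ a = FreeAlgebra.lift K φ b) : MU2 →ₐ[K] A :=
  RingQuot.liftAlgHom K ⟨FreeAlgebra.lift K φ, h⟩

/-! ### The simple modules `L⁺(n,0)`, `L⁺(n,1)` and `L⁺(n,01)` -/

/-- The vector `m_i` of the standard basis `m_0, …, m_n` of `L⁺(n)` (zero if `i > n`). -/
noncomputable def mvec (n i : ℕ) : Fin (n + 1) →₀ K :=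
  if h : i < n + 1 then Finsupp.single ⟨i, h⟩ 1 else 0

/-- The action of the generators on `L⁺(n,ε)`, the simple `U_v(sl₂)`-module `L⁺(n)` with highest
weight `v ^ n`, on which `ℓ` acts as the scalar `ε`. -/
noncomputable def opUniform (ε : K) (n : ℕ) : Gen → Module.End K (Fin (n + 1) →₀ K)
  | Gen.e => Finsupp.linearCombination K fun i =>
      (qint (i : ℕ) * qint ((n : ℤ) + 1 - (i : ℕ))) • mvec n (i - 1)
  | Gen.f => Finsupp.linearCombination K fun i => mvec n (i + 1)
  | Gen.k => Finsupp.linearCombination K fun i => v ^ ((n : ℤ) - 2 * (i : ℕ)) • mvec n i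
  | Gen.kinv => Finsupp.linearCombination K fun i => v ^ (2 * (i : ℕ) - (n : ℤ)) • mvec n i
  | Gen.l => ε • 1

/-- The vector `m_{i,0}` of `L⁺(n,01)`, a basis vector for `0 ≤ i ≤ n - 1` and zero otherwise. -/
noncomputable def mvec0 (n i : ℕ) : (Fin n ⊕ Fin n) →₀ K :=
  if h : i < n then Finsupp.single (Sum.inl ⟨i, h⟩) 1 else 0

/-- The vector `m_{j,1}` of `L⁺(n,01)`, a basis vector for `1 ≤ j ≤ n` and zero otherwise. -/
noncomputable def mvec1 (n : ℕ) : ℕ → ((Fin n ⊕ Fin n) →₀ K)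
  | 0 => 0
  | j + 1 => if h : j < n then Finsupp.single (Sum.inr ⟨j, h⟩) 1 else 0

/-- The linear map on `L⁺(n,01)` with the prescribed values at `m_{i,0}` and at `m_{j,1}`. -/
noncomputable def mkMixed (n : ℕ) (a b : ℕ → ((Fin n ⊕ Fin n) →₀ K)) :
    Module.End K ((Fin n ⊕ Fin n) →₀ K) :=
  Finsupp.linearCombination K (Sum.elim (fun i => a i) (fun j => b (j + 1)))

/-- The action of the generators on `L⁺(n,01)`. -/
noncomputable def opMixed (n : ℕ) : Gen → Module.End K ((Fin n ⊕ Fin n) →₀ K)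
  | Gen.e => mkMixed n
      (fun i => (v * qint i * qint ((n : ℤ) - i)) • mvec0 n (i - 1))
      (fun i => (qint i * qint ((n : ℤ) + 1 - i)) • mvec1 n (i - 1) +
        (v ^ ((i : ℤ) - n) * qint i) • mvec0 n (i - 1))
  | Gen.f => mkMixed n
      (fun i => mvec0 n (i + 1) + (v ^ i / qint ((i : ℤ) + 1)) • mvec1 n (i + 1))
      (fun i => (v⁻¹ * (qint i / qint ((i : ℤ) + 1))) • mvec1 n (i + 1))
  | Gen.k => mkMixed n
      (fun i => v ^ ((n : ℤ) - 2 * i) • mvec0 n i) (fun i => v ^ ((n : ℤ) - 2 * i) • mvec1 n i)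
  | Gen.kinv => mkMixed n
      (fun i => v ^ (2 * (i : ℤ) - n) • mvec0 n i) (fun i => v ^ (2 * (i : ℤ) - n) • mvec1 n i)
  | Gen.l => mkMixed n (fun _ => 0) (fun i => mvec1 n i)

theorem mvec_of_lt {n i : ℕ} (h : i < n + 1) : mvec n i = Finsupp.single ⟨i, h⟩ 1 := by
  simp [mvec, h]

theorem mvec_of_ge {n i : ℕ} (h : n + 1 ≤ i) : mvec n i = 0 := by
  simp [mvec, Nat.not_lt.mpr h]

theorem mvec0_of_ge {n i : ℕ} (h : n ≤ i) : mvec0 n i = 0 := by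
  simp [mvec0, Nat.not_lt.mpr h]

theorem mvec1_of_ge {n i : ℕ} (h : n < i) : mvec1 n i = 0 := by
  cases i with
  | zero => rfl
  | succ i => simp [mvec1, Nat.not_lt.mpr (Nat.lt_succ_iff.mp h)]

theorem opUniform_e (ε : K) (n i : ℕ) : opUniform ε n Gen.e (mvec n i) =
    (qint i * qint ((n : ℤ) + 1 - i)) • mvec n (i - 1) := by
  by_cases h : i < n + 1
  · rw [mvec_of_lt h]; simp [opUniform]
  · rw [mvec_of_ge (by omega), map_zero]
    by_cases h2 : i = n + 1
    · subst h2; simp [qint_zero]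
    · rw [mvec_of_ge (by omega), smul_zero]

theorem opUniform_f (ε : K) (n i : ℕ) : opUniform ε n Gen.f (mvec n i) = mvec n (i + 1) := by
  by_cases h : i < n + 1
  · rw [mvec_of_lt h]; simp [opUniform]
  · rw [mvec_of_ge (by omega), map_zero, mvec_of_ge (by omega)]

theorem opUniform_k (ε : K) (n i : ℕ) : opUniform ε n Gen.k (mvec n i) =
    v ^ ((n : ℤ) - 2 * i) • mvec n i := by
  by_cases h : i < n + 1
  · rw [mvec_of_lt h]; simp [opUniform, mvec_of_lt h]
  · rw [mvec_of_ge (by omega), map_zero, smul_zero]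

theorem opUniform_kinv (ε : K) (n i : ℕ) : opUniform ε n Gen.kinv (mvec n i) =
    v ^ (2 * (i : ℤ) - n) • mvec n i := by
  by_cases h : i < n + 1
  · rw [mvec_of_lt h]; simp [opUniform, mvec_of_lt h]
  · rw [mvec_of_ge (by omega), map_zero, smul_zero]

theorem opUniform_ext {n : ℕ} {S T : Module.End K (Fin (n + 1) →₀ K)}
    (h : ∀ i, S (mvec n i) = T (mvec n i)) : S = T := by
  refine Finsupp.lhom_ext' fun i => LinearMap.ext_ring ?_
  have := h i
  rw [mvec_of_lt i.2] at this
  simpa using this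

theorem mkMixed_mvec0 {n : ℕ} {a b : ℕ → ((Fin n ⊕ Fin n) →₀ K)} (i : ℕ)
    (ha : n ≤ i → a i = 0) : mkMixed n a b (mvec0 n i) = a i := by
  by_cases h : i < n
  · simp [mkMixed, mvec0, h]
  · rw [mvec0_of_ge (by omega), map_zero, ha (by omega)]

theorem mkMixed_mvec1 {n : ℕ} {a b : ℕ → ((Fin n ⊕ Fin n) →₀ K)} (i : ℕ)
    (h0 : b 0 = 0) (hb : n < i → b i = 0) : mkMixed n a b (mvec1 n i) = b i := by
  cases i with
  | zero => simp [mvec1, h0]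
  | succ i =>
    by_cases h : i < n
    · simp [mkMixed, mvec1, h]
    · rw [mvec1_of_ge (by omega), map_zero, hb (by omega)]

theorem opMixed_ext {n : ℕ} {S T : Module.End K ((Fin n ⊕ Fin n) →₀ K)}
    (h0 : ∀ i, S (mvec0 n i) = T (mvec0 n i)) (h1 : ∀ i, S (mvec1 n i) = T (mvec1 n i)) :
    S = T := by
  refine Finsupp.lhom_ext' fun i => LinearMap.ext_ring ?_
  rcases i with i | i
  · simpa [mvec0] using h0 i
  · simpa [mvec1] using h1 (i + 1)

theorem opMixed_e0 (n i : ℕ) : opMixed n Gen.e (mvec0 n i) =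
    (v * qint i * qint ((n : ℤ) - i)) • mvec0 n (i - 1) := by
  rw [opMixed, mkMixed_mvec0]
  intro h
  by_cases h2 : i = n
  · subst h2; simp [qint_zero]
  · rw [mvec0_of_ge (by omega), smul_zero]

theorem opMixed_e1 (n i : ℕ) : opMixed n Gen.e (mvec1 n i) =
    (qint i * qint ((n : ℤ) + 1 - i)) • mvec1 n (i - 1) +
      (v ^ ((i : ℤ) - n) * qint i) • mvec0 n (i - 1) := by
  rw [opMixed, mkMixed_mvec1 _ (by simp [qint_zero])]
  intro h
  rw [mvec0_of_ge (by omega), smul_zero, add_zero]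
  by_cases h2 : i = n + 1
  · subst h2; simp [qint_zero]
  · rw [mvec1_of_ge (by omega), smul_zero]

theorem opMixed_f0 (n i : ℕ) : opMixed n Gen.f (mvec0 n i) =
    mvec0 n (i + 1) + (v ^ i / qint ((i : ℤ) + 1)) • mvec1 n (i + 1) := by
  rw [opMixed, mkMixed_mvec0]
  intro h
  rw [mvec0_of_ge (by omega), mvec1_of_ge (by omega), smul_zero, add_zero]

theorem opMixed_f1 (n i : ℕ) : opMixed n Gen.f (mvec1 n i) =
    (v⁻¹ * (qint i / qint ((i : ℤ) + 1))) • mvec1 n (i + 1) := by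
  rw [opMixed, mkMixed_mvec1 _ (by simp [qint_zero])]
  intro h
  rw [mvec1_of_ge (by omega), smul_zero]

theorem opMixed_k0 (n i : ℕ) : opMixed n Gen.k (mvec0 n i) =
    v ^ ((n : ℤ) - 2 * i) • mvec0 n i := by
  rw [opMixed, mkMixed_mvec0]
  intro h
  rw [mvec0_of_ge h, smul_zero]

theorem opMixed_k1 (n i : ℕ) : opMixed n Gen.k (mvec1 n i) =
    v ^ ((n : ℤ) - 2 * i) • mvec1 n i := by
  rw [opMixed, mkMixed_mvec1 _ (by simp [mvec1])]
  intro h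
  rw [mvec1_of_ge h, smul_zero]

theorem opMixed_kinv0 (n i : ℕ) : opMixed n Gen.kinv (mvec0 n i) =
    v ^ (2 * (i : ℤ) - n) • mvec0 n i := by
  rw [opMixed, mkMixed_mvec0]
  intro h
  rw [mvec0_of_ge h, smul_zero]

theorem opMixed_kinv1 (n i : ℕ) : opMixed n Gen.kinv (mvec1 n i) =
    v ^ (2 * (i : ℤ) - n) • mvec1 n i := by
  rw [opMixed, mkMixed_mvec1 _ (by simp [mvec1])]
  intro h
  rw [mvec1_of_ge h, smul_zero]

theorem opMixed_l0 (n i : ℕ) : opMixed n Gen.l (mvec0 n i) = 0 := by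
  rw [opMixed, mkMixed_mvec0]
  intro h
  rfl

theorem opMixed_l1 (n i : ℕ) : opMixed n Gen.l (mvec1 n i) = mvec1 n i := by
  rw [opMixed, mkMixed_mvec1 _ (by simp [mvec1])]
  exact mvec1_of_ge

theorem qint_two : qint 2 = v + v⁻¹ := by
  have h0 := v_ne_zero
  have h1 := v_sub_inv_ne_zero
  rw [qint, div_eq_iff h1]
  simp only [zpow_neg, zpow_ofNat]
  field_simp
  ring

/-- The identity behind `ef - fe = (k - k⁻¹) / (v - v⁻¹)`. -/
theorem qint_identity (x y : ℤ) : qint (x + 1) * qint (y - x) - qint x * qint (y + 1 - x) =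
    (v - v⁻¹)⁻¹ * (v ^ (y - 2 * x) - v ^ (2 * x - y)) := by
  have h0 := v_ne_zero
  have h1 := v_sub_inv_ne_zero
  have ha : v ^ x ≠ 0 := zpow_ne_zero _ h0
  have hb : v ^ y ≠ 0 := zpow_ne_zero _ h0
  simp only [qint, neg_sub, neg_add_rev, two_mul, zpow_add₀ h0, zpow_sub₀ h0, zpow_neg, zpow_one]
  generalize v ^ x = a at *
  generalize v ^ y = b at *
  generalize hD : v - v⁻¹ = D at *
  field_simp
  rw [← hD]
  field_simp
  ring

theorem qint_identity0 (x y : ℤ) : v * qint (x + 1) * qint (y - (x + 1)) + v ^ (2 * x + 1 - y) -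
    v * qint x * qint (y - x) = (v - v⁻¹)⁻¹ * (v ^ (y - 2 * x) - v ^ (2 * x - y)) := by
  have h0 := v_ne_zero
  have h1 := v_sub_inv_ne_zero
  have ha : v ^ x ≠ 0 := zpow_ne_zero _ h0
  have hb : v ^ y ≠ 0 := zpow_ne_zero _ h0
  simp only [qint, neg_sub, neg_add_rev, two_mul, zpow_add₀ h0, zpow_sub₀ h0, zpow_neg, zpow_one]
  generalize v ^ x = a at *
  generalize v ^ y = b at *
  generalize hD : v - v⁻¹ = D at *
  field_simp
  rw [← hD]
  field_simp
  ring

theorem qint_identity1 (x y : ℤ) : v⁻¹ * qint (x + 1) * qint (y - (x + 1)) -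
    (qint (y - x) * v⁻¹ * qint x + v ^ (2 * x + 1 - y)) =
      (v - v⁻¹)⁻¹ * (v ^ (y - 2 * (x + 1)) - v ^ (2 * (x + 1) - y)) := by
  have h0 := v_ne_zero
  have h1 := v_sub_inv_ne_zero
  have ha : v ^ x ≠ 0 := zpow_ne_zero _ h0
  have hb : v ^ y ≠ 0 := zpow_ne_zero _ h0
  simp only [qint, neg_sub, neg_add_rev, two_mul, zpow_add₀ h0, zpow_sub₀ h0, zpow_neg, zpow_one]
  generalize v ^ x = a at *
  generalize v ^ y = b at *
  generalize hD : v - v⁻¹ = D at *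
  field_simp
  rw [← hD]
  field_simp
  ring

theorem zpow_cast_sub (i : ℕ) (y : ℤ) : v ^ (2 * (i : ℤ) + 1 - y) = v ^ i * v ^ ((i : ℤ) + 1 - y) := by
  rw [← zpow_natCast, ← zpow_add₀ v_ne_zero]; congr 1; ring

theorem zpow_succ_sub (x y : ℤ) : v ^ (x + 1 - y) = v * v ^ (x - y) := by
  rw [mul_comm, ← zpow_add_one₀ v_ne_zero]; congr 1; ring

theorem k_exp_inv (n i : ℕ) : v ^ (2 * (i : ℤ) - n) * v ^ ((n : ℤ) - 2 * i) = 1 := by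
  rw [← zpow_add₀ v_ne_zero]; simp

theorem k_exp_inv' (n i : ℕ) : v ^ ((n : ℤ) - 2 * i) * v ^ (2 * (i : ℤ) - n) = 1 := by
  rw [← zpow_add₀ v_ne_zero]; simp

theorem k_exp_e (n i : ℕ) : v ^ (2 * ((i + 1 : ℕ) : ℤ) - n) * v ^ ((n : ℤ) - 2 * i) = v ^ 2 := by
  rw [← zpow_add₀ v_ne_zero, ← zpow_natCast]; congr 1; push_cast; ring

theorem k_exp_f (n i : ℕ) :
    v ^ (2 * (i : ℤ) - n) * v ^ ((n : ℤ) - 2 * ((i + 1 : ℕ) : ℤ)) = v ^ (-2 : ℤ) := by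
  rw [← zpow_add₀ v_ne_zero]; congr 1; push_cast; ring

theorem opUniform_rel (ε : K) (hε : ε * ε = ε) (n : ℕ) ⦃a b : FreeAlgebra K Gen⦄ (h : Rel a b) :
    FreeAlgebra.lift K (opUniform ε n) a = FreeAlgebra.lift K (opUniform ε n) b := by
  have hl : opUniform ε n Gen.l = ε • 1 := rfl
  cases h <;> simp only [Free.e, Free.f, Free.k, Free.kinv, Free.l, map_mul, map_sub, map_add,
    map_smul, map_one, FreeAlgebra.lift_ι_apply]
  case k_kinv =>
    refine opUniform_ext fun i => ?_
    simp only [Module.End.mul_apply, Module.End.one_apply, opUniform_kinv, opUniform_k, map_smul,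
      smul_smul, k_exp_inv, one_smul]
  case kinv_k =>
    refine opUniform_ext fun i => ?_
    simp only [Module.End.mul_apply, Module.End.one_apply, opUniform_kinv, opUniform_k, map_smul,
      smul_smul, k_exp_inv', one_smul]
  case k_e =>
    refine opUniform_ext fun i => ?_
    simp only [Module.End.mul_apply, LinearMap.smul_apply, opUniform_kinv, opUniform_k,
      opUniform_e, map_smul, smul_smul]
    cases i with
    | zero => simp [qint_zero]
    | succ i =>
      simp only [Nat.add_sub_cancel]
      congr 1
      linear_combination (qint ((i + 1 : ℕ) : ℤ) * qint ((n : ℤ) + 1 - ((i + 1 : ℕ) : ℤ))) *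
        k_exp_e n i
  case k_f =>
    refine opUniform_ext fun i => ?_
    simp only [Module.End.mul_apply, LinearMap.smul_apply, opUniform_kinv, opUniform_k,
      opUniform_f, map_smul, smul_smul, k_exp_f]
  case e_f =>
    refine opUniform_ext fun i => ?_
    simp only [Module.End.mul_apply, LinearMap.smul_apply, LinearMap.sub_apply, opUniform_kinv,
      opUniform_k, opUniform_e, opUniform_f, map_smul, Nat.add_sub_cancel, ← sub_smul, smul_smul]
    have key := qint_identity i n
    have e1 : (n : ℤ) + 1 - ((i + 1 : ℕ) : ℤ) = n - i := by push_cast; ring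
    rw [← key, e1, Nat.cast_succ, sub_smul]
    cases i with
    | zero => simp [qint_zero]
    | succ i => simp only [Nat.add_sub_cancel]
  case l_l => rw [hl]; simp [smul_smul, hε]
  case k_l => rw [hl]; simp
  case l_e_l => rw [hl]; simp [smul_smul, hε]
  case l_f_l => rw [hl]; simp [smul_smul, hε]
  case e_l_e =>
    rw [hl, qint_two]
    simp only [mul_smul_comm, smul_mul_assoc, mul_one, one_mul, add_smul]
    exact add_comm _ _
  case f_l_f =>
    rw [hl, qint_two]
    simp only [mul_smul_comm, smul_mul_assoc, mul_one, one_mul, add_smul]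
    exact add_comm _ _

theorem opMixed_rel (n : ℕ) ⦃a b : FreeAlgebra K Gen⦄ (h : Rel a b) :
    FreeAlgebra.lift K (opMixed n) a = FreeAlgebra.lift K (opMixed n) b := by
  have h0 := v_ne_zero
  cases h <;> simp only [Free.e, Free.f, Free.k, Free.kinv, Free.l, map_mul, map_sub, map_add,
    map_smul, map_one, FreeAlgebra.lift_ι_apply] <;> refine opMixed_ext (fun i => ?_) fun i => ?_ <;>
    simp only [Module.End.mul_apply, Module.End.one_apply, LinearMap.smul_apply,
      LinearMap.sub_apply, LinearMap.add_apply, opMixed_e0, opMixed_e1, opMixed_f0, opMixed_f1,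
      opMixed_k0, opMixed_k1, opMixed_kinv0, opMixed_kinv1, opMixed_l0, opMixed_l1, map_smul,
      map_add, map_zero, smul_zero, add_zero, zero_add, Nat.add_sub_cancel, smul_add, smul_smul]
  case k_kinv.refine_1 => rw [k_exp_inv, one_smul]
  case k_kinv.refine_2 => rw [k_exp_inv, one_smul]
  case kinv_k.refine_1 => rw [k_exp_inv', one_smul]
  case kinv_k.refine_2 => rw [k_exp_inv', one_smul]
  case k_e.refine_1 =>
    cases i with
    | zero => simp [qint_zero]
    | succ i =>
      simp only [Nat.add_sub_cancel]
      congr 1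
      linear_combination (v * qint ((i + 1 : ℕ) : ℤ) * qint ((n : ℤ) - ((i + 1 : ℕ) : ℤ))) *
        k_exp_e n i
  case k_e.refine_2 =>
    cases i with
    | zero => simp [qint_zero]
    | succ i =>
      simp only [Nat.add_sub_cancel]
      congr 2
      · linear_combination (qint ((i + 1 : ℕ) : ℤ) * qint ((n : ℤ) + 1 - ((i + 1 : ℕ) : ℤ))) *
          k_exp_e n i
      · linear_combination (v ^ (((i + 1 : ℕ) : ℤ) - n) * qint ((i + 1 : ℕ) : ℤ)) * k_exp_e n i
  case k_f.refine_1 =>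
    congr 2
    · linear_combination k_exp_f n i
    · linear_combination (v ^ i / qint ((i : ℤ) + 1)) * k_exp_f n i
  case k_f.refine_2 =>
    congr 1
    linear_combination (v⁻¹ * (qint i / qint ((i : ℤ) + 1))) * k_exp_f n i
  case e_f.refine_1 =>
    have hi := qint_succ_ne_zero i
    have key := qint_identity0 i n
    rw [← sub_smul, smul_smul, ← key, zpow_cast_sub]
    push_cast
    cases i with
    | zero =>
      simp only [Nat.cast_zero, qint_zero, mul_zero, zero_mul, zero_smul, mvec1, smul_zero,
        sub_zero, add_zero, zero_add, ← add_smul]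
      simp only [Nat.cast_zero, zero_add] at hi
      congr 1
      field_simp
    | succ i =>
      have hi' := qint_succ_ne_zero i
      simp only [Nat.add_sub_cancel]
      push_cast at *
      have e1 : (n : ℤ) + 1 - ((i : ℤ) + 1 + 1) = n - (i + 1) := by ring
      rw [e1]
      have c1 : v ^ (i + 1) / qint ((i : ℤ) + 1 + 1) *
          (qint ((i : ℤ) + 1 + 1) * qint ((n : ℤ) - (i + 1))) =
          v * qint ((i : ℤ) + 1) * qint ((n : ℤ) - (i + 1)) * (v ^ i / qint ((i : ℤ) + 1)) := by
        field_simp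
        ring
      have c2 : v ^ (i + 1) / qint ((i : ℤ) + 1 + 1) *
          (v ^ ((i : ℤ) + 1 + 1 - n) * qint ((i : ℤ) + 1 + 1)) =
          v ^ (i + 1) * v ^ ((i : ℤ) + 1 + 1 - n) := by
        field_simp
      rw [c1, c2, sub_smul, add_smul]
      abel
  case e_f.refine_2 =>
    cases i with
    | zero => simp [qint_zero, mvec1]
    | succ i =>
      have hi := qint_succ_ne_zero i
      have hi' := qint_succ_ne_zero (i + 1)
      have key := qint_identity1 i n
      rw [← sub_smul, smul_smul]
      push_cast at *
      rw [← key, zpow_cast_sub]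
      have e1 : (n : ℤ) + 1 - ((i : ℤ) + 1 + 1) = n - (i + 1) := by ring
      have e2 : (n : ℤ) + 1 - ((i : ℤ) + 1) = n - i := by ring
      have c1 : v⁻¹ * (qint ((i : ℤ) + 1) / qint ((i : ℤ) + 1 + 1)) *
          (qint ((i : ℤ) + 1 + 1) * qint ((n : ℤ) - (i + 1))) =
          v⁻¹ * qint ((i : ℤ) + 1) * qint ((n : ℤ) - (i + 1)) := by
        field_simp
      have c2 : v⁻¹ * (qint ((i : ℤ) + 1) / qint ((i : ℤ) + 1 + 1)) *
          (v ^ ((i : ℤ) + 1 + 1 - n) * qint ((i : ℤ) + 1 + 1)) =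
          v ^ ((i : ℤ) + 1 - n) * qint ((i : ℤ) + 1) := by
        rw [zpow_succ_sub]
        field_simp
      have c3 : qint ((i : ℤ) + 1) * qint ((n : ℤ) - i) *
          (v⁻¹ * (qint (i : ℤ) / qint ((i : ℤ) + 1))) = qint ((n : ℤ) - i) * v⁻¹ * qint (i : ℤ) := by
        field_simp
      have c4 : v ^ ((i : ℤ) + 1 - n) * qint ((i : ℤ) + 1) * (v ^ i / qint ((i : ℤ) + 1)) =
          v ^ i * v ^ ((i : ℤ) + 1 - n) := by
        field_simp
      rw [e1, e2, c1, c2, c3, c4, sub_smul, add_smul]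
      abel
  case e_l_e.refine_2 =>
    cases i with
    | zero => simp [qint_zero]
    | succ i =>
      have e2 : (n : ℤ) + 1 - ((i : ℤ) + 1) = n - i := by ring
      simp only [Nat.add_sub_cancel, qint_two]
      push_cast
      rw [e2, zpow_succ_sub]
      have c1 : v⁻¹ * (v * v ^ ((i : ℤ) - n) * qint ((i : ℤ) + 1) *
          (v * qint (i : ℤ) * qint ((n : ℤ) - i))) =
          v * (qint ((i : ℤ) + 1) * qint ((n : ℤ) - i) * (v ^ ((i : ℤ) - n) * qint (i : ℤ))) := by
        field_simp
      rw [c1, add_mul, add_mul, add_smul, add_smul]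
      abel
  case f_l_f.refine_1 =>
    have hi := qint_succ_ne_zero i
    have hi' := qint_succ_ne_zero (i + 1)
    rw [← add_smul, qint_two]
    push_cast at *
    congr 1
    field_simp
    ring
  case f_l_f.refine_2 =>
    rw [← add_smul, qint_two, add_comm v, add_mul]

/-! ### The modules `L⁺` over `MU_v(2)` -/

/-- Labels for the simple modules `L⁺(n,0)`, `L⁺(n,1)` and `L⁺(n,01)`. -/
inductive Label : Type
  | zero (n : ℕ) | one (n : ℕ) | mixed (n : ℕ)

/-- The index set of the standard basis. -/
def Label.Index : Label → Type
  | .zero n => Fin (n + 1)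
  | .one n => Fin (n + 1)
  | .mixed n => Fin n ⊕ Fin n

/-- The underlying `ℂ(v)`-vector space of `L⁺(n,0)`, `L⁺(n,1)` or `L⁺(n,01)`. -/
def L (t : Label) : Type := t.Index →₀ K

noncomputable instance (t : Label) : AddCommGroup (L t) :=
  inferInstanceAs (AddCommGroup (t.Index →₀ K))

noncomputable instance (t : Label) : Module K (L t) :=
  inferInstanceAs (Module K (t.Index →₀ K))

/-- The representation of `MU_v(2)` on `L⁺(n,0)`, `L⁺(n,1)` or `L⁺(n,01)`. -/
noncomputable def L.rep : (t : Label) → MU2 →ₐ[K] Module.End K (L t)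
  | .zero n => MU2.lift (opUniform 0 n) (opUniform_rel 0 (by simp) n)
  | .one n => MU2.lift (opUniform 1 n) (opUniform_rel 1 (by simp) n)
  | .mixed n => MU2.lift (opMixed n) (opMixed_rel n)

noncomputable instance (t : Label) : Module MU2 (L t) :=
  Module.compHom (L t) (L.rep t).toRingHom

theorem L.smul_def (t : Label) (a : MU2) (x : L t) : a • x = L.rep t a x := rfl

instance (t : Label) : SMulCommClass K MU2 (L t) where
  smul_comm c a x := by simp only [L.smul_def, map_smul]

instance (t : Label) : IsScalarTower K MU2 (L t) where
  smul_assoc c a x := by simp only [L.smul_def, map_smul, LinearMap.smul_apply]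

/-! ### Bipartitions and multiplicity spaces -/

/-- The set `Λ` of bipartitions `(λ, 1^s)` of `d` with `λ = (λ₁ ≥ λ₂ ≥ 0)` and `0 ≤ s ≤ 2`. -/
structure Bipartition (d : ℕ) where
  l1 : ℕ
  l2 : ℕ
  s : ℕ
  l2_le_l1 : l2 ≤ l1
  s_le_two : s ≤ 2
  size : l1 + l2 + s = d

/-- The label of `L⁺_{(λ,1^s)}`. -/
def Bipartition.label {d : ℕ} (b : Bipartition d) : Label :=
  match b.s with
  | 0 => .one (b.l1 - b.l2)
  | 1 => .mixed (b.l1 - b.l2 + 1)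
  | _ => .zero (b.l1 - b.l2)

/-- The Young diagram of `λ = (λ₁, λ₂)`. -/
def Bipartition.shape {d : ℕ} (b : Bipartition d) : YoungDiagram :=
  YoungDiagram.ofRowLens [b.l1, b.l2] (by
    rw [List.sortedGE_iff_pairwise]
    simp [b.l2_le_l1])

/-- Standard Young tableaux: bijective fillings of the cells `(i, j)` with `0, …, |μ| - 1`,
increasing along rows and down columns. -/
def StandardTableau (μ : YoungDiagram) : Type :=
  {T : μ.cells ≃ Fin μ.card //
    (∀ c c' : μ.cells, c.1.1 = c'.1.1 → c.1.2 < c'.1.2 → T c < T c') ∧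
    (∀ c c' : μ.cells, c.1.2 = c'.1.2 → c.1.1 < c'.1.1 → T c < T c')}

/-- The `ℂ(v)`-vector space `M^{(λ,1^s)}`, of dimension `(d choose s) f_λ`: its basis consists of
the pairs of an `s`-element subset of `{1,…,d}` and a standard tableau of shape `λ`. -/
abbrev M {d : ℕ} (b : Bipartition d) : Type :=
  ({S : Finset (Fin d) // S.card = b.s} × StandardTableau b.shape) →₀ K

end Mirabolic

open Mirabolic

namespace Mirabolic

section

/-! ### Weight representations of `U_v(sl₂)` -/

/-! The proof joins the representation theory of `MU_v(2)` with counting over finite fields; a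
dimension count closes the argument.

Representation theory. The relations `ℓeℓ = ℓe` and `ℓfℓ = fℓ` say that `e` preserves `ker ℓ` and
`f` preserves `im ℓ`. The components that cross over are `X = (1 - ℓ)e : im ℓ → ker ℓ` and `Y = ℓf :
ker ℓ → im ℓ`. The relations for `eℓe` and `fℓf` imply that on each weight space `XYX` and `YXY` are
powers of `v` times `X` and `Y` (`X_Y_X`, `Y_X_Y`). Hence each weight space splits into a part with
`ℓ = 1` and `X = 0`, a part with `ℓ = 0` and `Y = 0`, and a mixed part on which `X` and `Y` are
inverse up to a scalar. Each part is governed by a representation of `U_v(sl₂)` (`MURep.one`,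
`MURep.zero`, `MURep.mixed`); on the mixed part the operators are `vℓe` and `f` on the `ℓ = 1` half,
with weights shifted by one. Highest weight theory then shows that images of the simple modules span
(`mem_of_simpleMap_mem`), and that the dimension of a space of highest weight vectors is a
difference of two weight multiplicities (`finrank_P`). As `sl₂` weights are symmetric, the
dimensions of the `ℓ = 1` weight spaces alone determine the `one` and mixed parts (`finrank_mixed`).

Geometry. On functions of a subspace `W` and a vector `x`, the generators `e`, `f`, `ℓ` are, up to
powers of `v`, sums over hyperplanes of `W`, over subspaces covering `W`, and over translates of `x`
by `W`. The defining relations become elementary counts (`opE_opF_sub`, `opE_opA_opE`,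
`opF_opA_opF`). Relative positions are characterised by ranks and memberships
(`inOrbit_iff_hasType`), so the structure constants are polynomials in `q` by inclusion-exclusion
(`exists_poly_e`, `exists_poly_f`, `exists_poly_a`). Identities valid at all primes are polynomial
identities (`mat_ext`) and may be specialised at `q = v²` (`genMat_rel`). Since `ℓ` is idempotent,
the dimension of its image in a weight space is a trace, computed by a bijection in `sum_matA_diag`.

Conclusion. The highest weight spaces have the dimensions of the multiplicity spaces, because
numbers of two-row tableaux are differences of binomial coefficients (`card_standardTableau`). The
resulting map from the direct sum is onto by spanning, and it is injective because the total
dimensions agree (`finrank_directSum`, `card_XiMT`). Complete reducibility thus needs no separate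
argument (`exists_equiv`). -/

theorem qint_ne_zero {m : ℤ} (hm : m ≠ 0) : qint m ≠ 0 := by
  rcases lt_or_gt_of_ne hm with h | h
  · obtain ⟨i, hi⟩ : ∃ i : ℕ, m = -((i : ℤ) + 1) := ⟨(-m - 1).toNat, by omega⟩
    have h2 : qint m = -qint ((i : ℤ) + 1) := by
      rw [hi, qint, qint, neg_neg, ← neg_div]; congr 1; ring
    rw [h2]
    exact neg_ne_zero.mpr (qint_succ_ne_zero i)
  · obtain ⟨i, rfl⟩ : ∃ i : ℕ, m = (i : ℤ) + 1 := ⟨(m - 1).toNat, by omega⟩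
    exact qint_succ_ne_zero i

theorem qint_neg (m : ℤ) : qint (-m) = -qint m := by
  rw [qint, qint, neg_neg, ← neg_div]; congr 1; ring

/-- This is `qint_identity` with its right-hand side read as a quantum integer; it drives the
induction in `E_F_pow`. -/
theorem qint_rec (x y : ℤ) :
    qint (x + 1) * qint (y - x) = qint x * qint (y + 1 - x) + qint (y - 2 * x) := by
  have h := qint_identity x y
  have h2 : qint (y - 2 * x) = (v - v⁻¹)⁻¹ * (v ^ (y - 2 * x) - v ^ (2 * x - y)) := by
    rw [qint, div_eq_inv_mul]; congr 3; ring
  rw [h2]; linear_combination h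

/-- Bounded weight spaces inside a vector space, with operators satisfying the relations of
`U_v(sl₂)` on them. -/
structure WeightRep (N : Type*) [AddCommGroup N] [Module K N] where
  W : ℤ → Submodule K N
  E : N →ₗ[K] N
  F : N →ₗ[K] N
  E_mem : ∀ {n x}, x ∈ W n → E x ∈ W (n + 2)
  F_mem : ∀ {n x}, x ∈ W n → F x ∈ W (n - 2)
  comm : ∀ {n x}, x ∈ W n → E (F x) - F (E x) = qint n • x
  B : ℤ
  bound : ∀ n, B < |n| → W n = ⊥

namespace WeightRep

variable {N : Type*} [AddCommGroup N] [Module K N] (R : WeightRep N)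

/-- Exchanging `E` and `F`. -/
noncomputable def flip : WeightRep N where
  W n := R.W (-n)
  E := R.F
  F := R.E
  E_mem {n x} h := by have := R.F_mem h; rwa [show -n - 2 = -(n + 2) by ring] at this
  F_mem {n x} h := by have := R.E_mem h; rwa [show -n + 2 = -(n - 2) by ring] at this
  comm {n x} h := by rw [← neg_sub, R.comm h, qint_neg, neg_smul, neg_neg]
  B := R.B
  bound n h := R.bound _ (by rwa [abs_neg])

/-- Highest weight vectors of weight `n`. -/
noncomputable def P (n : ℤ) : Submodule K N := R.W n ⊓ LinearMap.ker R.E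

theorem mem_P {n : ℤ} {x : N} : x ∈ R.P n ↔ x ∈ R.W n ∧ R.E x = 0 := Iff.rfl

theorem F_pow_mem {n : ℤ} {x : N} (h : x ∈ R.W n) (i : ℕ) : (R.F ^ i) x ∈ R.W (n - 2 * i) := by
  induction i with
  | zero => simpa using h
  | succ i ih =>
    rw [pow_succ', Module.End.mul_apply]
    have := R.F_mem ih
    convert this using 2
    push_cast; ring

theorem E_pow_mem {n : ℤ} {x : N} (h : x ∈ R.W n) (i : ℕ) : (R.E ^ i) x ∈ R.W (n + 2 * i) := by
  have := R.flip.F_pow_mem (n := -n) (x := x) (by simpa [flip] using h) i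
  simpa [flip, add_comm] using this

theorem E_F_pow {n : ℤ} {w : N} (hw : w ∈ R.P n) (i : ℕ) :
    R.E ((R.F ^ (i + 1)) w) = (qint ((i : ℤ) + 1) * qint (n - i)) • (R.F ^ i) w := by
  obtain ⟨h1, h2⟩ := R.mem_P.mp hw
  induction i with
  | zero =>
    have := R.comm h1
    rw [h2, map_zero, sub_zero] at this
    have h1' := qint_rec 0 n
    simp only [qint_zero, zero_mul, mul_zero, zero_add, sub_zero] at h1'
    simp [this, h1']
  | succ i ih =>
    have h3 := R.comm (R.F_pow_mem h1 (i + 1))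
    have e1 (t : ℕ) : R.F ((R.F ^ t) w) = (R.F ^ (t + 1)) w := by
      rw [pow_succ', Module.End.mul_apply]
    rw [ih, map_smul, e1, e1, sub_eq_iff_eq_add, ← add_smul] at h3
    rw [h3]
    congr 1
    have := qint_rec ((i : ℤ) + 1) n
    push_cast
    rw [this, show n + 1 - ((i : ℤ) + 1) = n - i by ring]
    ring

/-- Iterating `E_F_pow` gives factors `[t + 1][n - t]` with `i ≤ t < i + j`, and such a factor
vanishes only when `n = t`. -/
theorem E_pow_F_pow {n : ℤ} {w : N} (hw : w ∈ R.P n) (i j : ℕ)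
    (h : ∀ t : ℕ, t < i + j → n ≠ t) :
    ∃ c : K, c ≠ 0 ∧ (R.E ^ j) ((R.F ^ (i + j)) w) = c • (R.F ^ i) w := by
  induction j with
  | zero => exact ⟨1, one_ne_zero, by simp⟩
  | succ j ih =>
    obtain ⟨c, hc, h1⟩ := ih fun t ht => h t (by omega)
    refine ⟨(qint (((i + j : ℕ) : ℤ) + 1) * qint (n - (i + j : ℕ))) * c,
      mul_ne_zero (mul_ne_zero (qint_succ_ne_zero _) (qint_ne_zero ?_)) hc, ?_⟩
    · have := h (i + j) (by omega); omega
    · rw [pow_succ, Module.End.mul_apply, ← add_assoc, R.E_F_pow hw, map_smul, h1, smul_smul]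

/-- For negative `n` no factor of `E ^ j F ^ j w` vanishes, while `F ^ j w` leaves the bounded range
of weights for large `j`. -/
theorem P_eq_zero_of_neg {n : ℤ} (hn : n < 0) {w : N} (hw : w ∈ R.P n) : w = 0 := by
  set j := (R.B + |n| + 1).toNat with hj
  obtain ⟨c, hc, h⟩ := R.E_pow_F_pow hw 0 j (fun t _ => by omega)
  have h2 := R.F_pow_mem hw.1 j
  rw [R.bound (n - 2 * j) (by
    rw [abs_of_neg (by omega)]; have := neg_abs_le n; have := le_abs_self n; omega),
    Submodule.mem_bot] at h2
  rw [zero_add, h2, map_zero, pow_zero, Module.End.one_apply] at h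
  exact (smul_eq_zero.mp h.symm).resolve_left hc

/-- By `E_F_pow` the vector `F ^ (n + 1) w` is again killed by `E`, the coefficient containing
`[0]`; its weight `-n - 2` is negative. -/
theorem F_pow_eq_zero {n : ℤ} {w : N} (hw : w ∈ R.P n) {i : ℕ} (hi : n < i) :
    (R.F ^ i) w = 0 := by
  by_cases hn : n < 0
  · rw [R.P_eq_zero_of_neg hn hw, map_zero]
  obtain ⟨m, rfl⟩ : ∃ m : ℕ, n = m := ⟨n.toNat, by omega⟩
  have h0 : (R.F ^ (m + 1)) w = 0 := by
    refine R.P_eq_zero_of_neg (n := (m : ℤ) - 2 * (m + 1 : ℕ)) (by push_cast; omega)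
      (R.mem_P.mpr ⟨R.F_pow_mem hw.1 _, ?_⟩)
    rw [R.E_F_pow hw, sub_self, qint_zero, mul_zero, zero_smul]
  obtain ⟨j, rfl⟩ : ∃ j, i = j + (m + 1) := ⟨i - (m + 1), by omega⟩
  rw [pow_add, Module.End.mul_apply, h0, map_zero]

/-- The span of the vectors `F ^ i w` of weight `m`, with `w` a highest weight vector. -/
noncomputable def desc (m : ℤ) : Submodule K N :=
  -- The condition `0 ≤ m + i` says that `i` is at most the highest weight `m + 2 * i`; beyond that
  -- `F ^ i w` vanishes.
  ⨆ i : {i : ℕ // 0 ≤ m + i}, (R.P (m + 2 * (i : ℕ))).map (R.F ^ (i : ℕ))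

theorem F_pow_mem_desc {m n : ℤ} {w : N} (hw : w ∈ R.P n) (i : ℕ) (h : n = m + 2 * i)
    (h0 : 0 ≤ m + i) : (R.F ^ i) w ∈ R.desc m :=
  Submodule.mem_iSup_of_mem (p := fun i : {i : ℕ // 0 ≤ m + i} =>
    (R.P (m + 2 * (i : ℕ))).map (R.F ^ (i : ℕ))) ⟨i, h0⟩ ⟨w, by subst h; exact hw, rfl⟩

/-- Induction on `k` with `E ^ k x = 0`. The last power not known to vanish is a highest weight
vector, and subtracting a multiple of `F ^ k (E ^ k x)` from `x` kills it. The scalar of `E ^ k F ^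
k` is nonzero because the highest weight `m + 2 * k` is at least `k`. -/
theorem le_desc_of_nonneg {m : ℤ} (hm : 0 ≤ m) : R.W m ≤ R.desc m := by
  have key : ∀ (k : ℕ) (x : N), x ∈ R.W m → (R.E ^ k) x = 0 → x ∈ R.desc m := by
    intro k
    induction k with
    | zero => intro x _ h; simp only [pow_zero, Module.End.one_apply] at h; rw [h]; exact zero_mem _
    | succ k ih =>
      intro x hx h
      have hw : (R.E ^ k) x ∈ R.P (m + 2 * k) := by
        refine R.mem_P.mpr ⟨R.E_pow_mem hx k, ?_⟩
        rw [← Module.End.mul_apply, ← pow_succ', h]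
      obtain ⟨c, hc, h1⟩ := R.E_pow_F_pow hw 0 k (fun t ht => by omega)
      rw [zero_add, pow_zero, Module.End.one_apply] at h1
      have h2 := R.F_pow_mem_desc hw k rfl (by omega)
      have h3 : x - c⁻¹ • (R.F ^ k) ((R.E ^ k) x) ∈ R.desc m := by
        refine ih _ (sub_mem hx (Submodule.smul_mem _ _ ?_)) ?_
        · have := R.F_pow_mem hw.1 k
          rwa [add_sub_cancel_right] at this
        · rw [map_sub, map_smul, h1, smul_smul, inv_mul_cancel₀ hc, one_smul, sub_self]
      have := add_mem h3 (Submodule.smul_mem _ c⁻¹ h2)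
      rwa [sub_add_cancel] at this
  intro x hx
  refine key (R.B + 1).toNat x hx ?_
  have := R.E_pow_mem hx (R.B + 1).toNat
  rwa [R.bound _ (by rw [abs_of_nonneg (by omega)]; omega), Submodule.mem_bot] at this

/-- For `m < 0`, exchanging `E` and `F` reduces to vectors `E ^ i u` with `u` a lowest weight
vector. If `u` has weight `-M`, then `E ^ M u` is a highest weight vector and `u` is a multiple of
`F ^ M (E ^ M u)`, so `E ^ i u` is a multiple of `F ^ (M - i) (E ^ M u)`. -/
theorem le_desc (m : ℤ) : R.W m ≤ R.desc m := by
  by_cases hm : 0 ≤ m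
  · exact R.le_desc_of_nonneg hm
  have h := R.flip.le_desc_of_nonneg (m := -m) (by omega)
  have e1 : R.flip.W (-m) = R.W m := by simp [flip]
  rw [e1] at h
  refine h.trans (iSup_le ?_)
  rintro ⟨i, hi⟩
  rw [Submodule.map_le_iff_le_comap]
  intro u hu
  obtain ⟨M, hM⟩ : ∃ M : ℕ, -m + 2 * (i : ℤ) = M := ⟨(-m + 2 * (i : ℤ)).toNat, by omega⟩
  obtain ⟨j, hj⟩ : ∃ j : ℕ, M = j + i := ⟨M - i, by omega⟩
  simp only at hu hM
  rw [hM] at hu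
  have hu1 : u ∈ R.W (-(M : ℤ)) := hu.1
  have hw : (R.E ^ M) u ∈ R.P M := by
    refine R.mem_P.mpr ⟨?_, ?_⟩
    · have := R.E_pow_mem hu1 M
      rwa [show -(M : ℤ) + 2 * M = M by ring] at this
    · have := R.flip.F_pow_eq_zero hu (i := M + 1) (by push_cast; omega)
      rw [← Module.End.mul_apply, ← pow_succ']
      exact this
  obtain ⟨c, hc, h1⟩ := R.flip.E_pow_F_pow hu 0 M (fun t ht => by omega)
  rw [zero_add, pow_zero, Module.End.one_apply] at h1
  change (R.F ^ M) ((R.E ^ M) u) = c • u at h1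
  obtain ⟨c', -, h2⟩ := R.E_pow_F_pow hw j i (fun t ht => by omega)
  rw [← hj, h1, map_smul] at h2
  have h3 : (R.E ^ i) u = (c⁻¹ * c') • (R.F ^ j) ((R.E ^ M) u) := by
    rw [mul_smul, ← h2, smul_smul, inv_mul_cancel₀ hc, one_smul]
  change (R.E ^ i) u ∈ R.desc m
  rw [h3]
  exact Submodule.smul_mem _ _ (R.F_pow_mem_desc hw j (by omega) (by omega))

/-- Each `F ^ i w` of weight `n + 2` is a multiple of `E (F ^ (i + 1) w)`, the coefficient `[i +
1][n + 2 + i]` being nonzero because `n ≥ -1`. -/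
theorem map_E_eq {n : ℤ} (hn : -1 ≤ n) : (R.W n).map R.E = R.W (n + 2) := by
  apply le_antisymm
  · rintro _ ⟨x, hx, rfl⟩
    exact R.E_mem hx
  refine (R.le_desc _).trans (iSup_le ?_)
  rintro ⟨i, hi⟩ _ ⟨w, hw, rfl⟩
  have h := R.E_F_pow hw i
  have hc : qint ((i : ℤ) + 1) * qint (n + 2 + 2 * i - i) ≠ 0 :=
    mul_ne_zero (qint_succ_ne_zero _) (qint_ne_zero (by omega))
  refine ⟨(qint ((i : ℤ) + 1) * qint (n + 2 + 2 * i - i))⁻¹ • (R.F ^ (i + 1)) w,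
    Submodule.smul_mem _ _ ?_, ?_⟩
  · have := R.F_pow_mem hw.1 (i + 1)
    convert this using 2; push_cast; ring
  · rw [map_smul, h, smul_smul, inv_mul_cancel₀ hc, one_smul]

/-- Rank-nullity for `E : W n → W (n + 2)`, which is onto by `map_E_eq`. -/
theorem finrank_P [FiniteDimensional K N] {n : ℤ} (hn : -1 ≤ n) :
    Module.finrank K (R.P n) + Module.finrank K (R.W (n + 2)) = Module.finrank K (R.W n) := by
  have h := LinearMap.finrank_range_add_finrank_ker (R.E.domRestrict (R.W n))
  have h1 : LinearMap.range (R.E.domRestrict (R.W n)) = R.W (n + 2) := by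
    rw [LinearMap.range_domRestrict, R.map_E_eq hn]
  have h2 : Module.finrank K (LinearMap.ker (R.E.domRestrict (R.W n))) =
      Module.finrank K (R.P n) := by
    have h3 : LinearMap.ker (R.E.domRestrict (R.W n)) = (R.P n).comap (R.W n).subtype := by
      ext x
      simp [mem_P]
    rw [h3]
    exact (Submodule.comapSubtypeEquivOfLe inf_le_left).finrank_eq
  rw [← h, h1, h2, add_comm]

/-- In weight `-n` only the vectors `F ^ i w` with `i ≥ n` occur, and these lie in `F ^ n (W n)`. -/
theorem finrank_neg_le [FiniteDimensional K N] (n : ℕ) :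
    Module.finrank K (R.W (-(n : ℤ))) ≤ Module.finrank K (R.W n) := by
  have h : R.W (-(n : ℤ)) ≤ (R.W n).map (R.F ^ n) := by
    refine (R.le_desc _).trans (iSup_le ?_)
    rintro ⟨i, hi⟩ _ ⟨w, hw, rfl⟩
    obtain ⟨j, rfl⟩ : ∃ j, i = n + j := ⟨i - n, by omega⟩
    refine ⟨(R.F ^ j) w, ?_, by rw [pow_add, Module.End.mul_apply]⟩
    have := R.F_pow_mem hw.1 j
    push_cast at this
    rwa [show -(n : ℤ) + 2 * (n + j) - 2 * j = n by ring] at this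
  exact (Submodule.finrank_mono h).trans (Submodule.finrank_map_le _ _)

theorem finrank_neg [FiniteDimensional K N] (n : ℤ) :
    Module.finrank K (R.W (-n)) = Module.finrank K (R.W n) := by
  have key : ∀ n : ℕ, Module.finrank K (R.W (-(n : ℤ))) = Module.finrank K (R.W n) := by
    intro n
    refine le_antisymm (R.finrank_neg_le n) ?_
    have := R.flip.finrank_neg_le n
    change Module.finrank K (R.W (- -(n : ℤ))) ≤ _ at this
    rwa [neg_neg] at this
  obtain ⟨m, rfl | rfl⟩ := n.eq_nat_or_neg
  · exact key m
  · rw [neg_neg]; exact (key m).symm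

end WeightRep

end

section

/-! ### Representations of `MU_v(2)` with bounded weights -/

/-- In the mixed piece the eigenvalue of `YX` contributes the first term, which completes `v [m -
1]` to `[m]`. -/
theorem qint_shift (m : ℤ) : v ^ (1 - m) + v * qint (m - 1) = qint m := by
  have h0 := v_ne_zero
  have h1 := v_sub_inv_ne_zero
  have ha : v ^ m ≠ 0 := zpow_ne_zero _ h0
  simp only [qint, neg_sub, zpow_sub₀ h0, zpow_neg, zpow_one]
  generalize v ^ m = a at *
  generalize hD : v - v⁻¹ = D at *
  field_simp
  rw [← hD]
  field_simp
  ring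

/-- The source of the scalars in `X_Y_X` and `Y_X_Y`. -/
theorem qint_add_two_sub (m : ℤ) :
    qint (m + 2) - v ^ 2 * qint m = (1 + v ^ 2) * v ^ (-1 - m) := by
  have h0 := v_ne_zero
  have h1 := v_sub_inv_ne_zero
  have ha : v ^ m ≠ 0 := zpow_ne_zero _ h0
  simp only [qint, neg_add_rev, zpow_sub₀ h0, zpow_add₀ h0, zpow_neg, zpow_ofNat]
  generalize v ^ m = a at *
  generalize hD : v - v⁻¹ = D at *
  field_simp
  rw [← hD]
  field_simp
  ring

theorem one_add_v_sq_ne_zero : 1 + v ^ 2 ≠ 0 := by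
  intro h
  exact v_pow_ne_one 4 (by norm_num) (by linear_combination (v ^ 2 - 1) * h)

/-- Operators satisfying the relations of `MU_v(2)` with bounded `k`-weights. -/
structure MURep (N : Type*) [AddCommGroup N] [Module K N] where
  φ : Gen → Module.End K N
  rel : ∀ ⦃a b⦄, Rel a b → FreeAlgebra.lift K φ a = FreeAlgebra.lift K φ b
  B : ℤ
  bound : ∀ n, B < |n| → ∀ x, φ Gen.k x = v ^ n • x → x = 0

namespace MURep

variable {N : Type*} [AddCommGroup N] [Module K N] (R : MURep N)

/-- The action of `e`. -/
abbrev e : Module.End K N := R.φ Gen.e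
/-- The action of `f`. -/
abbrev f : Module.End K N := R.φ Gen.f
/-- The action of `k`. -/
abbrev k : Module.End K N := R.φ Gen.k
/-- The action of `k⁻¹`. -/
abbrev kinv : Module.End K N := R.φ Gen.kinv
/-- The action of `ℓ`. -/
abbrev l : Module.End K N := R.φ Gen.l

theorem rel_apply {a b : FreeAlgebra K Gen} (h : Rel a b) (x : N) :
    FreeAlgebra.lift K R.φ a x = FreeAlgebra.lift K R.φ b x := by rw [R.rel h]

theorem kinv_k (x : N) : R.kinv (R.k x) = x := by
  simpa [Free.k, Free.kinv] using R.rel_apply Rel.kinv_k x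

theorem k_e (x : N) : R.k (R.e x) = v ^ 2 • R.e (R.k x) := by
  have := R.rel_apply Rel.k_e (R.k x)
  simpa [Free.k, Free.kinv, Free.e, R.kinv_k] using this

theorem k_f (x : N) : R.k (R.f x) = v ^ (-2 : ℤ) • R.f (R.k x) := by
  have := R.rel_apply Rel.k_f (R.k x)
  simpa [Free.k, Free.kinv, Free.f, R.kinv_k] using this

theorem l_l (x : N) : R.l (R.l x) = R.l x := by
  simpa [Free.l] using R.rel_apply Rel.l_l x

theorem k_l (x : N) : R.k (R.l x) = R.l (R.k x) := by
  simpa [Free.l, Free.k] using R.rel_apply Rel.k_l x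

theorem l_e_l (x : N) : R.l (R.e (R.l x)) = R.l (R.e x) := by
  simpa [Free.l, Free.e] using R.rel_apply Rel.l_e_l x

theorem l_f_l (x : N) : R.l (R.f (R.l x)) = R.f (R.l x) := by
  simpa [Free.l, Free.f] using R.rel_apply Rel.l_f_l x

theorem e_l_e (x : N) :
    qint 2 • R.e (R.l (R.e x)) = v⁻¹ • R.e (R.e (R.l x)) + v • R.l (R.e (R.e x)) := by
  simpa [Free.l, Free.e] using R.rel_apply Rel.e_l_e x

theorem f_l_f (x : N) :
    qint 2 • R.f (R.l (R.f x)) = v⁻¹ • R.l (R.f (R.f x)) + v • R.f (R.f (R.l x)) := by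
  simpa [Free.l, Free.f] using R.rel_apply Rel.f_l_f x

theorem kinv_of_wt {n : ℤ} {x : N} (h : R.k x = v ^ n • x) : R.kinv x = v ^ (-n) • x := by
  have h1 := R.kinv_k x
  rw [h, map_smul] at h1
  rw [← h1, smul_smul, ← zpow_add₀ v_ne_zero, h1]
  simp

theorem e_f {n : ℤ} {x : N} (h : R.k x = v ^ n • x) :
    R.e (R.f x) = R.f (R.e x) + qint n • x := by
  have := R.rel_apply Rel.e_f x
  simp only [Free.e, Free.f, Free.k, Free.kinv, map_sub, map_mul, map_smul,
    FreeAlgebra.lift_ι_apply, LinearMap.sub_apply, LinearMap.smul_apply, Module.End.mul_apply]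
    at this
  change R.e (R.f x) - R.f (R.e x) = (v - v⁻¹)⁻¹ • (R.k x - R.kinv x) at this
  rw [h, R.kinv_of_wt h, ← sub_smul, smul_smul, ← div_eq_inv_mul] at this
  rw [qint, ← this]; abel

theorem wt_e {n : ℤ} {x : N} (h : R.k x = v ^ n • x) : R.k (R.e x) = v ^ (n + 2) • R.e x := by
  rw [R.k_e, h, map_smul, smul_smul, add_comm, zpow_add₀ v_ne_zero]; rfl

theorem wt_f {n : ℤ} {x : N} (h : R.k x = v ^ n • x) : R.k (R.f x) = v ^ (n - 2) • R.f x := by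
  rw [R.k_f, h, map_smul, smul_smul, sub_eq_neg_add, zpow_add₀ v_ne_zero]

theorem wt_l {n : ℤ} {x : N} (h : R.k x = v ^ n • x) : R.k (R.l x) = v ^ n • R.l x := by
  rw [R.k_l, h, map_smul]

/-- The component `im ℓ → ker ℓ` of `e`. -/
noncomputable def X : Module.End K N := R.e - R.l * R.e

/-- The component `ker ℓ → im ℓ` of `f`. -/
noncomputable def Y : Module.End K N := R.l * R.f

theorem X_apply (x : N) : R.X x = R.e x - R.l (R.e x) := rfl

theorem Y_apply (x : N) : R.Y x = R.l (R.f x) := rfl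

theorem wt_X {n : ℤ} {x : N} (h : R.k x = v ^ n • x) : R.k (R.X x) = v ^ (n + 2) • R.X x := by
  rw [X_apply, map_sub, R.wt_l (R.wt_e h), R.wt_e h, smul_sub]

theorem wt_Y {n : ℤ} {x : N} (h : R.k x = v ^ n • x) : R.k (R.Y x) = v ^ (n - 2) • R.Y x :=
  R.wt_l (R.wt_f h)

theorem l_X (x : N) : R.l (R.X x) = 0 := by rw [X_apply, map_sub, R.l_l, sub_self]

theorem l_Y (x : N) : R.l (R.Y x) = R.Y x := R.l_l _

theorem l_e_of_ker {x : N} (h : R.l x = 0) : R.l (R.e x) = 0 := by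
  rw [← R.l_e_l, h, map_zero, map_zero]

theorem l_f_of_im {x : N} (h : R.l x = x) : R.l (R.f x) = R.f x := by
  have := R.l_f_l x
  rwa [h] at this

/-- On `im ℓ` the relation for `eℓe`, multiplied by `v` and combined with `ℓeℓ = ℓe`, reads `(v² +
1) eℓe x = e² x + v² ℓeℓe x`; solve for `e² x`. -/
theorem e_X {x : N} (h : R.l x = x) : R.e (R.X x) = v ^ 2 • R.X (R.l (R.e x)) := by
  have h1 := R.e_l_e x
  have h2 : R.l (R.e (R.e x)) = R.l (R.e (R.l (R.e x))) := (R.l_e_l _).symm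
  rw [h, h2, qint_two] at h1
  have h0 := v_ne_zero
  rw [X_apply, X_apply, map_sub]
  have h3 : R.e (R.e x) = v • (v⁻¹ • R.e (R.e x)) := by
    rw [smul_smul, mul_inv_cancel₀ h0, one_smul]
  rw [h3, eq_sub_of_add_eq h1.symm, ← sub_eq_zero]
  simp only [smul_sub, smul_add, add_smul, smul_smul, mul_inv_cancel₀ h0, ← pow_two, one_smul]
  abel

/-- The mirror image of `e_X`, from the relation for `fℓf` on `ker ℓ`. -/
theorem Y_f {x : N} (h : R.l x = 0) : R.Y (R.f x - R.Y x) = v ^ 2 • R.f (R.Y x) := by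
  have h1 := R.f_l_f x
  rw [h, map_zero, map_zero, smul_zero, add_zero, qint_two] at h1
  have h0 := v_ne_zero
  have h2 : R.l (R.f (R.Y x)) = R.f (R.Y x) := R.l_f_of_im (R.l_Y x)
  rw [map_sub, Y_apply, Y_apply _ (R.Y x), h2]
  have h3 : R.l (R.f (R.f x)) = v • (v⁻¹ • R.l (R.f (R.f x))) := by
    rw [smul_smul, mul_inv_cancel₀ h0, one_smul]
  rw [h3, ← h1, Y_apply]
  have h4 : v * (v + v⁻¹) = v ^ 2 + 1 := by field_simp
  rw [smul_smul, h4, add_smul, one_smul, add_sub_cancel_right]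

/-- `f₀ X = X f₁`. -/
theorem X_f {n : ℤ} {x : N} (hx : R.k x = v ^ n • x) (h : R.l x = x) :
    R.X (R.f x) = R.f (R.X x) - R.Y (R.X x) := by
  have h1 : R.l (R.f (R.l (R.e x))) = R.f (R.l (R.e x)) := R.l_f_l _
  simp only [X_apply, Y_apply, R.e_f hx, map_add, map_sub, map_smul, h, h1]
  abel

/-- `e₁ Y = Y e₀`. -/
theorem l_e_Y {n : ℤ} {x : N} (hx : R.k x = v ^ n • x) (h : R.l x = 0) :
    R.l (R.e (R.Y x)) = R.Y (R.e x) := by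
  rw [Y_apply, R.l_e_l, R.e_f hx, map_add, map_smul, h, smul_zero, add_zero, Y_apply]

/-- Put `y = X x` and compute `e f y` in two ways: as `f e y + [n + 2] y`, and through `f y = Y y +
X f x`. The `ker ℓ` component of the resulting identity is `(1 + v²) X Y y = ([n + 2] - v² [n]) y`.
Consequently a multiple of `YX` is a projection on each weight space of `im ℓ`. -/
theorem X_Y_X {n : ℤ} {x : N} (hx : R.k x = v ^ n • x) (h : R.l x = x) :
    R.X (R.Y (R.X x)) = v ^ (-1 - n) • R.X x := by
  set y := R.X x with hy
  set p := R.l (R.e x) with hp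
  have hlp : R.l p = p := R.l_l _
  have hkp : R.k p = v ^ (n + 2) • p := R.wt_l (R.wt_e hx)
  have hex : R.e x = p + y := by rw [hy, X_apply]; abel
  have h1 : R.e (R.f y) = R.f (R.e y) + qint (n + 2) • y := R.e_f (R.wt_X hx)
  have h2 : R.f y = R.Y y + R.X (R.f x) := by rw [R.X_f hx h]; abel
  have h3 : R.e (R.X (R.f x)) = v ^ 2 • (R.X (R.f p) + R.X (R.Y y) + qint n • y) := by
    rw [R.e_X (R.l_f_of_im h), R.e_f hx, hex]
    simp only [map_add, map_smul, h]
    rw [R.l_f_of_im hlp, ← R.Y_apply]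
  have h4 : R.e y = v ^ 2 • R.X p := R.e_X h
  have h5 : R.f (R.X p) = R.X (R.f p) + R.Y (R.X p) := by rw [R.X_f hkp hlp]; abel
  rw [h2, map_add, h3, h4, map_smul, h5] at h1
  -- Applying `1 - ℓ` kills the terms in `im ℓ` and turns `e (Y y)` into `X (Y y)`.
  have h6 := congrArg (fun z => z - R.l z) h1
  have h7 : R.e (R.Y y) - R.l (R.e (R.Y y)) = R.X (R.Y y) := rfl
  have hly : R.l y = 0 := R.l_X x
  simp only [map_add, map_smul, R.l_X, R.l_Y, hly, smul_zero, add_zero, zero_add,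
    smul_add] at h6
  have h8 : (1 + v ^ 2) • R.X (R.Y y) = ((1 + v ^ 2) * v ^ (-1 - n)) • y := by
    rw [← qint_add_two_sub, sub_smul, add_smul, one_smul, ← h7, mul_smul]
    rw [← sub_eq_zero] at h6 ⊢
    rw [← h6, ← h7]
    simp only [smul_sub]
    abel_nf
  rw [mul_smul] at h8
  exact smul_right_injective _ one_add_v_sq_ne_zero h8

/-- The counterpart on `ker ℓ`: with `g = f x - Y x`, evaluate `Y e g` once as `ℓ e Y g` using
`Y_f`, and once by expanding `e g`. -/
theorem Y_X_Y {n : ℤ} {x : N} (hx : R.k x = v ^ n • x) (h : R.l x = 0) :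
    R.Y (R.X (R.Y x)) = v ^ (1 - n) • R.Y x := by
  set y := R.Y x with hy
  set g := R.f x - y with hg
  have hly : R.l y = y := R.l_Y x
  have hlg : R.l g = 0 := by rw [hg, map_sub, hly, hy, Y_apply, sub_self]
  have hkg : R.k g = v ^ (n - 2) • g := by
    rw [hg, map_sub, R.wt_f hx, hy, R.wt_Y hx, smul_sub]
  have hlex := R.l_e_of_ker h
  have hp : R.l (R.e y) = R.Y (R.e x) := R.l_e_Y hx h
  have hey : R.e y = R.Y (R.e x) + R.X y := by rw [X_apply, hp]; abel
  have h1 := congrArg R.l (R.e_f (R.wt_Y hx))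
  rw [← hy, hey] at h1
  simp only [map_add, map_smul, hly] at h1
  rw [R.l_f_of_im (R.l_Y _), ← R.Y_apply (R.X y)] at h1
  have h2 : R.Y (R.e g) = v ^ 2 • R.l (R.e (R.f y)) := by
    rw [← R.l_e_Y hkg hlg, R.Y_f h, map_smul, map_smul]
  have h3 := R.Y_f hlex
  have h4 : R.e g = R.f (R.e x) - R.Y (R.e x) + qint n • x - R.X y := by
    rw [hg, map_sub, R.e_f hx, hey]; abel
  rw [h4, map_sub, map_add, h3, map_smul, h1, ← hy] at h2
  have h5 := qint_add_two_sub (n - 2)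
  rw [sub_add_cancel, show -1 - (n - 2) = 1 - n by ring] at h5
  refine smul_right_injective _ one_add_v_sq_ne_zero ?_
  simp only
  rw [smul_smul, ← h5]
  rw [sub_smul, add_smul, one_smul, mul_smul]
  simp only [smul_add] at h2
  rw [← sub_eq_zero] at h2 ⊢
  rw [← neg_eq_zero, ← h2]
  abel

/-! ### The three pieces of a representation -/

/-- The part of weight `n` and `ℓ`-eigenvalue `ε`. -/
def D (ε : K) (n : ℤ) : Submodule K N where
  carrier := {x | R.k x = v ^ n • x ∧ R.l x = ε • x}
  add_mem' {x y} hx hy := by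
    constructor
    · rw [map_add, hx.1, hy.1, smul_add]
    · rw [map_add, hx.2, hy.2, smul_add]
  zero_mem' := by simp
  smul_mem' c x hx := by
    constructor
    · rw [map_smul, hx.1, smul_comm]
    · rw [map_smul, hx.2, smul_comm]

theorem mem_D_one {n : ℤ} {x : N} : x ∈ R.D 1 n ↔ R.k x = v ^ n • x ∧ R.l x = x := by
  change _ ∧ _ ↔ _
  rw [one_smul]

theorem mem_D_zero {n : ℤ} {x : N} : x ∈ R.D 0 n ↔ R.k x = v ^ n • x ∧ R.l x = 0 := by
  change _ ∧ _ ↔ _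
  rw [zero_smul]

theorem X_eq_zero {x : N} (h : R.X x = 0) : R.l (R.e x) = R.e x := (sub_eq_zero.mp h).symm

/-- The largest subrepresentation on which `ℓ` is `1`. -/
noncomputable def one : WeightRep N where
  W n := R.D 1 n ⊓ LinearMap.ker R.X
  E := R.e
  F := R.f
  E_mem {n x} h := by
    obtain ⟨h1, h3 : R.X x = 0⟩ := h
    obtain ⟨h1, h2⟩ := R.mem_D_one.mp h1
    have h4 := R.X_eq_zero h3
    refine ⟨R.mem_D_one.mpr ⟨R.wt_e h1, h4⟩, ?_⟩
    have h5 := R.e_X h2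
    rw [h3, map_zero, h4] at h5
    exact (smul_eq_zero.mp h5.symm).resolve_left (pow_ne_zero _ v_ne_zero)
  F_mem {n x} h := by
    obtain ⟨h1, h3 : R.X x = 0⟩ := h
    obtain ⟨h1, h2⟩ := R.mem_D_one.mp h1
    refine ⟨R.mem_D_one.mpr ⟨R.wt_f h1, R.l_f_of_im h2⟩, ?_⟩
    change R.X (R.f x) = 0
    rw [R.X_f h1 h2, h3, map_zero, map_zero, sub_zero]
  comm {n x} h := by rw [R.e_f h.1.1, add_sub_cancel_left]
  B := R.B
  bound n hn := (Submodule.eq_bot_iff _).mpr fun x hx => R.bound n hn x hx.1.1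

/-- The largest subrepresentation on which `ℓ` is `0`. -/
noncomputable def zero : WeightRep N where
  W n := R.D 0 n ⊓ LinearMap.ker R.Y
  E := R.e
  F := R.f
  E_mem {n x} h := by
    obtain ⟨h1, h3 : R.Y x = 0⟩ := h
    obtain ⟨h1, h2⟩ := R.mem_D_zero.mp h1
    refine ⟨R.mem_D_zero.mpr ⟨R.wt_e h1, R.l_e_of_ker h2⟩, ?_⟩
    change R.Y (R.e x) = 0
    rw [← R.l_e_Y h1 h2, h3, map_zero, map_zero]
  F_mem {n x} h := by
    obtain ⟨h1, h3 : R.Y x = 0⟩ := h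
    obtain ⟨h1, h2⟩ := R.mem_D_zero.mp h1
    refine ⟨R.mem_D_zero.mpr ⟨R.wt_f h1, h3⟩, ?_⟩
    have h5 := R.Y_f h2
    rwa [h3, map_zero, smul_zero, sub_zero] at h5
  comm {n x} h := by rw [R.e_f h.1.1, add_sub_cancel_left]
  B := R.B
  bound n hn := (Submodule.eq_bot_iff _).mpr fun x hx => R.bound n hn x hx.1.1

/-- The `ℓ = 1` part of the mixed piece; the weights are raised by one. -/
noncomputable def mixed : WeightRep N where
  -- By `X_Y_X` at weight `n - 1`, the only possible nonzero eigenvalue of `YX` is `v ^ (-n)`.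
  W n := R.D 1 (n - 1) ⊓ LinearMap.ker (R.Y * R.X - v ^ (-n) • 1)
  -- With the factor `v` and the weights raised by one, `qint_shift` turns the commutator with `f`
  -- into the `sl₂` relation.
  E := v • (R.l * R.e)
  F := R.f
  E_mem {n x} h := by
    obtain ⟨h1, h3 : R.Y (R.X x) - v ^ (-n) • x = 0⟩ := h
    obtain ⟨h1, h2⟩ := R.mem_D_one.mp h1
    rw [sub_eq_zero] at h3
    change v • R.l (R.e x) ∈ _
    have hy := R.wt_X h1
    refine Submodule.smul_mem _ _ ⟨R.mem_D_one.mpr ⟨?_, R.l_l _⟩, ?_⟩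
    · have := R.wt_l (R.wt_e h1)
      rwa [show n - 1 + 2 = n + 2 - 1 by ring] at this
    · change R.Y (R.X _) - v ^ (-(n + 2)) • R.l (R.e x) = 0
      have h4 := R.l_e_Y hy (R.l_X x)
      rw [h3, R.e_X h2, map_smul, map_smul, map_smul] at h4
      rw [sub_eq_zero]
      refine smul_right_injective _ (pow_ne_zero 2 v_ne_zero) ?_
      simp only
      rw [← h4, smul_smul, neg_add, zpow_add₀ v_ne_zero, mul_comm, mul_assoc]
      congr 1
      rw [← zpow_natCast, ← zpow_add₀ v_ne_zero]
      simp
  F_mem {n x} h := by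
    obtain ⟨h1, h3 : R.Y (R.X x) - v ^ (-n) • x = 0⟩ := h
    obtain ⟨h1, h2⟩ := R.mem_D_one.mp h1
    rw [sub_eq_zero] at h3
    refine ⟨R.mem_D_one.mpr ⟨?_, R.l_f_of_im h2⟩, ?_⟩
    · have := R.wt_f h1
      rwa [show n - 1 - 2 = n - 2 - 1 by ring] at this
    · change R.Y (R.X (R.f x)) - v ^ (-(n - 2)) • R.f x = 0
      rw [R.X_f h1 h2, R.Y_f (R.l_X x), h3, map_smul, smul_smul, neg_sub, sub_eq_zero,
        sub_eq_add_neg (2 : ℤ), zpow_add₀ v_ne_zero]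
      rfl
  comm {n x} h := by
    obtain ⟨h1, h3 : R.Y (R.X x) - v ^ (-n) • x = 0⟩ := h
    obtain ⟨h1, h2⟩ := R.mem_D_one.mp h1
    rw [sub_eq_zero] at h3
    change v • R.l (R.e (R.f x)) - R.f (v • R.l (R.e x)) = qint n • x
    have hex : R.e x = R.l (R.e x) + R.X x := by rw [X_apply]; abel
    have h4 : R.l (R.f (R.l (R.e x))) = R.f (R.l (R.e x)) := R.l_f_l _
    have h5 : R.l (R.e (R.f x)) = R.f (R.l (R.e x)) + v ^ (-n) • x + qint (n - 1) • x := by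
      rw [R.e_f h1, map_add, map_smul, h2]
      nth_rewrite 1 [hex]
      rw [map_add, map_add, h4, ← R.Y_apply, h3]
    rw [h5, map_smul, ← qint_shift n, add_smul, sub_eq_add_neg (1 : ℤ), zpow_add₀ v_ne_zero,
      zpow_one, mul_smul, mul_smul, smul_add, smul_add]
    abel
  B := R.B + 1
  bound n hn := (Submodule.eq_bot_iff _).mpr fun x hx =>
    R.bound (n - 1) (by have := abs_sub_abs_le_abs_sub n 1; rw [abs_one] at this; omega) x hx.1.1

end MURep

end

/-! ### The splitting of weight spaces into three pieces, and maps from the simple modules -/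

section

namespace MURep

variable {N : Type*} [AddCommGroup N] [Module K N] (R : MURep N)

theorem mem_one_W {n : ℤ} {x : N} :
    x ∈ R.one.W n ↔ (R.k x = v ^ n • x ∧ R.l x = x) ∧ R.X x = 0 :=
  and_congr_left' R.mem_D_one

theorem mem_zero_W {n : ℤ} {x : N} :
    x ∈ R.zero.W n ↔ (R.k x = v ^ n • x ∧ R.l x = 0) ∧ R.Y x = 0 :=
  and_congr_left' R.mem_D_zero

theorem mem_mixed_W {n : ℤ} {x : N} :
    x ∈ R.mixed.W n ↔ (R.k x = v ^ (n - 1) • x ∧ R.l x = x) ∧ R.Y (R.X x) = v ^ (-n) • x :=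
  and_congr R.mem_D_one sub_eq_zero

/-- By `X_Y_X`, `v ^ (m + 1) • YX` projects onto the mixed piece along `ker X`. -/
theorem D_one_le (m : ℤ) : R.D 1 m ≤ R.one.W m ⊔ R.mixed.W (m + 1) := by
  intro x hx
  obtain ⟨h1, h2⟩ := R.mem_D_one.mp hx
  have h3 := R.X_Y_X h1 h2
  have hz : R.Y (R.X x) ∈ R.D 1 m := by
    have := R.wt_Y (R.wt_X h1)
    rw [add_sub_cancel_right] at this
    exact R.mem_D_one.mpr ⟨this, R.l_Y _⟩
  have e : v ^ (m + 1) * v ^ (-1 - m) = 1 := by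
    rw [← zpow_add₀ v_ne_zero]; ring_nf; simp
  have hx2 : x = (x - v ^ (m + 1) • R.Y (R.X x)) + v ^ (m + 1) • R.Y (R.X x) := by abel
  rw [hx2]
  refine Submodule.add_mem_sup ⟨sub_mem hx (Submodule.smul_mem _ _ hz), ?_⟩
    (Submodule.smul_mem _ _ ⟨by simpa using hz, ?_⟩)
  · change R.X (x - v ^ (m + 1) • R.Y (R.X x)) = 0
    rw [map_sub, map_smul, h3, smul_smul, e, one_smul, sub_self]
  · change R.Y (R.X (R.Y (R.X x))) - v ^ (-(m + 1)) • R.Y (R.X x) = 0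
    rw [h3, map_smul, show -(m + 1) = -1 - m by ring, sub_self]

/-- `Y_X_Y` is an eigenvalue equation for `YX` at the vector `Y x`. -/
theorem Y_mem_mixed {m : ℤ} {x : N} (hx : x ∈ R.D 0 m) : R.Y x ∈ R.mixed.W (m - 1) := by
  obtain ⟨h1, h2⟩ := R.mem_D_zero.mp hx
  refine R.mem_mixed_W.mpr ⟨⟨?_, R.l_Y _⟩, ?_⟩
  · have := R.wt_Y h1
    rwa [show m - 2 = m - 1 - 1 by ring] at this
  · rw [R.Y_X_Y h1 h2, neg_sub]

/-- On `ker ℓ` the projection to the mixed part is `v ^ (m - 1) • XY`. -/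
theorem D_zero_le (m : ℤ) : R.D 0 m ≤ R.zero.W m ⊔ (R.mixed.W (m - 1)).map R.X := by
  intro x hx
  obtain ⟨h1, h2⟩ := R.mem_D_zero.mp hx
  have hz : R.X (R.Y x) ∈ R.D 0 m := by
    have := R.wt_X (R.wt_Y h1)
    rw [sub_add_cancel] at this
    exact R.mem_D_zero.mpr ⟨this, R.l_X _⟩
  have e : v ^ (m - 1) * v ^ (1 - m) = 1 := by
    rw [← zpow_add₀ v_ne_zero]; ring_nf; simp
  have hx2 : x = (x - v ^ (m - 1) • R.X (R.Y x)) + v ^ (m - 1) • R.X (R.Y x) := by abel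
  rw [hx2]
  refine Submodule.add_mem_sup ⟨sub_mem hx (Submodule.smul_mem _ _ hz), ?_⟩
    (Submodule.smul_mem _ _ ⟨R.Y x, R.Y_mem_mixed hx, rfl⟩)
  change R.Y (x - v ^ (m - 1) • R.X (R.Y x)) = 0
  rw [map_sub, map_smul, R.Y_X_Y h1 h2, smul_smul, e, one_smul, sub_self]

/-- The sum in `D_one_le` is direct: `YX` is zero on one summand and a nonzero scalar on the other.
-/
theorem finrank_D_one [FiniteDimensional K N] (m : ℤ) : Module.finrank K (R.D 1 m) =
    Module.finrank K (R.one.W m) + Module.finrank K (R.mixed.W (m + 1)) := by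
  have h1 : R.D 1 m = R.one.W m ⊔ R.mixed.W (m + 1) := by
    refine le_antisymm (R.D_one_le m) (sup_le inf_le_left fun x hx => ?_)
    have := hx.1
    rwa [add_sub_cancel_right] at this
  have h2 : R.one.W m ⊓ R.mixed.W (m + 1) = ⊥ := by
    rw [eq_bot_iff]
    rintro x ⟨hx, hx'⟩
    have h3 := (R.mem_one_W.mp hx).2
    have h4 := (R.mem_mixed_W.mp hx').2
    rw [h3, map_zero] at h4
    exact (smul_eq_zero.mp h4.symm).resolve_left (zpow_ne_zero _ v_ne_zero)
  have h3 := Submodule.finrank_sup_add_finrank_inf_eq (R.one.W m) (R.mixed.W (m + 1))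
  rw [h2, finrank_bot, add_zero] at h3
  rw [h1, h3]

/-- The mixed piece enters `ker ℓ` through `X`, which is injective on it because `YX` is a nonzero
scalar there. -/
theorem finrank_D_zero [FiniteDimensional K N] (m : ℤ) : Module.finrank K (R.D 0 m) =
    Module.finrank K (R.zero.W m) + Module.finrank K (R.mixed.W (m - 1)) := by
  have h0 : ∀ x ∈ R.mixed.W (m - 1), R.Y (R.X x) = 0 → x = 0 := by
    intro x hx h
    have h4 := (R.mem_mixed_W.mp hx).2
    rw [h] at h4
    exact (smul_eq_zero.mp h4.symm).resolve_left (zpow_ne_zero _ v_ne_zero)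
  have h1 : R.D 0 m = R.zero.W m ⊔ (R.mixed.W (m - 1)).map R.X := by
    refine le_antisymm (R.D_zero_le m) (sup_le inf_le_left ?_)
    rintro _ ⟨x, hx, rfl⟩
    have := R.wt_X (R.mem_mixed_W.mp hx).1.1
    rw [show m - 1 - 1 + 2 = m by ring] at this
    exact R.mem_D_zero.mpr ⟨this, R.l_X _⟩
  have h2 : R.zero.W m ⊓ (R.mixed.W (m - 1)).map R.X = ⊥ := by
    rw [eq_bot_iff]
    rintro _ ⟨hx, ⟨x, hx', rfl⟩⟩
    rw [h0 x hx' (R.mem_zero_W.mp hx).2, map_zero]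
    exact zero_mem _
  have h3 := Submodule.finrank_sup_add_finrank_inf_eq (R.zero.W m) ((R.mixed.W (m - 1)).map R.X)
  have h4 : Module.finrank K ((R.mixed.W (m - 1)).map R.X) =
      Module.finrank K (R.mixed.W (m - 1)) := by
    rw [← LinearMap.range_domRestrict]
    refine LinearMap.finrank_range_of_inj ((injective_iff_map_eq_zero _).mpr fun x hx => ?_)
    rw [LinearMap.domRestrict_apply] at hx
    exact Subtype.ext (h0 x x.2 (by rw [hx, map_zero]))
  rw [h2, finrank_bot, add_zero, h4] at h3
  rw [h1, h3]

/-! ### Embeddings of the simple modules -/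

theorem uniform_hom_ext {n : ℕ} {S T : (Fin (n + 1) →₀ K) →ₗ[K] N}
    (h : ∀ i, S (mvec n i) = T (mvec n i)) : S = T := by
  refine Finsupp.lhom_ext' fun i => LinearMap.ext_ring ?_
  have := h i
  rw [mvec_of_lt i.2] at this
  simpa using this

theorem mixed_hom_ext {n : ℕ} {S T : ((Fin n ⊕ Fin n) →₀ K) →ₗ[K] N}
    (h0 : ∀ i, S (mvec0 n i) = T (mvec0 n i)) (h1 : ∀ i, S (mvec1 n (i + 1)) = T (mvec1 n (i + 1))) :
    S = T := by
  refine Finsupp.lhom_ext' fun i => LinearMap.ext_ring ?_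
  rcases i with i | i
  · simpa [mvec0] using h0 i
  · simpa [mvec1] using h1 i

/-- The linear map sending `m_i` to `f ^ i w`. -/
noncomputable def uniformMap (n : ℕ) : N →ₗ[K] (Fin (n + 1) →₀ K) →ₗ[K] N :=
  (Finsupp.llift N K K (Fin (n + 1))).toLinearMap ∘ₗ
    LinearMap.pi fun i : Fin (n + 1) => R.f ^ (i : ℕ)

theorem uniformMap_mvec {n : ℕ} {w : N} (h : ∀ i, n < i → (R.f ^ i) w = 0) (i : ℕ) :
    R.uniformMap n w (mvec n i) = (R.f ^ i) w := by
  by_cases hi : i < n + 1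
  · rw [mvec_of_lt hi]; simp [uniformMap]
  · rw [mvec_of_ge (by omega), map_zero, h i (by omega)]

/-- The linear map sending `m_{i,0}` to `v ^ (n - 1) X (f ^ i w)` and `m_{i+1,1}` to
`v ^ i [i + 1] f ^ i w`. -/
noncomputable def mixedMap (n : ℕ) : N →ₗ[K] ((Fin n ⊕ Fin n) →₀ K) →ₗ[K] N :=
  (Finsupp.llift N K K (Fin n ⊕ Fin n)).toLinearMap ∘ₗ
    -- The scalars come from the formulas for `f` on `L⁺(n,01)`: `f m_{i+1,1}` governs the ratios `v
    -- ^ i [i + 1]`, and the `m_{i+1,1}` term of `f m_{i,0}`, compared with the eigenvalue of `YX`,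
    -- requires `v ^ (n - 1)`.
    LinearMap.pi (Sum.elim (fun i : Fin n => v ^ ((n : ℤ) - 1) • (R.X * R.f ^ (i : ℕ)))
      fun i : Fin n => (v ^ (i : ℕ) * qint ((i : ℕ) + 1)) • R.f ^ (i : ℕ))

theorem mixedMap_mvec0 {n : ℕ} {w : N} (h : ∀ i, n ≤ i → (R.f ^ i) w = 0) (i : ℕ) :
    R.mixedMap n w (mvec0 n i) = v ^ ((n : ℤ) - 1) • R.X ((R.f ^ i) w) := by
  by_cases hi : i < n
  · simp [mixedMap, mvec0, hi]
  · rw [mvec0_of_ge (by omega), map_zero, h i (by omega), map_zero, smul_zero]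

theorem mixedMap_mvec1 {n : ℕ} {w : N} (h : ∀ i, n ≤ i → (R.f ^ i) w = 0) (i : ℕ) :
    R.mixedMap n w (mvec1 n (i + 1)) = (v ^ i * qint ((i : ℤ) + 1)) • (R.f ^ i) w := by
  by_cases hi : i < n
  · simp [mixedMap, mvec1, hi]
  · rw [mvec1_of_ge (by omega), map_zero, h i (by omega), smul_zero]

theorem f_pow_succ (i : ℕ) (w : N) : R.f ((R.f ^ i) w) = (R.f ^ (i + 1)) w := by
  rw [pow_succ', Module.End.mul_apply]

/-- Stated for any `WeightRep` contained in one eigenspace of `ℓ`, so that it serves both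
`MURep.one` and `MURep.zero`. -/
theorem uniformMap_apply {S : WeightRep N} (hE : S.E = R.e) (hF : S.F = R.f) {ε : K}
    (hW : ∀ n, S.W n ≤ R.D ε n) {n : ℕ} {w : N} (hw : w ∈ S.P n) (g : Gen)
    (x : Fin (n + 1) →₀ K) :
    R.uniformMap n w (opUniform ε n g x) = R.φ g (R.uniformMap n w x) := by
  have hJ := R.uniformMap_mvec (n := n) (w := w) fun i hi => by
    rw [← hF]; exact S.F_pow_eq_zero hw (by exact_mod_cast hi)
  have hk (i : ℕ) : R.k ((R.f ^ i) w) = v ^ ((n : ℤ) - 2 * i) • (R.f ^ i) w := by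
    have := (hW _ (S.F_pow_mem hw.1 i)).1
    rwa [hF] at this
  have hl (i : ℕ) : R.l ((R.f ^ i) w) = ε • (R.f ^ i) w := by
    have := (hW _ (S.F_pow_mem hw.1 i)).2
    rwa [hF] at this
  revert x
  rw [← funext_iff]
  change ⇑(R.uniformMap n w ∘ₗ opUniform ε n g) = ⇑(R.φ g ∘ₗ R.uniformMap n w)
  congr 1
  refine uniform_hom_ext fun i => ?_
  rw [LinearMap.comp_apply, LinearMap.comp_apply, hJ]
  cases g with
  | e =>
    rw [opUniform_e, map_smul, hJ]
    cases i with
    | zero =>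
      have := (S.mem_P.mp hw).2
      rw [hE] at this
      simp [qint_zero, this]
    | succ i =>
      have := S.E_F_pow hw i
      rw [hE, hF] at this
      rw [this]
      push_cast
      rw [show (n : ℤ) + 1 - (i + 1) = n - i by ring]
  | f => rw [opUniform_f, hJ, f_pow_succ]
  | k => rw [opUniform_k, map_smul, hJ, hk]
  | kinv => rw [opUniform_kinv, map_smul, hJ, R.kinv_of_wt (hk i), neg_sub]
  | l => simp [opUniform, hJ, hl]

/-- The `sl₂` structure of `MURep.mixed` gives `f` and `vℓe` on the string `f ^ i w`, and `X`
supplies the rest of `e`. On the vectors `X (f ^ i w)` the action follows from `X_f`, `e_X` and the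
eigenvalue of `YX`. -/
theorem mixedMap_apply {n : ℕ} {w : N} (hw : w ∈ R.mixed.P ((n : ℤ) - 1)) (g : Gen)
    (x : (Fin n ⊕ Fin n) →₀ K) :
    R.mixedMap n w (opMixed n g x) = R.φ g (R.mixedMap n w x) := by
  have h0 := v_ne_zero
  have hz : ∀ i, n ≤ i → (R.f ^ i) w = 0 := fun i hi =>
    R.mixed.F_pow_eq_zero hw (by omega)
  have hJ0 := R.mixedMap_mvec0 hz
  have hJ1 := R.mixedMap_mvec1 hz
  have hm (i : ℕ) := R.mem_mixed_W.mp (R.mixed.F_pow_mem hw.1 i)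
  change ∀ i, (R.k ((R.f ^ i) w) = _ • (R.f ^ i) w ∧ R.l ((R.f ^ i) w) = (R.f ^ i) w) ∧
    R.Y (R.X ((R.f ^ i) w)) = _ • (R.f ^ i) w at hm
  have hk1 (i : ℕ) : R.k ((R.f ^ i) w) = v ^ ((n : ℤ) - 2 * (i + 1 : ℕ)) • (R.f ^ i) w := by
    rw [(hm i).1.1]; congr 2; push_cast; ring
  have hk0 (i : ℕ) : R.k (R.X ((R.f ^ i) w)) = v ^ ((n : ℤ) - 2 * i) • R.X ((R.f ^ i) w) := by
    rw [R.wt_X (hk1 i)]; congr 2; push_cast; ring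
  have hl (i : ℕ) := (hm i).1.2
  have he0 : R.l (R.e w) = 0 := by
    have := (R.mixed.mem_P.mp hw).2
    exact (smul_eq_zero.mp this).resolve_left h0
  have he1 (i : ℕ) : v • R.l (R.e ((R.f ^ (i + 1)) w)) =
      (qint ((i : ℤ) + 1) * qint ((n : ℤ) - 1 - i)) • (R.f ^ i) w := R.mixed.E_F_pow hw i
  revert x
  rw [← funext_iff]
  change ⇑(R.mixedMap n w ∘ₗ opMixed n g) = ⇑(R.φ g ∘ₗ R.mixedMap n w)
  congr 1
  refine mixed_hom_ext (fun i => ?_) fun i => ?_ <;>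
    simp only [LinearMap.comp_apply, hJ0, hJ1, map_smul] <;> cases g
  case refine_1.e =>
    rw [opMixed_e0, map_smul, hJ0, R.e_X (hl i)]
    cases i with
    | zero => simp [qint_zero, he0]
    | succ i =>
      have : v ^ 2 • R.X (R.l (R.e ((R.f ^ (i + 1)) w))) =
          v • R.X (v • R.l (R.e ((R.f ^ (i + 1)) w))) := by
        rw [map_smul, smul_smul, pow_two]
      rw [this, he1, map_smul, smul_smul, smul_smul, smul_smul, Nat.add_sub_cancel]
      push_cast
      rw [show (n : ℤ) - (i + 1) = n - 1 - i by ring]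
      congr 1; ring
  case refine_1.f =>
    have hi := qint_succ_ne_zero i
    rw [opMixed_f0, map_add, map_smul, hJ0, hJ1]
    have h1 := R.X_f (hk1 i) (hl i)
    rw [f_pow_succ, (hm i).2, eq_sub_iff_add_eq] at h1
    rw [← h1, smul_add, smul_smul, smul_smul]
    congr 2
    rw [← zpow_add₀ h0]
    have : (n : ℤ) - 1 + -((n : ℤ) - 1 - 2 * i) = (i : ℤ) + i := by ring
    rw [this, zpow_add₀ h0, zpow_natCast]
    field_simp
  case refine_1.k => rw [opMixed_k0, map_smul, hJ0, hk0, smul_comm]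
  case refine_1.kinv =>
    rw [opMixed_kinv0, map_smul, hJ0, R.kinv_of_wt (hk0 i), neg_sub, smul_comm]
  case refine_1.l => rw [opMixed_l0, map_zero, R.l_X, smul_zero]
  case refine_2.e =>
    rw [opMixed_e1, map_add, map_smul, map_smul, Nat.add_sub_cancel, hJ0]
    have hex : R.e ((R.f ^ i) w) = R.l (R.e ((R.f ^ i) w)) + R.X ((R.f ^ i) w) := by
      rw [X_apply]; abel
    rw [hex, smul_add, smul_smul]
    congr 1
    · cases i with
      | zero => simp [mvec1, he0]
      | succ i =>
        have : R.l (R.e ((R.f ^ (i + 1)) w)) =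
            v⁻¹ • (v • R.l (R.e ((R.f ^ (i + 1)) w))) := by
          rw [smul_smul, inv_mul_cancel₀ h0, one_smul]
        rw [this, he1, hJ1, smul_smul, smul_smul, smul_smul]
        congr 1
        push_cast
        rw [show (n : ℤ) + 1 - (i + 1 + 1) = n - 1 - i by ring]
        field_simp
        ring
    · congr 1
      push_cast
      have : v ^ ((i : ℤ) + 1 - n) * v ^ ((n : ℤ) - 1) = v ^ i := by
        rw [← zpow_add₀ h0, ← zpow_natCast]; congr 1; ring
      rw [← this]; ring
  case refine_2.f =>
    have hi := qint_succ_ne_zero i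
    have hi' := qint_succ_ne_zero (i + 1)
    rw [opMixed_f1, map_smul, hJ1, f_pow_succ, smul_smul]
    congr 1
    push_cast at *
    field_simp
    ring
  case refine_2.k => rw [opMixed_k1, map_smul, hJ1, hk1, smul_comm]
  case refine_2.kinv =>
    rw [opMixed_kinv1, map_smul, hJ1, R.kinv_of_wt (hk1 i), neg_sub, smul_comm]
  case refine_2.l => rw [opMixed_l1, hJ1, hl]

end MURep

end

/-! ### Spanning by images of simple modules -/

section

namespace MURep

variable {N : Type*} [AddCommGroup N] [Module K N] (R : MURep N)

/-- The vectors of `N` generating a copy of the simple module with a given label. -/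
noncomputable def hw : Label → Submodule K N
  | .zero n => R.zero.P n
  | .one n => R.one.P n
  | .mixed n => R.mixed.P ((n : ℤ) - 1)

/-- The family of linear maps from a simple module attached to the vectors of `N`. -/
noncomputable def simpleMap : (t : Label) → N →ₗ[K] L t →ₗ[K] N
  | .zero n => R.uniformMap n
  | .one n => R.uniformMap n
  | .mixed n => R.mixedMap n

theorem intertwine_of_gen {A B : Type*} [AddCommGroup A] [Module K A] [AddCommGroup B] [Module K B]
    (ρ : MU2 →ₐ[K] Module.End K A) (σ : MU2 →ₐ[K] Module.End K B) (T : A →ₗ[K] B)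
    (h : ∀ g x, T (ρ (MU2.gen g) x) = σ (MU2.gen g) (T x)) (a : MU2) (x : A) :
    T (ρ a x) = σ a (T x) := by
  obtain ⟨b, rfl⟩ := RingQuot.mkAlgHom_surjective K Rel a
  induction b using FreeAlgebra.induction generalizing x with
  | grade0 r => simp [Module.algebraMap_end_apply]
  | grade1 g => exact h g x
  | mul a b ha hb => rw [map_mul, map_mul, map_mul, Module.End.mul_apply, ha, hb]; rfl
  | add a b ha hb => simp only [map_add, LinearMap.add_apply, ha, hb]

theorem lift_gen {A : Type} [Ring A] [Algebra K A] (φ : Gen → A)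
    (h : ∀ ⦃a b⦄, Rel a b → FreeAlgebra.lift K φ a = FreeAlgebra.lift K φ b) (g : Gen) :
    MU2.lift φ h (MU2.gen g) = φ g := by
  unfold MU2.lift MU2.gen
  rw [RingQuot.liftAlgHom_mkAlgHom_apply, FreeAlgebra.lift_ι_apply]

theorem simpleMap_apply (ρ : MU2 →ₐ[K] Module.End K N) (hρ : ∀ g, ρ (MU2.gen g) = R.φ g)
    {t : Label} {w : N} (hw : w ∈ R.hw t) (a : MU2) (x : L t) :
    R.simpleMap t w (a • x) = ρ a (R.simpleMap t w x) := by
  refine intertwine_of_gen (L.rep t) ρ (R.simpleMap t w) (fun g x => ?_) a x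
  rw [hρ]
  cases t with
  | zero n =>
    have e : L.rep (.zero n) (MU2.gen g) x = opUniform 0 n g x :=
      LinearMap.congr_fun (lift_gen _ (opUniform_rel 0 (by simp) n) g) x
    rw [e]
    exact R.uniformMap_apply (S := R.zero) rfl rfl (fun n => inf_le_left) hw g x
  | one n =>
    have e : L.rep (.one n) (MU2.gen g) x = opUniform 1 n g x :=
      LinearMap.congr_fun (lift_gen _ (opUniform_rel 1 (by simp) n) g) x
    rw [e]
    exact R.uniformMap_apply (S := R.one) rfl rfl (fun n => inf_le_left) hw g x
  | mixed n =>
    have e : L.rep (.mixed n) (MU2.gen g) x = opMixed n g x :=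
      LinearMap.congr_fun (lift_gen _ (opMixed_rel n) g) x
    rw [e]
    exact R.mixedMap_apply hw g x

/-- Every weight vector is a combination of images of simple modules. -/
theorem mem_of_simpleMap_mem {S : Submodule K N}
    (hS : ∀ t, ∀ w ∈ R.hw t, ∀ x, R.simpleMap t w x ∈ S) {n : ℤ} {x : N}
    (hx : R.k x = v ^ n • x) : x ∈ S := by
  have h1 : ∀ m, R.one.W m ≤ S := by
    refine fun m => (R.one.le_desc m).trans (iSup_le ?_)
    rintro ⟨i, hi⟩ _ ⟨w, hw, rfl⟩
    obtain ⟨n, hn⟩ : ∃ n : ℕ, m + 2 * (i : ℤ) = n := ⟨(m + 2 * (i : ℤ)).toNat, by omega⟩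
    simp only at hw
    rw [hn] at hw
    have := hS (.one n) w hw (mvec n i)
    change R.uniformMap n w (mvec n i) ∈ S at this
    rwa [R.uniformMap_mvec fun i hi => R.one.F_pow_eq_zero hw (by exact_mod_cast hi)] at this
  have h2 : ∀ m, R.zero.W m ≤ S := by
    refine fun m => (R.zero.le_desc m).trans (iSup_le ?_)
    rintro ⟨i, hi⟩ _ ⟨w, hw, rfl⟩
    obtain ⟨n, hn⟩ : ∃ n : ℕ, m + 2 * (i : ℤ) = n := ⟨(m + 2 * (i : ℤ)).toNat, by omega⟩
    simp only at hw
    rw [hn] at hw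
    have := hS (.zero n) w hw (mvec n i)
    change R.uniformMap n w (mvec n i) ∈ S at this
    rwa [R.uniformMap_mvec fun i hi => R.zero.F_pow_eq_zero hw (by exact_mod_cast hi)] at this
  -- The images under `X` are needed too, since the mixed part of `ker ℓ` is reached only through
  -- `X`.
  have h3 : ∀ m, R.mixed.W m ≤ S ⊓ S.comap R.X := by
    refine fun m => (R.mixed.le_desc m).trans (iSup_le ?_)
    rintro ⟨i, hi⟩ _ ⟨w, hw, rfl⟩
    obtain ⟨n, hn⟩ : ∃ n : ℕ, m + 2 * (i : ℤ) = (n : ℤ) - 1 :=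
      ⟨(m + 2 * (i : ℤ) + 1).toNat, by omega⟩
    simp only at hw
    rw [hn] at hw
    have hz : ∀ i, n ≤ i → (R.f ^ i) w = 0 := fun i hi => R.mixed.F_pow_eq_zero hw (by omega)
    have h4 := hS (.mixed n) w hw (mvec1 n (i + 1))
    have h5 := hS (.mixed n) w hw (mvec0 n i)
    change R.mixedMap n w _ ∈ S at h4 h5
    rw [R.mixedMap_mvec1 hz] at h4
    rw [R.mixedMap_mvec0 hz] at h5
    exact ⟨(S.smul_mem_iff (mul_ne_zero (pow_ne_zero _ v_ne_zero) (qint_succ_ne_zero i))).mp h4,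
      (S.smul_mem_iff (zpow_ne_zero _ v_ne_zero)).mp h5⟩
  have hD1 : R.D 1 n ≤ S :=
    (R.D_one_le n).trans (sup_le (h1 n) ((h3 _).trans inf_le_left))
  have hD0 : R.D 0 n ≤ S := (R.D_zero_le n).trans
    (sup_le (h2 n) (Submodule.map_le_iff_le_comap.mpr ((h3 _).trans inf_le_right)))
  have h4 : x = R.l x + (x - R.l x) := by abel
  rw [h4]
  refine S.add_mem (hD1 (R.mem_D_one.mpr ⟨R.wt_l hx, R.l_l x⟩))
    (hD0 (R.mem_D_zero.mpr ⟨?_, by rw [map_sub, R.l_l, sub_self]⟩))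
  rw [map_sub, R.wt_l hx, hx, smul_sub]

end MURep

end

section

/-! ### Standard tableaux with two rows -/

/-- The `t`-element subsets of `{0, …, n - 1}` that contain at most half of every initial
segment. -/
def ballotSets (n t : ℕ) : Finset (Finset ℕ) :=
  ((Finset.range n).powersetCard t).filter fun S =>
    ∀ m, m ≤ n → 2 * (S.filter (· < m)).card ≤ m

theorem ballotSets_zero (n : ℕ) : ballotSets n 0 = {∅} := by
  ext S
  simp only [ballotSets, Finset.mem_filter, Finset.mem_powersetCard, Finset.card_eq_zero,
    Finset.mem_singleton]
  constructor
  · exact fun h => h.1.2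
  · rintro rfl; simp

theorem ballotSets_eq_empty {n t : ℕ} (h : n < 2 * t) : ballotSets n t = ∅ := by
  rw [ballotSets, Finset.filter_eq_empty_iff]
  intro S hS h2
  obtain ⟨h3, h4⟩ := Finset.mem_powersetCard.mp hS
  have h5 := h2 n le_rfl
  rw [Finset.filter_true_of_mem fun x hx => Finset.mem_range.mp (h3 hx), h4] at h5
  omega

/-- Sort the sets by whether they contain the last element `n`. The hypothesis makes the new
condition at `m = n + 1` automatic for sets of size `t + 1`. -/
theorem card_ballotSets_succ {n t : ℕ} (h : 2 * (t + 1) ≤ n + 1) :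
    (ballotSets (n + 1) (t + 1)).card = (ballotSets n (t + 1)).card + (ballotSets n t).card := by
  have key : ballotSets (n + 1) (t + 1) =
      ballotSets n (t + 1) ∪ (ballotSets n t).image (insert n) := by
    ext S
    simp only [ballotSets, Finset.range_add_one, Finset.mem_filter, Finset.mem_union,
      Finset.mem_image, Finset.powersetCard_succ_insert Finset.notMem_range_self]
    constructor
    · rintro ⟨h1 | ⟨S, h1, rfl⟩, h2⟩
      · exact Or.inl ⟨h1, fun m hm => h2 m (by omega)⟩
      · refine Or.inr ⟨S, ⟨h1, fun m hm => ?_⟩, rfl⟩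
        have := h2 m (by omega)
        rwa [Finset.filter_insert, if_neg (by omega)] at this
    · rintro (⟨h1, h2⟩ | ⟨S, ⟨h1, h2⟩, rfl⟩)
      · refine ⟨Or.inl h1, fun m hm => ?_⟩
        rcases hm.lt_or_eq with hm | rfl
        · exact h2 m (by omega)
        · have h4 := (Finset.mem_powersetCard.mp h1).2
          have := Finset.card_filter_le S (· < n + 1)
          omega
      · refine ⟨Or.inr ⟨S, h1, rfl⟩, fun m hm => ?_⟩
        rcases hm.lt_or_eq with hm | rfl
        · rw [Finset.filter_insert, if_neg (by omega)]
          exact h2 m (by omega)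
        · have h4 := (Finset.mem_powersetCard.mp h1).2
          have := Finset.card_filter_le (insert n S) (· < n + 1)
          have := Finset.card_insert_le n S
          omega
  have hn : ∀ {t S}, S ∈ ballotSets n t → n ∉ S := fun hS hn => by
    have := (Finset.mem_powersetCard.mp (Finset.mem_filter.mp hS).1).1 hn
    simp at this
  rw [key, Finset.card_union_of_disjoint, Finset.card_image_of_injOn]
  · intro S hS S' hS' h
    rw [← Finset.erase_insert (hn hS), ← Finset.erase_insert (hn hS')]
    exact congrArg (·.erase n) h
  · rw [Finset.disjoint_right]
    intro S hS h
    obtain ⟨S, -, rfl⟩ := Finset.mem_image.mp hS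
    exact hn h (Finset.mem_insert_self _ _)

/-- The ballot number `(n choose t) - (n choose (t - 1))`, written additively and with `n - t + 1`
in place of `t - 1`, so that `t = 0` is no exception. The induction needs the boundary case `2 * t =
n + 1`, where there are no ballot sets and the two binomial coefficients coincide. -/
theorem card_ballotSets (n t : ℕ) (h : 2 * t ≤ n + 1) :
    (ballotSets n t).card + n.choose (n - t + 1) = n.choose t := by
  induction n generalizing t with
  | zero =>
    obtain rfl : t = 0 := by omega
    simp [ballotSets_zero]
  | succ n ih =>
    cases t with
    | zero => simp [ballotSets_zero]
    | succ s =>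
      by_cases h2 : 2 * (s + 1) ≤ n + 1
      · rw [card_ballotSets_succ h2]
        have h3 := ih (s + 1) h2
        have h4 := ih s (by omega)
        have h5 : n + 1 - (s + 1) + 1 = n - s + 1 := by omega
        have h6 : n - s = n - (s + 1) + 1 := by omega
        rw [h5, Nat.choose_succ_succ' n s, Nat.choose_succ_succ' n (n - s)]
        rw [← h6] at h3
        omega
      · rw [ballotSets_eq_empty (by omega), Finset.card_empty, zero_add]
        congr 1; omega

/-- A Young diagram with two rows. -/
def twoRow (a b : ℕ) (h : b ≤ a) : YoungDiagram :=
  YoungDiagram.ofRowLens [a, b] (by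
    rw [List.sortedGE_iff_pairwise]
    simp [h])

section

variable {a b : ℕ} (h : b ≤ a)

theorem mem_twoRow {i j : ℕ} :
    (i, j) ∈ (twoRow a b h).cells ↔ (i = 0 ∧ j < a) ∨ (i = 1 ∧ j < b) := by
  rw [YoungDiagram.mem_cells, twoRow, YoungDiagram.mem_ofRowLens]
  match i with
  | 0 => simp
  | 1 => simp
  | i + 2 => simp

/-- The cells of a Young diagram with two rows. -/
def twoRowCells : Fin a ⊕ Fin b ≃ (twoRow a b h).cells where
  toFun := Sum.elim (fun j => ⟨(0, j), (mem_twoRow h).mpr (Or.inl ⟨rfl, j.2⟩)⟩)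
    fun j => ⟨(1, j), (mem_twoRow h).mpr (Or.inr ⟨rfl, j.2⟩)⟩
  invFun c := if h0 : c.1.1 = 0 then Sum.inl ⟨c.1.2, by
      have := (mem_twoRow h (i := c.1.1) (j := c.1.2)).mp c.2; omega⟩
    else Sum.inr ⟨c.1.2, by have := (mem_twoRow h (i := c.1.1) (j := c.1.2)).mp c.2; omega⟩
  left_inv x := by rcases x with x | x <;> simp
  right_inv c := by
    obtain ⟨⟨i, j⟩, hc⟩ := c
    rcases (mem_twoRow h).mp hc with ⟨rfl, h2⟩ | ⟨rfl, h2⟩ <;> simp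

theorem card_twoRow : (twoRow a b h).card = a + b := by
  have := Fintype.card_congr (twoRowCells h)
  simpa [YoungDiagram.card] using this.symm

variable {h}

namespace StandardTableau

/-- The entry in a given cell. -/
def entry (T : StandardTableau (twoRow a b h)) (x : Fin a ⊕ Fin b) : ℕ :=
  (T.1 (twoRowCells h x) : ℕ)

theorem entry_injective (T : StandardTableau (twoRow a b h)) : Function.Injective T.entry :=
  Fin.val_injective.comp (T.1.injective.comp (twoRowCells h).injective)

theorem entry_lt (T : StandardTableau (twoRow a b h)) (x : Fin a ⊕ Fin b) :
    T.entry x < a + b := (T.1 (twoRowCells h x)).2.trans_eq (card_twoRow h)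

theorem exists_entry (T : StandardTableau (twoRow a b h)) {m : ℕ} (hm : m < a + b) :
    ∃ x, T.entry x = m :=
  ⟨(twoRowCells h).symm (T.1.symm ⟨m, by rwa [card_twoRow]⟩), by simp [entry]⟩

theorem entry_inl_strictMono (T : StandardTableau (twoRow a b h)) :
    StrictMono fun j => T.entry (Sum.inl j) := fun i j hij =>
  T.2.1 (twoRowCells h (Sum.inl i)) (twoRowCells h (Sum.inl j)) rfl hij

theorem entry_inr_strictMono (T : StandardTableau (twoRow a b h)) :
    StrictMono fun j => T.entry (Sum.inr j) := fun i j hij =>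
  T.2.1 (twoRowCells h (Sum.inr i)) (twoRowCells h (Sum.inr j)) rfl hij

theorem entry_inl_lt_inr (T : StandardTableau (twoRow a b h)) (j : Fin b) :
    T.entry (Sum.inl (Fin.castLE h j)) < T.entry (Sum.inr j) :=
  T.2.2 (twoRowCells h (Sum.inl _)) (twoRowCells h (Sum.inr j)) rfl Nat.zero_lt_one

/-- The set of entries in the second row. -/
def secondRow (T : StandardTableau (twoRow a b h)) : Finset ℕ :=
  Finset.univ.image fun j : Fin b => T.entry (Sum.inr j)

/-- The set of entries in the first row. -/
def firstRow (T : StandardTableau (twoRow a b h)) : Finset ℕ :=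
  Finset.univ.image fun j : Fin a => T.entry (Sum.inl j)

theorem card_secondRow (T : StandardTableau (twoRow a b h)) : T.secondRow.card = b := by
  rw [secondRow, Finset.card_image_of_injective _ T.entry_inr_strictMono.injective,
    Finset.card_univ, Fintype.card_fin]

theorem card_firstRow (T : StandardTableau (twoRow a b h)) : T.firstRow.card = a := by
  rw [firstRow, Finset.card_image_of_injective _ T.entry_inl_strictMono.injective,
    Finset.card_univ, Fintype.card_fin]

theorem firstRow_eq (T : StandardTableau (twoRow a b h)) :
    T.firstRow = Finset.range (a + b) \ T.secondRow := by
  ext m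
  simp only [firstRow, secondRow, Finset.mem_image, Finset.mem_univ, true_and, Finset.mem_sdiff,
    Finset.mem_range]
  constructor
  · rintro ⟨j, rfl⟩
    exact ⟨T.entry_lt _, fun ⟨i, hi⟩ => by simpa using T.entry_injective hi⟩
  · rintro ⟨hm, h2⟩
    obtain ⟨x | x, rfl⟩ := T.exists_entry hm
    · exact ⟨x, rfl⟩
    · exact absurd ⟨x, rfl⟩ h2

theorem secondRow_subset (T : StandardTableau (twoRow a b h)) :
    T.secondRow ⊆ Finset.range (a + b) := by
  intro m hm
  obtain ⟨j, -, rfl⟩ := Finset.mem_image.mp hm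
  exact Finset.mem_range.mpr (T.entry_lt _)

/-- Each entry of the second row is preceded by the entry above it, so at most half of the entries
below `m` lie in the second row. -/
theorem secondRow_mem (T : StandardTableau (twoRow a b h)) :
    T.secondRow ∈ ballotSets (a + b) b := by
  refine Finset.mem_filter.mpr ⟨Finset.mem_powersetCard.mpr ⟨T.secondRow_subset, T.card_secondRow⟩,
    fun m hm => ?_⟩
  have h1 : (T.secondRow.filter (· < m)).card ≤ (T.firstRow.filter (· < m)).card := by
    have e : T.secondRow.filter (· < m) =
        (Finset.univ.filter fun j : Fin b => T.entry (Sum.inr j) < m).image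
          fun j : Fin b => T.entry (Sum.inr j) := by
      rw [secondRow, Finset.filter_image]
    rw [e, Finset.card_image_of_injective _ T.entry_inr_strictMono.injective,
      ← Finset.card_image_of_injective (f := fun j : Fin b => T.entry (Sum.inl (Fin.castLE h j)))
        _ (T.entry_inl_strictMono.injective.comp (Fin.castLE_injective h))]
    refine Finset.card_le_card fun x hx => ?_
    obtain ⟨j, hj, rfl⟩ := Finset.mem_image.mp hx
    exact Finset.mem_filter.mpr ⟨Finset.mem_image_of_mem _ (Finset.mem_univ _),
      (T.entry_inl_lt_inr j).trans (Finset.mem_filter.mp hj).2⟩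
  have h2 : (T.secondRow.filter (· < m)).card + (T.firstRow.filter (· < m)).card = m := by
    rw [← Finset.card_union_of_disjoint, ← Finset.filter_union, T.firstRow_eq,
      Finset.union_sdiff_of_subset T.secondRow_subset]
    · have : (Finset.range (a + b)).filter (· < m) = Finset.range m := by
        ext x; simp; omega
      rw [this, Finset.card_range]
    · rw [T.firstRow_eq]
      exact Finset.disjoint_filter_filter Finset.disjoint_sdiff
  omega

/-- Rows increase, so a tableau is determined by the entry sets of its rows, and these are
complementary. -/
theorem secondRow_injective :
    Function.Injective (secondRow : StandardTableau (twoRow a b h) → Finset ℕ) := by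
  intro T T' hT
  have h1 := Finset.orderEmbOfFin_unique (f := fun j => T.entry (Sum.inr j)) T.card_secondRow
    (fun j => Finset.mem_image_of_mem _ (Finset.mem_univ j)) T.entry_inr_strictMono
  have h1' := Finset.orderEmbOfFin_unique (f := fun j => T'.entry (Sum.inr j))
    (hT ▸ T'.card_secondRow)
    (fun j => hT ▸ Finset.mem_image_of_mem _ (Finset.mem_univ j)) T'.entry_inr_strictMono
  have hF : T.firstRow = T'.firstRow := by rw [T.firstRow_eq, T'.firstRow_eq, hT]
  have h2 := Finset.orderEmbOfFin_unique (f := fun j => T.entry (Sum.inl j)) T.card_firstRow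
    (fun j => Finset.mem_image_of_mem _ (Finset.mem_univ j)) T.entry_inl_strictMono
  have h2' := Finset.orderEmbOfFin_unique (f := fun j => T'.entry (Sum.inl j))
    (hF ▸ T'.card_firstRow)
    (fun j => hF ▸ Finset.mem_image_of_mem _ (Finset.mem_univ j)) T'.entry_inl_strictMono
  refine Subtype.ext (Equiv.ext fun c => Fin.ext ?_)
  obtain ⟨x, rfl⟩ := (twoRowCells h).surjective c
  rcases x with j | j
  · exact congrFun (h2.trans h2'.symm) j
  · exact congrFun (h1.trans h1'.symm) j

/-- Fill the rows increasingly with the complement of `S` and with `S`. The column condition is the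
ballot condition: were `s j ≤ p j`, the initial segment up to `s j` would contain at least `j + 1`
elements of `S` and at most `j` others. -/
theorem exists_secondRow {S : Finset ℕ} (hS : S ∈ ballotSets (a + b) b) :
    ∃ T : StandardTableau (twoRow a b h), T.secondRow = S := by
  obtain ⟨hS1, hS2⟩ := Finset.mem_filter.mp hS
  obtain ⟨hS3, hS4⟩ := Finset.mem_powersetCard.mp hS1
  have hF : (Finset.range (a + b) \ S).card = a := by
    rw [Finset.card_sdiff_of_subset hS3, Finset.card_range, hS4, Nat.add_sub_cancel]
  set p := (Finset.range (a + b) \ S).orderEmbOfFin hF with hp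
  set s := S.orderEmbOfFin hS4 with hs
  have hpm (j) : p j ∈ Finset.range (a + b) \ S := Finset.orderEmbOfFin_mem _ _ _
  have hsm (j) : s j ∈ S := Finset.orderEmbOfFin_mem _ _ _
  let g : Fin a ⊕ Fin b → Fin (twoRow a b h).card := fun x => ⟨Sum.elim p s x, by
    rw [card_twoRow]
    rcases x with j | j
    · exact Finset.mem_range.mp (Finset.mem_sdiff.mp (hpm j)).1
    · exact Finset.mem_range.mp (hS3 (hsm j))⟩
  have hg : Function.Injective g := by
    intro x y hxy
    have : Sum.elim p s x = Sum.elim p s y := congrArg Fin.val hxy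
    rcases x with i | i <;> rcases y with j | j <;> simp only [Sum.elim_inl, Sum.elim_inr] at this
    · rw [p.injective this]
    · exact absurd (this ▸ hsm j) (Finset.mem_sdiff.mp (hpm i)).2
    · exact absurd (this ▸ hsm i) (Finset.mem_sdiff.mp (hpm j)).2
    · rw [s.injective this]
  have hg2 : Function.Bijective g := (Fintype.bijective_iff_injective_and_card g).mpr
    ⟨hg, by simp [card_twoRow]⟩
  have hcol (j : Fin b) : p (Fin.castLE h j) < s j := by
    by_contra hlt
    rw [not_lt] at hlt
    have hj : s j < a + b := Finset.mem_range.mp (hS3 (hsm j))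
    have h1 := hS2 (s j + 1) hj
    have h2 : (j : ℕ) + 1 ≤ (S.filter (· < s j + 1)).card := by
      have : ((Finset.Iic j).image s).card = (j : ℕ) + 1 := by
        rw [Finset.card_image_of_injective _ s.injective, Fin.card_Iic]
      rw [← this]
      refine Finset.card_le_card fun x hx => ?_
      obtain ⟨i, hi, rfl⟩ := Finset.mem_image.mp hx
      exact Finset.mem_filter.mpr ⟨hsm i,
        Nat.lt_succ_of_le (s.monotone (Finset.mem_Iic.mp hi))⟩
    have h3 : ((Finset.range (a + b) \ S).filter (· < s j + 1)).card ≤ j := by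
      have : ((Finset.Iio (Fin.castLE h j)).image p).card = j := by
        rw [Finset.card_image_of_injective _ p.injective, Fin.card_Iio]; rfl
      rw [← this]
      refine Finset.card_le_card fun x hx => ?_
      obtain ⟨hx1, hx2⟩ := Finset.mem_filter.mp hx
      obtain ⟨i, rfl⟩ : x ∈ Set.range p := by
        rw [hp, Finset.range_orderEmbOfFin]; exact hx1
      refine Finset.mem_image_of_mem _ (Finset.mem_Iio.mpr ?_)
      have hne : p i ≠ s j := fun e => (Finset.mem_sdiff.mp hx1).2 (e ▸ hsm j)
      exact p.lt_iff_lt.mp (by omega)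
    have h4 : (S.filter (· < s j + 1)).card +
        ((Finset.range (a + b) \ S).filter (· < s j + 1)).card = s j + 1 := by
      rw [← Finset.card_union_of_disjoint, ← Finset.filter_union,
        Finset.union_sdiff_of_subset hS3]
      · have : (Finset.range (a + b)).filter (· < s j + 1) = Finset.range (s j + 1) := by
          ext x; simp; omega
        rw [this, Finset.card_range]
      · exact Finset.disjoint_filter_filter Finset.disjoint_sdiff
    omega
  refine ⟨⟨(twoRowCells h).symm.trans (Equiv.ofBijective g hg2), ?_, ?_⟩, ?_⟩
  · intro c c' h1 h2
    obtain ⟨x, rfl⟩ := (twoRowCells h).surjective c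
    obtain ⟨y, rfl⟩ := (twoRowCells h).surjective c'
    simp only [Equiv.trans_apply, Equiv.symm_apply_apply, Equiv.ofBijective_apply]
    rcases x with i | i <;> rcases y with j | j <;> simp [twoRowCells] at h1 h2
    · exact p.strictMono h2
    · exact s.strictMono h2
  · intro c c' h1 h2
    obtain ⟨x, rfl⟩ := (twoRowCells h).surjective c
    obtain ⟨y, rfl⟩ := (twoRowCells h).surjective c'
    simp only [Equiv.trans_apply, Equiv.symm_apply_apply, Equiv.ofBijective_apply]
    rcases x with i | i <;> rcases y with j | j <;> simp [twoRowCells] at h1 h2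
    obtain rfl : i = Fin.castLE h j := Fin.ext h1
    exact hcol j
  · ext m
    simp only [secondRow, Finset.mem_image, Finset.mem_univ, true_and, entry, Equiv.trans_apply,
      Equiv.symm_apply_apply, Equiv.ofBijective_apply]
    change (∃ j, s j = m) ↔ m ∈ S
    rw [← Set.mem_range, hs, Finset.range_orderEmbOfFin, Finset.mem_coe]

end StandardTableau

/-- Second rows of tableaux are the ballot sets. The count is a difference of two weight
multiplicities of a tensor power, the form in which `finrank_P` delivers multiplicities. -/
theorem card_standardTableau (h : b ≤ a) :
    Nat.card (StandardTableau (twoRow a b h)) + (a + b).choose (a + 1) = (a + b).choose a := by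
  have e : StandardTableau (twoRow a b h) ≃ ballotSets (a + b) b :=
    Equiv.ofBijective (fun T => ⟨T.secondRow, T.secondRow_mem⟩)
      ⟨fun T T' hT => StandardTableau.secondRow_injective (congrArg Subtype.val hT),
        fun S => by
          obtain ⟨T, hT⟩ := StandardTableau.exists_secondRow (h := h) S.2
          exact ⟨T, Subtype.ext hT⟩⟩
  have h1 := card_ballotSets (a + b) b (by omega)
  rw [Nat.card_congr e, Nat.card_eq_fintype_card, Fintype.card_coe]
  rw [Nat.add_sub_cancel] at h1
  rw [h1, Nat.choose_symm_add]

instance (h : b ≤ a) : Finite (StandardTableau (twoRow a b h)) :=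
  Finite.of_injective (fun T => (⟨T.secondRow, T.secondRow_mem⟩ : ballotSets (a + b) b))
    fun _ _ hT => StandardTableau.secondRow_injective (congrArg Subtype.val hT)

end

end

section

/-! ### Multiplicities -/

/-- The dimension of the weight space of weight `n` in the `m`-th tensor power of the vector
representation. -/
def weightMult (m : ℕ) (n : ℤ) : ℕ :=
  if (n + m) % 2 = 0 ∧ 0 ≤ n + m then m.choose ((n + m) / 2).toNat else 0

theorem weightMult_of_eq {m r : ℕ} {n : ℤ} (h : n + m = 2 * r) : weightMult m n = m.choose r := by
  rw [weightMult, if_pos (by omega)]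
  congr 1; omega

theorem weightMult_ne_zero {m : ℕ} {n : ℤ} (h : weightMult m n ≠ 0) :
    ∃ r : ℕ, n + m = 2 * r ∧ r ≤ m := by
  rw [weightMult] at h
  split_ifs at h with h1
  · refine ⟨((n + m) / 2).toNat, by omega, ?_⟩
    by_contra h2
    exact h (Nat.choose_eq_zero_of_lt (by omega))
  · exact absurd rfl h

theorem weightMult_eq_zero {m : ℕ} {n : ℤ} (h : (m : ℤ) < n) : weightMult m n = 0 := by
  by_contra h2
  obtain ⟨r, h3, h4⟩ := weightMult_ne_zero h2
  omega

theorem weightMult_neg (m : ℕ) (n : ℤ) : weightMult m (-n) = weightMult m n := by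
  have key : ∀ n, weightMult m n ≠ 0 → weightMult m (-n) = weightMult m n := by
    intro n hn
    obtain ⟨r, h1, h2⟩ := weightMult_ne_zero hn
    rw [weightMult_of_eq h1, weightMult_of_eq (r := m - r) (by omega), Nat.choose_symm h2]
  by_cases h : weightMult m n = 0
  · by_contra h2
    have h3 := key (-n) (by rwa [h] at h2)
    rw [neg_neg] at h3
    exact h2 h3.symm
  · exact key n h

/-- The dimension of a tensor power, summed over simple `sl₂`-modules of dimension `m + 1 - 2 * t`;
truncated subtraction discards `2 * t > m`. In the induction a ballot set with `t` elements
contributes with factors `m + 2 - 2 * t` and `m - 2 * t`, which add up to twice `m + 1 - 2 * t`. -/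
theorem sum_ballotSets (m : ℕ) :
    ∑ t ∈ Finset.range (m + 1), (m + 1 - 2 * t) * (ballotSets m t).card = 2 ^ m := by
  induction m with
  | zero => simp [ballotSets_zero]
  | succ m ih =>
    have h1 : ∀ s ∈ Finset.range (m + 1),
        (m + 1 + 1 - 2 * (s + 1)) * (ballotSets (m + 1) (s + 1)).card =
          (m + 2 - 2 * (s + 1)) * (ballotSets m (s + 1)).card +
            (m - 2 * s) * (ballotSets m s).card := by
      intro s _
      by_cases h : 2 * (s + 1) ≤ m + 1
      · rw [card_ballotSets_succ h, mul_add]; congr 2; omega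
      · rw [show m + 1 + 1 - 2 * (s + 1) = 0 by omega, show m - 2 * s = 0 by omega]; simp
    rw [Finset.sum_range_succ', Finset.sum_congr rfl h1, Finset.sum_add_distrib, add_right_comm]
    have h2 := Finset.sum_range_succ' (fun t => (m + 2 - 2 * t) * (ballotSets m t).card) (m + 1)
    have h3 : (ballotSets (m + 1) 0).card = (ballotSets m 0).card := by simp [ballotSets_zero]
    rw [h3, ← h2, Finset.sum_range_succ, show m + 2 - 2 * (m + 1) = 0 by omega, zero_mul, add_zero,
      ← Finset.sum_add_distrib, pow_succ, ← ih, Finset.sum_mul]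
    refine Finset.sum_congr rfl fun t _ => ?_
    by_cases h : 2 * t ≤ m
    · rw [← add_mul, mul_right_comm]; congr 1; omega
    · rw [ballotSets_eq_empty (by omega)]; simp

namespace MURep

variable {N : Type*} [AddCommGroup N] [Module K N] (R : MURep N) [FiniteDimensional K N] {d : ℕ}

/-- Only the sum of the `one` and mixed dimensions is given, but each is symmetric in the weight.
Comparing `D 1 (n + 1)` with `D 1 (-(n + 1))` eliminates the `one` piece, so the deviation `g`
satisfies `g (n + 2) = g n`; it vanishes for large weights, hence everywhere. -/
theorem finrank_mixed (hD1 : ∀ n, Module.finrank K (R.D 1 n) =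
    weightMult d n + d * weightMult (d - 1) (n + 1)) (n : ℤ) :
    Module.finrank K (R.mixed.W n) = d * weightMult (d - 1) n := by
  set g : ℤ → ℤ := fun n => (Module.finrank K (R.mixed.W n) : ℤ) - (d * weightMult (d - 1) n : ℕ)
    with hg
  have step : ∀ n, g (n + 2) = g n := by
    intro n
    have h1 := R.finrank_D_one (n + 1)
    have h2 := R.finrank_D_one (-(n + 1))
    rw [hD1] at h1 h2
    rw [R.one.finrank_neg, weightMult_neg, show -(n + 1) + 1 = -n by ring, R.mixed.finrank_neg,
      weightMult_neg] at h2
    rw [show n + 1 + 1 = n + 2 by ring] at h1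
    simp only [hg]
    omega
  have steps : ∀ (k : ℕ) n, g (n + 2 * k) = g n := by
    intro k
    induction k with
    | zero => intro n; simp
    | succ k ih =>
      intro n
      rw [← ih n, ← step (n + 2 * k)]
      congr 1; push_cast; ring
  have h0 : g n = 0 := by
    rw [← steps (|R.mixed.B| + |n| + d + 1).toNat n]
    have h1 := abs_nonneg R.mixed.B
    have h2 := abs_nonneg n
    have h3 := neg_abs_le n
    have h4 := le_abs_self R.mixed.B
    simp only [hg]
    rw [R.mixed.bound _ (by rw [abs_of_nonneg (by omega)]; omega), finrank_bot,
      weightMult_eq_zero (by omega)]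
    simp
  simp only [hg] at h0
  omega

theorem finrank_one (hD1 : ∀ n, Module.finrank K (R.D 1 n) =
    weightMult d n + d * weightMult (d - 1) (n + 1)) (n : ℤ) :
    Module.finrank K (R.one.W n) = weightMult d n := by
  have := R.finrank_D_one n
  rw [hD1, R.finrank_mixed hD1] at this
  omega

theorem finrank_zero (hD1 : ∀ n, Module.finrank K (R.D 1 n) =
    weightMult d n + d * weightMult (d - 1) (n + 1)) (hD0 : ∀ n, Module.finrank K (R.D 0 n) =
    d.choose 2 * weightMult (d - 2) n + d * weightMult (d - 1) (n - 1)) (n : ℤ) :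
    Module.finrank K (R.zero.W n) = d.choose 2 * weightMult (d - 2) n := by
  have := R.finrank_D_zero n
  rw [hD0, R.finrank_mixed hD1] at this
  omega

end MURep

instance {d : ℕ} (b : Bipartition d) : Finite (StandardTableau b.shape) :=
  inferInstanceAs (Finite (StandardTableau (twoRow b.l1 b.l2 b.l2_le_l1)))

theorem card_shape {d : ℕ} (b : Bipartition d) : Nat.card (StandardTableau b.shape) +
    (b.l1 + b.l2).choose (b.l1 + 1) = (b.l1 + b.l2).choose b.l1 :=
  card_standardTableau b.l2_le_l1

theorem card_multiplicity {d : ℕ} (b : Bipartition d) : Module.finrank K (M b) =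
    d.choose b.s * Nat.card (StandardTableau b.shape) := by
  have := Fintype.ofFinite (StandardTableau b.shape)
  rw [Module.finrank_finsupp_self, Fintype.card_prod, Fintype.card_finset_len, Fintype.card_fin,
    Nat.card_eq_fintype_card]

instance {d : ℕ} (b : Bipartition d) : FiniteDimensional K (M b) :=
  have := Fintype.ofFinite (StandardTableau b.shape)
  inferInstance

namespace MURep

variable {N : Type*} [AddCommGroup N] [Module K N] (R : MURep N) [FiniteDimensional K N] {d : ℕ}

/-- With `m = λ₁ + λ₂`, `finrank_P` gives `(d choose s)` times `(m choose λ₁) - (m choose (λ₁ +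
1))`, and this difference counts standard tableaux. -/
theorem finrank_hw (hD1 : ∀ n, Module.finrank K (R.D 1 n) =
    weightMult d n + d * weightMult (d - 1) (n + 1)) (hD0 : ∀ n, Module.finrank K (R.D 0 n) =
    d.choose 2 * weightMult (d - 2) n + d * weightMult (d - 1) (n - 1)) (b : Bipartition d) :
    Module.finrank K (R.hw b.label) = Module.finrank K (M b) := by
  rw [card_multiplicity]
  have h1 := card_shape b
  generalize Nat.card (StandardTableau b.shape) = c at h1 ⊢
  obtain ⟨l1, l2, s, h12, hs, hd⟩ := b
  simp only at h1 ⊢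
  have hn : -1 ≤ ((l1 - l2 : ℕ) : ℤ) := by omega
  have ha (m : ℕ) (hm : m = l1 + l2) : weightMult m ((l1 - l2 : ℕ) : ℤ) = m.choose l1 :=
    weightMult_of_eq (by omega)
  have hb (m : ℕ) (hm : m = l1 + l2) :
      weightMult m (((l1 - l2 : ℕ) : ℤ) + 2) = m.choose (l1 + 1) :=
    weightMult_of_eq (by push_cast; omega)
  obtain rfl | rfl | rfl : s = 0 ∨ s = 1 ∨ s = 2 := by omega
  · have h2 := R.one.finrank_P hn
    rw [R.finrank_one hD1, R.finrank_one hD1, ha _ (by omega), hb _ (by omega)] at h2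
    change Module.finrank K (R.one.P ((l1 - l2 : ℕ) : ℤ)) = _
    obtain rfl : d = l1 + l2 := by omega
    rw [Nat.choose_zero_right]
    omega
  · have h2 := R.mixed.finrank_P hn
    rw [R.finrank_mixed hD1, R.finrank_mixed hD1, ha _ (by omega), hb _ (by omega), show d - 1 = l1 + l2 by omega, ← h1,
      mul_add] at h2
    change Module.finrank K (R.mixed.P (((l1 - l2 + 1 : ℕ) : ℤ) - 1)) = _
    rw [Nat.choose_one_right, Nat.cast_succ, add_sub_cancel_right]
    omega
  · have h2 := R.zero.finrank_P hn
    rw [R.finrank_zero hD1 hD0, R.finrank_zero hD1 hD0, ha _ (by omega), hb _ (by omega), show d - 2 = l1 + l2 by omega, ← h1,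
      mul_add] at h2
    change Module.finrank K (R.zero.P ((l1 - l2 : ℕ) : ℤ)) = _
    omega

/-- A nonzero highest weight vector lives in a nonzero weight space, and the known multiplicities
vanish unless the weight comes from a bipartition of `d`. -/
theorem exists_label (hd : 0 < d) (hD1 : ∀ n, Module.finrank K (R.D 1 n) =
    weightMult d n + d * weightMult (d - 1) (n + 1)) (hD0 : ∀ n, Module.finrank K (R.D 0 n) =
    d.choose 2 * weightMult (d - 2) n + d * weightMult (d - 1) (n - 1)) {t : Label}
    {w : N} (hw : w ∈ R.hw t) (h0 : w ≠ 0) : ∃ b : Bipartition d, b.label = t := by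
  have key : ∀ S : Submodule K N, w ∈ S → Module.finrank K S ≠ 0 := by
    intro S hS h
    rw [Submodule.finrank_eq_zero] at h
    exact h0 ((Submodule.mem_bot K).mp (h ▸ hS))
  cases t with
  | one n =>
    have h1 := key _ (R.one.mem_P.mp hw).1
    rw [R.finrank_one hD1] at h1
    obtain ⟨r, h2, h3⟩ := weightMult_ne_zero h1
    refine ⟨⟨r, d - r, 0, by omega, by omega, by omega⟩, ?_⟩
    simp only [Bipartition.label]
    congr 1; omega
  | mixed n =>
    rcases Nat.eq_zero_or_pos n with rfl | hn
    -- The label `mixed 0` names the zero module, and no vector has its highest weight `-1`.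
    · exact absurd (R.mixed.P_eq_zero_of_neg (by simp) hw) h0
    have h1 := key _ (R.mixed.mem_P.mp hw).1
    rw [R.finrank_mixed hD1] at h1
    obtain ⟨r, h2, h3⟩ := weightMult_ne_zero (right_ne_zero_of_mul h1)
    refine ⟨⟨r, d - 1 - r, 1, by omega, by omega, by omega⟩, ?_⟩
    simp only [Bipartition.label]
    congr 1; omega
  | zero n =>
    have h1 := key _ (R.zero.mem_P.mp hw).1
    rw [R.finrank_zero hD1 hD0] at h1
    obtain ⟨r, h2, h3⟩ := weightMult_ne_zero (right_ne_zero_of_mul h1)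
    have h4 : 2 ≤ d := by
      by_contra h
      exact left_ne_zero_of_mul h1 (Nat.choose_eq_zero_of_lt (by omega))
    refine ⟨⟨r, d - 2 - r, 2, by omega, by omega, by omega⟩, ?_⟩
    simp only [Bipartition.label]
    congr 1; omega

end MURep

/-! ### The dimension of the direct sum -/

/-- Bipartitions with at most two rows on the left and at most two boxes on the right. -/
def bipartitionEquiv (d : ℕ) :
    Bipartition d ≃ Σ s : Fin 3, {t : Fin (d + 1) // 2 * (t : ℕ) + s ≤ d} where
  toFun b := ⟨⟨b.s, Nat.lt_succ_of_le b.s_le_two⟩, ⟨b.l2, by have := b.size; omega⟩, by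
    have := b.size; have := b.l2_le_l1; simp only; omega⟩
  invFun x := ⟨d - x.1 - x.2.1, x.2.1, x.1, by have := x.2.2; omega, by omega,
    by have := x.2.2; omega⟩
  left_inv b := by
    obtain ⟨l1, l2, s, h1, h2, h3⟩ := b
    simp only [Bipartition.mk.injEq, and_true]
    omega
  right_inv x := rfl

noncomputable instance (d : ℕ) : Fintype (Bipartition d) :=
  Fintype.ofEquiv _ (bipartitionEquiv d).symm

noncomputable instance (d : ℕ) : DecidableEq (Bipartition d) := Classical.decEq _

noncomputable instance (t : Label) : Fintype t.Index :=
  match t with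
  | .zero n => inferInstanceAs (Fintype (Fin (n + 1)))
  | .one n => inferInstanceAs (Fintype (Fin (n + 1)))
  | .mixed n => inferInstanceAs (Fintype (Fin n ⊕ Fin n))

instance (t : Label) : FiniteDimensional K (L t) :=
  inferInstanceAs (FiniteDimensional K (t.Index →₀ K))

instance (t : Label) : Module.Free K (L t) :=
  inferInstanceAs (Module.Free K (t.Index →₀ K))

theorem finrank_L (t : Label) : Module.finrank K (L t) = Fintype.card t.Index :=
  Module.finrank_finsupp_self K

/-- The number `d - s + 1 - 2 * λ₂` is `λ₁ - λ₂ + 1`, the dimension of the uniform modules; for `s =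
1` the mixed module has twice that dimension. -/
theorem finrank_summand {d : ℕ} (b : Bipartition d) :
    Module.finrank K (L b.label ⊗[K] M b) =
      (if b.s = 1 then 2 else 1) * d.choose b.s *
        ((d - b.s + 1 - 2 * b.l2) * (ballotSets (d - b.s) b.l2).card) := by
  rw [Module.finrank_tensorProduct, card_multiplicity, finrank_L]
  have h1 : Nat.card (StandardTableau b.shape) = (ballotSets (d - b.s) b.l2).card := by
    have h2 := card_shape b
    have h3 := card_ballotSets (b.l1 + b.l2) b.l2 (by have := b.l2_le_l1; omega)
    rw [show d - b.s = b.l1 + b.l2 by have := b.size; omega]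
    rw [Nat.add_sub_cancel, ← Nat.choose_symm_add] at h3
    omega
  rw [h1]
  obtain ⟨l1, l2, s, h12, hs, hd⟩ := b
  simp only
  match s, hs with
  | 0, _ =>
    have : Fintype.card (Label.Index (.one (l1 - l2))) = l1 - l2 + 1 := Fintype.card_fin _
    simp only [Bipartition.label, this]
    rw [show d - 0 + 1 - 2 * l2 = l1 - l2 + 1 by omega]
    simp
  | 1, _ =>
    have : Fintype.card (Label.Index (.mixed (l1 - l2 + 1))) = 2 * (l1 - l2 + 1) := by
      change Fintype.card (Fin _ ⊕ Fin _) = _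
      simp; ring
    simp only [Bipartition.label, this]
    rw [show d - 1 + 1 - 2 * l2 = l1 - l2 + 1 by omega]
    simp; ring
  | 2, _ =>
    have : Fintype.card (Label.Index (.zero (l1 - l2))) = l1 - l2 + 1 := Fintype.card_fin _
    simp only [Bipartition.label, this]
    rw [show d - 2 + 1 - 2 * l2 = l1 - l2 + 1 by omega]
    simp; ring

theorem sum_fiber {d s : ℕ} (hs : s ≤ d) :
    ∑ t : {t : Fin (d + 1) // 2 * (t : ℕ) + s ≤ d},
      (d - s + 1 - 2 * (t : ℕ)) * (ballotSets (d - s) t).card = 2 ^ (d - s) := by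
  rw [← Finset.sum_subtype (Finset.univ.filter fun t : Fin (d + 1) => 2 * (t : ℕ) + s ≤ d)
    (fun t => by simp)
    (fun t : Fin (d + 1) => (d - s + 1 - 2 * (t : ℕ)) * (ballotSets (d - s) t).card),
    Finset.sum_filter_of_ne, ← Finset.sum_range
      (fun t => (d - s + 1 - 2 * t) * (ballotSets (d - s) t).card), ← sum_ballotSets (d - s)]
  · refine (Finset.sum_subset (Finset.range_mono (by omega)) fun t _ ht => ?_).symm
    rw [Finset.mem_range] at ht
    rw [show d - s + 1 - 2 * t = 0 by omega, zero_mul]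
  · intro t _ h
    have := left_ne_zero_of_mul h
    omega

theorem finrank_directSum {d : ℕ} (hd : 0 < d) :
    Module.finrank K (⨁ b : Bipartition d, L b.label ⊗[K] M b) =
      2 ^ d + d * 2 ^ d + d.choose 2 * 2 ^ (d - 2) := by
  rw [Module.finrank_directSum]
  simp only [finrank_summand]
  rw [← (bipartitionEquiv d).symm.sum_comp, Fintype.sum_sigma]
  have h (s : Fin 3) : ∑ t : {t : Fin (d + 1) // 2 * (t : ℕ) + s ≤ d},
      (if (s : ℕ) = 1 then 2 else 1) * d.choose s *
        ((d - s + 1 - 2 * (t : ℕ)) * (ballotSets (d - s) t).card) =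
      (if (s : ℕ) = 1 then 2 else 1) * d.choose s * 2 ^ (d - s) := by
    rw [← Finset.mul_sum]
    by_cases hs : (s : ℕ) ≤ d
    · rw [sum_fiber hs]
    · rw [Nat.choose_eq_zero_of_lt (by omega)]; simp
  refine (Finset.sum_congr rfl fun s _ => h s).trans ?_
  rw [Fin.sum_univ_three]
  obtain ⟨m, rfl⟩ : ∃ m, d = m + 1 := ⟨d - 1, by omega⟩
  simp [pow_succ]
  ring

namespace MURep

variable {N : Type*} [AddCommGroup N] [Module K N] (R : MURep N) [FiniteDimensional K N] {d : ℕ}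

/-- Any linear isomorphisms `θ` from multiplicity spaces to highest weight spaces give an
equivariant map from the direct sum. It is onto because images of simple modules span, and then
bijective because the dimensions agree. -/
theorem exists_equiv (hd : 0 < d) (hD1 : ∀ n, Module.finrank K (R.D 1 n) =
    weightMult d n + d * weightMult (d - 1) (n + 1)) (hD0 : ∀ n, Module.finrank K (R.D 0 n) =
    d.choose 2 * weightMult (d - 2) n + d * weightMult (d - 1) (n - 1))
    (hN : Module.finrank K N = 2 ^ d + d * 2 ^ d + d.choose 2 * 2 ^ (d - 2))
    (hspan : ∀ S : Submodule K N, (∀ n : ℤ, ∀ x, R.k x = v ^ n • x → x ∈ S) → S = ⊤)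
    (ρ : MU2 →ₐ[K] Module.End K N) (hρ : ∀ g, ρ (MU2.gen g) = R.φ g) :
    ∃ Φ : N ≃ₗ[K] ⨁ b : Bipartition d, L b.label ⊗[K] M b,
      ∀ (a : MU2) (x : N), Φ (ρ a x) = a • Φ x := by
  let θ (b : Bipartition d) : M b ≃ₗ[K] R.hw b.label :=
    LinearEquiv.ofFinrankEq _ _ (R.finrank_hw hD1 hD0 b).symm
  let Ψ : (⨁ b : Bipartition d, L b.label ⊗[K] M b) →ₗ[K] N :=
    DirectSum.toModule K _ _ fun b => TensorProduct.lift
      ((R.simpleMap b.label ∘ₗ (R.hw b.label).subtype ∘ₗ (θ b).toLinearMap).flip)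
  have hΨ (b : Bipartition d) (x : L b.label) (m : M b) :
      Ψ (DirectSum.lof K _ (fun b : Bipartition d => L b.label ⊗[K] M b) b (x ⊗ₜ m)) =
        R.simpleMap b.label (θ b m) x := by
    simp only [Ψ, DirectSum.toModule_lof, TensorProduct.lift.tmul]
    rfl
  have hsurj : Function.Surjective Ψ := by
    rw [← LinearMap.range_eq_top]
    refine hspan _ fun n x hx => R.mem_of_simpleMap_mem (fun t w hw y => ?_) hx
    by_cases h0 : w = 0
    · rw [h0, map_zero]; exact zero_mem _
    obtain ⟨b, rfl⟩ := R.exists_label hd hD1 hD0 hw h0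
    refine ⟨_, (hΨ b y ((θ b).symm ⟨w, hw⟩)).trans ?_⟩
    rw [LinearEquiv.apply_symm_apply]
  have hlin (a : MU2) (y) : Ψ (a • y) = ρ a (Ψ y) := by
    induction y using DirectSum.induction_on with
    | zero => simp
    | add x y hx hy => rw [smul_add, map_add, map_add, map_add, hx, hy]
    | of b z =>
      induction z using TensorProduct.induction_on with
      | zero => simp
      | add x y hx hy => rw [map_add, smul_add, map_add, map_add, map_add, hx, hy]
      | tmul x m =>
        have h1 : a • DirectSum.of (fun b : Bipartition d => L b.label ⊗[K] M b) b (x ⊗ₜ m) =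
            DirectSum.lof K _ (fun b : Bipartition d => L b.label ⊗[K] M b) b ((a • x) ⊗ₜ m) := by
          rw [← TensorProduct.smul_tmul']
          exact (DirectSum.of_smul _ _ _ _).symm
        rw [h1, hΨ, R.simpleMap_apply ρ hρ (θ b m).2, ← hΨ]
        rfl
  have hfin : Module.finrank K (⨁ b : Bipartition d, L b.label ⊗[K] M b) = Module.finrank K N := by
    rw [hN, finrank_directSum hd]
  let Φ := LinearEquiv.ofBijective Ψ
    ⟨(LinearMap.injective_iff_surjective_of_finrank_eq_finrank hfin).mpr hsurj, hsurj⟩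
  refine ⟨Φ.symm, fun a x => ?_⟩
  rw [LinearEquiv.symm_apply_eq]
  change _ = Ψ _
  rw [hlin]
  exact congrArg _ (Φ.apply_symm_apply x).symm

end MURep

end

section

/-! ### Coordinate subspaces -/

section CoordSpan

variable {k V ι : Type} [Field k] [AddCommGroup V] [Module k V]

/-- The span of the basis vectors with index in `S`. -/
def coordSpan (b : Module.Basis ι k V) (S : Set ι) : Submodule k V := Submodule.span k (b '' S)

variable (b : Module.Basis ι k V)

theorem mem_coordSpan {S : Set ι} {x : V} : x ∈ coordSpan b S ↔ ∀ i, b.repr x i ≠ 0 → i ∈ S := by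
  rw [coordSpan, b.mem_span_image]
  simp [Set.subset_def]

theorem coordSpan_mono {S T : Set ι} (h : S ⊆ T) : coordSpan b S ≤ coordSpan b T :=
  Submodule.span_mono (Set.image_mono h)

theorem coordSpan_inf (S T : Set ι) : coordSpan b S ⊓ coordSpan b T = coordSpan b (S ∩ T) := by
  ext x
  simp only [Submodule.mem_inf, mem_coordSpan, Set.mem_inter_iff]
  exact ⟨fun h i hi => ⟨h.1 i hi, h.2 i hi⟩, fun h => ⟨fun i hi => (h i hi).1, fun i hi => (h i hi).2⟩⟩

theorem coordSpan_sup (S T : Set ι) : coordSpan b S ⊔ coordSpan b T = coordSpan b (S ∪ T) := by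
  rw [coordSpan, coordSpan, coordSpan, Set.image_union, Submodule.span_union]

theorem coordSpan_univ : coordSpan b Set.univ = ⊤ := by
  rw [coordSpan, Set.image_univ, b.span_eq]

theorem finrank_coordSpan [Fintype ι] (S : Finset ι) :
    Module.finrank k (coordSpan b (S : Set ι)) = S.card := by
  have h := finrank_span_eq_card (b.linearIndependent.comp ((↑) : S → ι) Subtype.val_injective)
  rw [Fintype.card_coe] at h
  have e : b '' (S : Set ι) = Set.range (b ∘ ((↑) : S → ι)) := by
    rw [Set.range_comp]
    simp
  rw [← h, coordSpan, e]

theorem sum_mem_coordSpan {J : Finset ι} {S : Set ι} :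
    ∑ j ∈ J, b j ∈ coordSpan b S ↔ ∀ j ∈ J, j ∈ S := by
  classical
  rw [mem_coordSpan]
  have h (i) : b.repr (∑ j ∈ J, b j) i = if i ∈ J then 1 else 0 := by
    simp [Finsupp.single_apply]
  simp only [h]
  simp

end CoordSpan

/-- A predicate true at the end is true at the start or switches on at some step. -/
theorem exists_least_fin {d : ℕ} {p : Fin (d + 1) → Prop} (h : p (Fin.last d)) :
    p 0 ∨ ∃ j : Fin d, p j.succ ∧ ¬ p j.castSucc := by
  by_contra! h2
  have : ∀ s, ¬ p s := fun s => by
    induction s using Fin.induction with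
    | zero => exact h2.1
    | succ j ih => exact fun h3 => ih (h2.2 j h3)
  exact this _ h

/-! ### Relative positions of a subspace, a complete flag and a vector -/

section Position

variable {k V : Type} [Field k] [AddCommGroup V] [Module k V] {d : ℕ}

/-- A complete flag. -/
structure IsComplete (F : Fin (d + 1) → Submodule k V) : Prop where
  mono : Monotone F
  bot : F 0 = ⊥
  top : F (Fin.last d) = ⊤
  finrank : ∀ s, Module.finrank k (F s) = s

/-- A basis adapted to a subspace, a complete flag and a vector in relative position `Y`. -/
structure Adapted (Y : XiMT 2 d) (W : Submodule k V) (F : Fin (d + 1) → Submodule k V) (x : V)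
    (b : Module.Basis (Fin d) k V) : Prop where
  flag : ∀ s, F s = coordSpan b {j | (j : ℕ) < s}
  sub : W = coordSpan b {j | Y.1.1 j = 0}
  vec : x = ∑ j ∈ Y.1.2, b j

/-- The number of the first `s` entries of `i` that are equal to `0`. -/
def XiMT.rk (Y : XiMT 2 d) (s : ℕ) : ℕ :=
  (Finset.univ.filter fun j : Fin d => Y.1.1 j = 0 ∧ (j : ℕ) < s).card

/-- The numerical invariants of the relative position `Y`. -/
structure HasType (Y : XiMT 2 d) (W : Submodule k V) (F : Fin (d + 1) → Submodule k V)
    (x : V) : Prop where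
  rank : ∀ s, Module.finrank k (W ⊓ F s : Submodule k V) = Y.rk s
  mem : ∀ s, x ∈ F s ↔ ∀ j ∈ Y.1.2, (j : ℕ) < s
  mem_sup : ∀ s, x ∈ W ⊔ F s ↔ ∀ j ∈ Y.1.2, Y.1.1 j = 1 → (j : ℕ) < s

theorem Adapted.hasType {Y : XiMT 2 d} {W : Submodule k V} {F : Fin (d + 1) → Submodule k V}
    {x : V} {b : Module.Basis (Fin d) k V} (h : Adapted Y W F x b) : HasType Y W F x where
  rank s := by
    have e : ({j | Y.1.1 j = 0} ∩ {j | (j : ℕ) < s} : Set (Fin d)) =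
        (Finset.univ.filter fun j : Fin d => Y.1.1 j = 0 ∧ (j : ℕ) < s : Finset _) := by
      ext j; simp
    rw [h.flag, h.sub, coordSpan_inf, e, finrank_coordSpan, XiMT.rk]
  mem s := by
    rw [h.flag, h.vec, sum_mem_coordSpan]; rfl
  mem_sup s := by
    rw [h.flag, h.sub, coordSpan_sup, h.vec, sum_mem_coordSpan]
    refine forall₂_congr fun j _ => ?_
    have : Y.1.1 j = 0 ∨ Y.1.1 j = 1 := by omega
    simp only [Set.mem_union, Set.mem_ofPred_eq]
    rcases this with h | h <;> simp [h]

theorem XiMT.rk_succ (Y : XiMT 2 d) (j : Fin d) :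
    Y.rk (j + 1) = Y.rk j + if Y.1.1 j = 0 then 1 else 0 := by
  have e : (Finset.univ.filter fun i : Fin d => Y.1.1 i = 0 ∧ (i : ℕ) < j + 1) =
      (Finset.univ.filter fun i : Fin d => Y.1.1 i = 0 ∧ (i : ℕ) < j) ∪
        (if Y.1.1 j = 0 then {j} else ∅) := by
    ext i
    by_cases hij : i = j
    · subst hij; by_cases h0 : Y.1.1 i = 0 <;> simp [h0]
    · have hij' : (i : ℕ) ≠ j := fun h => hij (Fin.ext h)
      by_cases h0 : Y.1.1 j = 0
      · simp [h0, hij]; intro _; omega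
      · simp [h0]; intro _; omega
  rw [XiMT.rk, XiMT.rk, e, Finset.card_union_of_disjoint]
  · split_ifs <;> simp
  · split_ifs <;> simp

theorem XiMT.fst_eq_of_rk {Y Z : XiMT 2 d} (h : ∀ s : Fin (d + 1), Y.rk s = Z.rk s) :
    Y.1.1 = Z.1.1 := by
  funext j
  have h1 := Y.rk_succ j
  have h2 := Z.rk_succ j
  have h3 := h j.castSucc
  have h4 := h j.succ
  rw [Fin.val_castSucc] at h3
  rw [Fin.val_succ] at h4
  rw [h3, h4, h2] at h1
  have a1 : Y.1.1 j = 0 ∨ Y.1.1 j = 1 := by omega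
  have a2 : Z.1.1 j = 0 ∨ Z.1.1 j = 1 := by omega
  rcases a1 with a1 | a1 <;> rcases a2 with a2 | a2 <;> simp [a1, a2] at h1 ⊢

/-- A decoration has at most one position in each row, and the one in row `1` comes first. So a
position in row `0` is the maximum of `J`, and one in row `1` is the maximum of that part of `J`;
the bounds determine both maxima. -/
theorem XiMT.ext_of_bounds {Y Z : XiMT 2 d} (h0 : Y.1.1 = Z.1.1)
    (h1 : ∀ s : Fin (d + 1), (∀ j ∈ Y.1.2, (j : ℕ) < s) ↔ ∀ j ∈ Z.1.2, (j : ℕ) < s)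
    (h2 : ∀ s : Fin (d + 1), (∀ j ∈ Y.1.2, Y.1.1 j = 1 → (j : ℕ) < s) ↔
      ∀ j ∈ Z.1.2, Z.1.1 j = 1 → (j : ℕ) < s) : Y = Z := by
  have key : ∀ {Y Z : XiMT 2 d}, Y.1.1 = Z.1.1 →
      (∀ s : Fin (d + 1), (∀ j ∈ Y.1.2, (j : ℕ) < s) ↔ ∀ j ∈ Z.1.2, (j : ℕ) < s) →
      (∀ s : Fin (d + 1), (∀ j ∈ Y.1.2, Y.1.1 j = 1 → (j : ℕ) < s) ↔
        ∀ j ∈ Z.1.2, Z.1.1 j = 1 → (j : ℕ) < s) → Y.1.2 ⊆ Z.1.2 := by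
    intro Y Z h0 h1 h2 j hj
    have hj2 : Y.1.1 j = 0 ∨ Y.1.1 j = 1 := by omega
    rcases hj2 with hj2 | hj2
    · have h3 := mt (h1 j.castSucc).mpr fun h => absurd (h j hj) (by simp)
      push Not at h3
      obtain ⟨i, hi, hi2⟩ := h3
      rw [Fin.val_castSucc] at hi2
      rcases hi2.eq_or_lt with h4 | h4
      · rwa [Fin.ext h4]
      have h5 := mt (h1 i.castSucc).mp fun h => absurd (h i hi) (by simp)
      push Not at h5
      obtain ⟨t, ht, ht2⟩ := h5
      rw [Fin.val_castSucc] at ht2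
      have := Y.2 j hj t ht (Fin.lt_def.mpr (by omega))
      rw [hj2] at this
      exact absurd this (by simp)
    · have h3 := mt (h2 j.castSucc).mpr fun h => absurd (h j hj hj2) (by simp)
      push Not at h3
      obtain ⟨i, hi, hi1, hi2⟩ := h3
      rw [Fin.val_castSucc] at hi2
      rcases hi2.eq_or_lt with h4 | h4
      · rwa [Fin.ext h4]
      have h5 := mt (h2 i.castSucc).mp fun h => absurd (h i hi hi1) (by simp)
      push Not at h5
      obtain ⟨t, ht, ht1, ht2⟩ := h5
      rw [Fin.val_castSucc] at ht2
      have := Y.2 j hj t ht (Fin.lt_def.mpr (by omega))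
      rw [hj2, ht1] at this
      exact absurd this (by simp)
  refine Subtype.ext (Prod.ext h0 (Finset.Subset.antisymm (key h0 h1 h2)
    (key h0.symm (fun s => (h1 s).symm) fun s => (h2 s).symm)))

/-- The invariants separate relative positions, so together with `exists_adapted` they characterise
the orbits. -/
theorem HasType.unique {Y Z : XiMT 2 d} {W : Submodule k V} {F : Fin (d + 1) → Submodule k V}
    {x : V} (hY : HasType Y W F x) (hZ : HasType Z W F x) : Y = Z :=
  XiMT.ext_of_bounds (XiMT.fst_eq_of_rk fun s => (hY.rank s).symm.trans (hZ.rank s))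
    (fun s => (hY.mem s).symm.trans (hZ.mem s)) fun s => (hY.mem_sup s).symm.trans (hZ.mem_sup s)

namespace IsComplete

variable {F : Fin (d + 1) → Submodule k V} (hF : IsComplete F)

include hF

theorem le_succ (j : Fin d) : F j.castSucc ≤ F j.succ := hF.mono (Fin.castSucc_lt_succ).le

theorem exists_notMem [FiniteDimensional k V] (j : Fin d) : ∃ y ∈ F j.succ, y ∉ F j.castSucc := by
  by_contra! h
  have := Submodule.finrank_mono (show F j.succ ≤ F j.castSucc from h)
  rw [hF.finrank, hF.finrank] at this
  simp at this

theorem sub_smul_mem [FiniteDimensional k V] {j : Fin d} {y : V} (h1 : y ∈ F j.succ)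
    (h2 : y ∉ F j.castSucc) {x : V} (hx : x ∈ F j.succ) : ∃ c : k, x - c • y ∈ F j.castSucc := by
  have h3 : F j.castSucc ⊔ Submodule.span k {y} = F j.succ := by
    refine Submodule.eq_of_le_of_finrank_le (sup_le (hF.le_succ j)
      ((Submodule.span_singleton_le_iff_mem _ _).mpr h1)) ?_
    have h4 : F j.castSucc < F j.castSucc ⊔ Submodule.span k {y} :=
      lt_of_le_of_ne le_sup_left fun h => h2 (h ▸ Submodule.mem_sup_right
        (Submodule.mem_span_singleton_self y))
    have := Submodule.finrank_lt_finrank_of_lt h4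
    rw [hF.finrank, Fin.val_castSucc] at this
    rw [hF.finrank, Fin.val_succ]
    omega
  rw [← h3] at hx
  obtain ⟨z, hz, w, hw, rfl⟩ := Submodule.mem_sup.mp hx
  obtain ⟨c, rfl⟩ := Submodule.mem_span_singleton.mp hw
  exact ⟨c, by rwa [add_sub_cancel_right]⟩

/-- Induction along the flag: a vector of `W` new in layer `j` forces `j ∈ A`, and subtracting a
multiple of `b j ∈ W` moves it one step down. -/
theorem inf_le_span [FiniteDimensional k V] {b : Fin d → V} (h1 : ∀ j, b j ∈ F j.succ)
    (h2 : ∀ j, b j ∉ F j.castSucc) {W : Submodule k V} {A : Set (Fin d)}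
    (hA : ∀ j, (∃ w ∈ W, w ∈ F j.succ ∧ w ∉ F j.castSucc) → j ∈ A) (hW : ∀ j ∈ A, b j ∈ W)
    (s : Fin (d + 1)) : W ⊓ F s ≤ Submodule.span k (b '' {j | j ∈ A ∧ (j : ℕ) < s}) := by
  induction s using Fin.induction with
  | zero => rw [hF.bot, inf_bot_eq]; exact bot_le
  | succ j ih =>
    rintro x ⟨hx, hx2⟩
    have hmono : Submodule.span k (b '' {i | i ∈ A ∧ (i : ℕ) < j.castSucc}) ≤
        Submodule.span k (b '' {i | i ∈ A ∧ (i : ℕ) < j.succ}) :=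
      Submodule.span_mono (Set.image_mono fun i hi => ⟨hi.1, hi.2.trans (by simp)⟩)
    by_cases h3 : x ∈ F j.castSucc
    · exact hmono (ih ⟨hx, h3⟩)
    · have hj := hA j ⟨x, hx, hx2, h3⟩
      obtain ⟨c, hc⟩ := hF.sub_smul_mem (h1 j) (h2 j) hx2
      have h4 := hmono (ih ⟨W.sub_mem hx (W.smul_mem c (hW j hj)), hc⟩)
      have h5 : b j ∈ Submodule.span k (b '' {i | i ∈ A ∧ (i : ℕ) < j.succ}) :=
        Submodule.subset_span ⟨j, ⟨hj, by simp⟩, rfl⟩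
      have := add_mem h4 (Submodule.smul_mem _ c h5)
      rwa [sub_add_cancel] at this

theorem mem_of_lt {b : Fin d → V} (h1 : ∀ j, b j ∈ F j.succ) {j : Fin d} {s : Fin (d + 1)}
    (h : (j : ℕ) < s) : b j ∈ F s :=
  hF.mono (Fin.le_def.mpr (by rw [Fin.val_succ]; omega)) (h1 j)

/-- Vectors in the successive layers of a complete flag form a basis. -/
theorem exists_basis [FiniteDimensional k V] {b : Fin d → V} (h1 : ∀ j, b j ∈ F j.succ)
    (h2 : ∀ j, b j ∉ F j.castSucc) : ∃ B : Module.Basis (Fin d) k V, ⇑B = b ∧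
      (∀ s, F s = coordSpan B {j | (j : ℕ) < s}) ∧
      ∀ (W : Submodule k V) (A : Set (Fin d)),
        (∀ j, (∃ w ∈ W, w ∈ F j.succ ∧ w ∉ F j.castSucc) → j ∈ A) → (∀ j ∈ A, b j ∈ W) →
        W = coordSpan B A := by
  have h3 : ⊤ ≤ Submodule.span k (Set.range b) := by
    have := hF.inf_le_span h1 h2 (W := ⊤) (A := Set.univ) (fun _ _ => trivial)
      (fun _ _ => trivial) (Fin.last d)
    rw [hF.top, top_inf_eq] at this
    exact this.trans (Submodule.span_mono (Set.image_subset_range _ _))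
  have h4 : Fintype.card (Fin d) = Module.finrank k V := by
    have := hF.finrank (Fin.last d)
    rw [hF.top, finrank_top, Fin.val_last] at this
    rw [this, Fintype.card_fin]
  refine ⟨basisOfTopLeSpanOfCardEqFinrank b h3 h4, coe_basisOfTopLeSpanOfCardEqFinrank b h3 h4,
    fun s => ?_, fun W A hA hW => ?_⟩
  · refine le_antisymm ?_ ?_
    · have := hF.inf_le_span h1 h2 (W := ⊤) (A := Set.univ) (fun _ _ => trivial)
        (fun _ _ => trivial) s
      rw [top_inf_eq] at this
      simpa [coordSpan] using this
    · rw [coordSpan, Submodule.span_le, coe_basisOfTopLeSpanOfCardEqFinrank]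
      rintro _ ⟨j, hj, rfl⟩
      exact hF.mem_of_lt h1 hj
  · refine le_antisymm ?_ ?_
    · have := hF.inf_le_span h1 h2 hA hW (Fin.last d)
      rw [hF.top, inf_top_eq] at this
      refine this.trans ?_
      rw [coordSpan, coe_basisOfTopLeSpanOfCardEqFinrank]
      exact Submodule.span_mono (Set.image_mono fun j hj => hj.1)
    · rw [coordSpan, Submodule.span_le, coe_basisOfTopLeSpanOfCardEqFinrank]
      rintro _ ⟨j, hj, rfl⟩
      exact hW j hj

/-- Every triple of a subspace, a complete flag and a vector has an adapted basis. -/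
theorem exists_adapted [FiniteDimensional k V] (W : Submodule k V) (x : V) :
    ∃ Y b, Adapted Y W F x b := by
  classical
  let i : Fin d → Fin 2 := fun j => if ∃ w ∈ W, w ∈ F j.succ ∧ w ∉ F j.castSucc then 0 else 1
  have hi0 (j) : i j = 0 ↔ ∃ w ∈ W, w ∈ F j.succ ∧ w ∉ F j.castSucc := by
    simp only [i]; split_ifs with h <;> simp [h]
  -- it suffices to choose the vectors of the basis so that the vector is their partial sum
  have suff : ∀ (J : Finset (Fin d)) (c : Fin d → V), (∀ a ∈ J, ∀ b ∈ J, a < b → i b < i a) →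
      (∀ j ∈ J, c j ∈ F j.succ ∧ c j ∉ F j.castSucc ∧ (i j = 0 → c j ∈ W)) → x = ∑ j ∈ J, c j →
      ∃ Y b, Adapted Y W F x b := by
    intro J c hJ hc hx
    have hex : ∀ j, ∃ y, y ∈ F j.succ ∧ y ∉ F j.castSucc ∧ (i j = 0 → y ∈ W) := by
      intro j
      by_cases h : i j = 0
      · obtain ⟨w, hw, h1, h2⟩ := (hi0 j).mp h
        exact ⟨w, h1, h2, fun _ => hw⟩
      · obtain ⟨y, h1, h2⟩ := hF.exists_notMem j
        exact ⟨y, h1, h2, fun h3 => absurd h3 h⟩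
    choose y hy using hex
    let b : Fin d → V := fun j => if j ∈ J then c j else y j
    have hb (j) : b j ∈ F j.succ ∧ b j ∉ F j.castSucc ∧ (i j = 0 → b j ∈ W) := by
      simp only [b]; split_ifs with h
      · exact hc j h
      · exact hy j
    obtain ⟨B, hB, hB1, hB2⟩ := hF.exists_basis (fun j => (hb j).1) fun j => (hb j).2.1
    refine ⟨⟨(i, J), hJ⟩, B, hB1, hB2 W {j | i j = 0} (fun j hj => (hi0 j).mpr hj)
      fun j hj => (hb j).2.2 hj, ?_⟩
    rw [hx, hB]
    exact Finset.sum_congr rfl fun j hj => (if_pos hj).symm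
  -- The layer `a` of `x` modulo `W` and the layer `t` of `x` itself are the candidates for elements
  -- of `J`.
  have h1 := exists_least_fin (p := fun s => x ∈ W ⊔ F s) (by rw [hF.top]; simp)
  have h2 := exists_least_fin (p := fun s => x ∈ F s) (by rw [hF.top]; simp)
  rw [hF.bot] at h1 h2
  simp only [sup_bot_eq, Submodule.mem_bot] at h1 h2
  rcases h2 with rfl | ⟨t, ht1, ht2⟩
  · exact suff ∅ 0 (by simp) (by simp) (by simp)
  rcases h1 with hxW | ⟨a, ha1, ha2⟩
  · exact suff {t} (fun _ => x) (by simp) (by simpa using ⟨ht1, ht2, fun _ => hxW⟩) (by simp)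
  obtain ⟨w, hw, y, hy, rfl⟩ := Submodule.mem_sup.mp ha1
  have hy2 : y ∉ F a.castSucc := fun h => ha2 (Submodule.add_mem_sup hw h)
  -- If `W` met the layer `a`, subtracting an element of `W` from `y` would put `x` in `W ⊔ F
  -- a.castSucc`.
  have hia : i a ≠ 0 := by
    intro h
    obtain ⟨u, hu, hu1, hu2⟩ := (hi0 a).mp h
    obtain ⟨c, hc⟩ := hF.sub_smul_mem hu1 hu2 hy
    refine ha2 ?_
    have : w + y = (w + c • u) + (y - c • u) := by abel
    rw [this]
    exact Submodule.add_mem_sup (W.add_mem hw (W.smul_mem c hu)) hc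
  have hat : a ≤ t := by
    by_contra h
    have h3 : F t.succ ≤ F a.castSucc := hF.mono (Fin.le_def.mpr (by
      rw [Fin.val_succ, Fin.val_castSucc]; exact Fin.lt_def.mp (not_le.mp h)))
    exact ha2 (Submodule.mem_sup_right (h3 ht1))
  rcases hat.eq_or_lt with rfl | hat
  · exact suff {a} (fun _ => w + y) (by simp) (by simpa using ⟨ht1, ht2, fun h => absurd h hia⟩)
      (by simp)
  have h3 : F a.succ ≤ F t.castSucc := hF.mono (Fin.le_def.mpr (by
      rw [Fin.val_succ, Fin.val_castSucc]; exact Fin.lt_def.mp hat))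
  -- As `a < t`, the summand `y` lies below the layer `t`, so `w` lies in the layer of `x`.
  have hw1 : w ∈ F t.succ := by
    have := (F t.succ).sub_mem ht1 (hF.le_succ t (h3 hy))
    rwa [add_sub_cancel_right] at this
  have hw2 : w ∉ F t.castSucc := fun h => ht2 (add_mem h (h3 hy))
  have hit : i t = 0 := (hi0 t).mpr ⟨w, hw, hw1, hw2⟩
  refine suff {t, a} (fun j => if j = t then w else y) ?_ ?_ ?_
  · simp only [Finset.mem_insert, Finset.mem_singleton]
    rintro p (rfl | rfl) q (rfl | rfl) hpq
    · exact absurd hpq (lt_irrefl _)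
    · exact absurd hpq hat.not_gt
    · rw [hit]; exact Fin.pos_of_ne_zero hia
    · exact absurd hpq (lt_irrefl _)
  · simp only [Finset.mem_insert, Finset.mem_singleton]
    rintro p (rfl | rfl)
    · simpa using ⟨hw1, hw2, fun _ => hw⟩
    · simpa [hat.ne] using ⟨hy, hy2, fun h => absurd h hia⟩
  · rw [Finset.sum_pair hat.ne']
    simp [hat.ne]

theorem exists_hasType [FiniteDimensional k V] (W : Submodule k V) (x : V) :
    ∃ Y, HasType Y W F x := by
  obtain ⟨Y, b, h⟩ := hF.exists_adapted W x
  exact ⟨Y, h.hasType⟩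

theorem exists_adapted_of_hasType [FiniteDimensional k V] {Y : XiMT 2 d} {W : Submodule k V}
    {x : V} (h : HasType Y W F x) : ∃ b, Adapted Y W F x b := by
  obtain ⟨Z, b, hZ⟩ := hF.exists_adapted W x
  rw [h.unique hZ.hasType]
  exact ⟨b, hZ⟩

end IsComplete

theorem Adapted.isComplete {Y : XiMT 2 d} {W : Submodule k V} {F : Fin (d + 1) → Submodule k V}
    {x : V} {b : Module.Basis (Fin d) k V} (h : Adapted Y W F x b) : IsComplete F where
  mono s t hst := by
    rw [h.flag, h.flag]
    exact coordSpan_mono b fun j (hj : (j : ℕ) < s) => hj.trans_le hst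
  bot := by rw [h.flag]; simp [coordSpan]
  top := by
    rw [h.flag, ← coordSpan_univ b]
    congr 1
    ext j; simp
  finrank s := by
    have : {j : Fin d | (j : ℕ) < s} = (Finset.univ.filter fun j : Fin d => (j : ℕ) < s : Finset _) := by
      simp
    rw [h.flag, this, finrank_coordSpan, Fin.card_filter_val_lt]
    omega

/-! ### Comparison with orbits -/

/-- The index set of the basis in the definition of the orbit of `Y`. -/
def XiMT.sigmaEquiv (Y : XiMT 2 d) : (Σ p : Fin 2 × Fin d, Fin (Y.mat p.1 p.2)) ≃ Fin d where
  toFun c := c.1.2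
  invFun j := ⟨(Y.1.1 j, j), ⟨0, by simp [XiMT.mat]⟩⟩
  left_inv := by
    rintro ⟨⟨m, r⟩, t⟩
    have ht : (t : ℕ) < Y.mat m r := t.2
    by_cases h : Y.1.1 r = m
    · subst h
      simp only [Sigma.mk.injEq, heq_eq_eq, true_and]
      have h1 : Y.mat (Y.1.1 r) r = 1 := by simp [XiMT.mat]
      have h2 := ht.trans_eq h1
      exact Fin.ext (by simp only; omega)
    · simp [XiMT.mat, h] at ht
  right_inv j := rfl

/-- A column of `Y.mat` has a single nonzero entry, equal to `1`, so the basis in the definition of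
the orbit is indexed by the columns alone. -/
theorem inOrbit_iff_adapted {Y : XiMT 2 d} {F : Flag k V 2} {F' : Flag k V d} {x : V} :
    InOrbit Y.mat Y.dec F F' x ↔ ∃ b, Adapted Y (F.F 1) F'.F x b := by
  have hfst : ∀ c : Σ p : Fin 2 × Fin d, Fin (Y.mat p.1 p.2), Y.1.1 c.1.2 = c.1.1 := by
    rintro ⟨⟨m, r⟩, t⟩
    by_contra h
    have := t.2
    simp [XiMT.mat, h] at this
  have hvec : ∀ e : (Σ p : Fin 2 × Fin d, Fin (Y.mat p.1 p.2)) → V,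
      (∑ p ∈ Y.dec, if h : 0 < Y.mat p.1 p.2 then e ⟨p, ⟨0, h⟩⟩ else 0) =
        ∑ j ∈ Y.1.2, e (Y.sigmaEquiv.symm j) := by
    intro e
    rw [XiMT.dec, Finset.sum_image (fun a _ b _ h => (Prod.ext_iff.mp h).2)]
    refine Finset.sum_congr rfl fun j _ => ?_
    rw [dif_pos (by simp [XiMT.mat])]
    rfl
  constructor
  · rintro ⟨e, h1, h2, h3⟩
    refine ⟨e.reindex Y.sigmaEquiv, fun s => ?_, ?_, ?_⟩
    · rw [h2, coordSpan]
      congr 1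
      ext y
      simp only [Set.mem_ofPred_eq, Set.mem_image, Module.Basis.reindex_apply]
      constructor
      · rintro ⟨c, hc, rfl⟩
        exact ⟨Y.sigmaEquiv c, hc, by simp⟩
      · rintro ⟨j, hj, rfl⟩
        exact ⟨Y.sigmaEquiv.symm j, hj, rfl⟩
    · rw [h1, coordSpan]
      congr 1
      ext y
      simp only [Set.mem_ofPred_eq, Set.mem_image, Module.Basis.reindex_apply]
      constructor
      · rintro ⟨c, hc, rfl⟩
        refine ⟨Y.sigmaEquiv c, ?_, by simp⟩
        rw [show Y.sigmaEquiv c = c.1.2 from rfl, hfst c]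
        exact Fin.ext (by simpa using hc)
      · rintro ⟨j, hj, rfl⟩
        refine ⟨Y.sigmaEquiv.symm j, ?_, rfl⟩
        rw [← hfst, show (Y.sigmaEquiv.symm j).1.2 = j from rfl, hj]
        simp
    · rw [h3, hvec]
      simp
  · rintro ⟨b, h1, h2, h3⟩
    refine ⟨b.reindex Y.sigmaEquiv.symm, fun r => ?_, fun s => ?_, ?_⟩
    · have hr : ∀ r : Fin (2 + 1), r = 0 ∨ r = 1 ∨ r = 2 := by decide
      rcases hr r with rfl | rfl | rfl
      · rw [F.bot]; simp
      · rw [h2, coordSpan]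
        congr 1
        ext y
        simp only [Set.mem_ofPred_eq, Set.mem_image, Module.Basis.reindex_apply, Equiv.symm_symm]
        constructor
        · rintro ⟨j, hj, rfl⟩
          refine ⟨Y.sigmaEquiv.symm j, ?_, by simp⟩
          rw [← hfst, show (Y.sigmaEquiv.symm j).1.2 = j from rfl, hj]
          simp
        · rintro ⟨c, hc, rfl⟩
          refine ⟨Y.sigmaEquiv c, ?_, rfl⟩
          rw [show Y.sigmaEquiv c = c.1.2 from rfl, hfst c]
          exact Fin.ext (by simpa using hc)
      · rw [show (2 : Fin 3) = Fin.last 2 from rfl, F.top, eq_comm, eq_top_iff,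
          ← (b.reindex Y.sigmaEquiv.symm).span_eq]
        refine Submodule.span_mono ?_
        rintro _ ⟨c, rfl⟩
        exact ⟨c, c.1.1.2, rfl⟩
    · rw [h1, coordSpan]
      congr 1
      ext y
      simp only [Set.mem_ofPred_eq, Set.mem_image, Module.Basis.reindex_apply, Equiv.symm_symm]
      constructor
      · rintro ⟨j, hj, rfl⟩
        exact ⟨Y.sigmaEquiv.symm j, hj, by simp⟩
      · rintro ⟨c, hc, rfl⟩
        exact ⟨Y.sigmaEquiv c, hc, rfl⟩
    · rw [h3, hvec]
      simp

theorem InOrbit.isComplete {Y : XiMT 2 d} {F : Flag k V 2} {F' : Flag k V d} {x : V}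
    (h : InOrbit Y.mat Y.dec F F' x) : IsComplete F'.F := by
  obtain ⟨b, hb⟩ := inOrbit_iff_adapted.mp h
  exact hb.isComplete

/-- This replaces the existence of a basis by rank and membership conditions, which can be counted.
-/
theorem inOrbit_iff_hasType [FiniteDimensional k V] {Y : XiMT 2 d} {F : Flag k V 2}
    {F' : Flag k V d} (hF' : IsComplete F'.F) {x : V} :
    InOrbit Y.mat Y.dec F F' x ↔ HasType Y (F.F 1) F'.F x := by
  rw [inOrbit_iff_adapted]
  exact ⟨fun ⟨b, hb⟩ => hb.hasType, fun h => hF'.exists_adapted_of_hasType h⟩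

end Position

end

section

/-! ### Orbits of pairs of two-step flags and a vector -/

section TwoStep

variable {k V : Type} [Field k] [AddCommGroup V] [Module k V]

/-- The two-step flag of a subspace. -/
def Flag.ofSubmodule (U : Submodule k V) : Flag k V 2 where
  F := ![⊥, U, ⊤]
  mono := by
    intro i j h
    have hr : ∀ r : Fin (2 + 1), r = 0 ∨ r = 1 ∨ r = 2 := by decide
    rcases hr i with rfl | rfl | rfl <;> rcases hr j with rfl | rfl | rfl <;>
      first | exact le_rfl | exact bot_le | exact le_top | exact absurd h (by decide)
  bot := rfl
  top := rfl

/-- Two-step flags are the same as subspaces. -/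
def Flag.equivSubmodule : Flag k V 2 ≃ Submodule k V where
  toFun F := F.F 1
  invFun := Flag.ofSubmodule
  left_inv F := by
    obtain ⟨F, hm, hb, ht⟩ := F
    have h : (![⊥, F 1, ⊤] : Fin (2 + 1) → Submodule k V) = F := by
      funext r
      have hr : ∀ r : Fin (2 + 1), r = 0 ∨ r = 1 ∨ r = 2 := by decide
      rcases hr r with rfl | rfl | rfl
      · exact hb.symm
      · rfl
      · exact ht.symm
    simp only [Flag.ofSubmodule, h]
  right_inv _ := rfl

/-- An isomorphism between two lines extends to an automorphism of the space, which is applied to an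
arbitrary basis. This puts a decorated vector into the basis of its block. -/
theorem exists_basis_apply_eq [FiniteDimensional k V] {n : ℕ} (hn : Module.finrank k V = n)
    {u : V} (hu : u ≠ 0) (h0 : 0 < n) : ∃ b : Module.Basis (Fin n) k V, b ⟨0, h0⟩ = u := by
  let b := Module.finBasisOfFinrankEq k V hn
  let f := (LinearEquiv.toSpanNonzeroSingleton k V _ (b.ne_zero ⟨0, h0⟩)).symm ≪≫ₗ
    LinearEquiv.toSpanNonzeroSingleton k V u hu
  obtain ⟨g, hg⟩ := Submodule.exists_linearEquiv_restrict_eq f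
  refine ⟨b.map g, ?_⟩
  rw [Module.Basis.map_apply]
  have h1 := hg ⟨b ⟨0, h0⟩, Submodule.mem_span_singleton_self _⟩
  simp only at h1
  rw [← h1]
  have h2 : (LinearEquiv.toSpanNonzeroSingleton k V _ (b.ne_zero ⟨0, h0⟩)).symm
      ⟨b ⟨0, h0⟩, Submodule.mem_span_singleton_self _⟩ = 1 := by
    rw [LinearEquiv.symm_apply_eq]
    exact (LinearEquiv.toSpanNonzeroSingleton_one k V _ (b.ne_zero ⟨0, h0⟩)).symm
  simp only [f, LinearEquiv.trans_apply, h2]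
  rw [LinearEquiv.toSpanNonzeroSingleton_one]

variable {A : Matrix (Fin 2) (Fin 2) ℕ} {F H : Flag k V 2} {u : V}

/-- Block decompositions give points of orbits. -/
theorem inOrbit_of_blocks [FiniteDimensional k V] {Δ : Finset (Fin 2 × Fin 2)}
    (U : Fin 2 × Fin 2 → Submodule k V)
    (hU : ∀ p, Module.finrank k (U p) = A p.1 p.2) (hA : ∑ i, ∑ j, A i j = Module.finrank k V)
    (htop : U (0, 0) ⊔ U (0, 1) ⊔ U (1, 0) ⊔ U (1, 1) = ⊤)
    (hF : F.F 1 = U (0, 0) ⊔ U (0, 1)) (hH : H.F 1 = U (0, 0) ⊔ U (1, 0))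
    (hu : (Δ = ∅ ∧ u = 0) ∨ (Δ = {(0, 0)} ∧ u ∈ U (0, 0) ∧ u ≠ 0)) : InOrbit A Δ F H u := by
  have hb : ∃ b : ∀ p : Fin 2 × Fin 2, Module.Basis (Fin (A p.1 p.2)) k (U p),
      Δ = ∅ ∧ u = 0 ∨ Δ = {(0, 0)} ∧ ∃ h : 0 < A 0 0, u = b (0, 0) ⟨0, h⟩ := by
    let b := fun p => Module.finBasisOfFinrankEq k (U p) (hU p)
    rcases hu with hu | ⟨h1, h2, h3⟩
    · exact ⟨b, Or.inl hu⟩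
    · have h4 : (⟨u, h2⟩ : U (0, 0)) ≠ 0 := fun h => h3 (congrArg Subtype.val h)
      have h5 : 0 < A 0 0 := by
        rw [← hU (0, 0)]
        exact Module.finrank_pos_iff_exists_ne_zero.mpr ⟨_, h4⟩
      obtain ⟨c, hc⟩ := exists_basis_apply_eq (hU (0, 0)) h4 h5
      refine ⟨Function.update b (0, 0) c, Or.inr ⟨h1, h5, ?_⟩⟩
      rw [Function.update_self]
      exact (congrArg Subtype.val hc).symm
  obtain ⟨b, hb⟩ := hb
  let e : (Σ p : Fin 2 × Fin 2, Fin (A p.1 p.2)) → V := fun c => b c.1 c.2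
  have hspan (p) : Submodule.span k {y | ∃ l, e ⟨p, l⟩ = y} = U p := by
    have h1 : {y | ∃ l, e ⟨p, l⟩ = y} = (U p).subtype '' Set.range (b p) := by
      rw [← Set.range_comp]; rfl
    rw [h1, Submodule.span_image, (b p).span_eq, Submodule.map_top, Submodule.range_subtype]
  have hspan2 (p q) (S : Set V) (hS : S = {y | ∃ l, e ⟨p, l⟩ = y} ∪ {y | ∃ l, e ⟨q, l⟩ = y}) :
      U p ⊔ U q = Submodule.span k S := by
    rw [hS, Submodule.span_union, hspan, hspan]
  have h2 : ∀ r : Fin 2, r = 0 ∨ r = 1 := by decide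
  have htop2 : ⊤ ≤ Submodule.span k (Set.range e) := by
    rw [← htop]
    have h3 (p) : U p ≤ Submodule.span k (Set.range e) := by
      rw [← hspan]
      refine Submodule.span_mono ?_
      rintro _ ⟨l, rfl⟩
      exact ⟨_, rfl⟩
    exact sup_le (sup_le (sup_le (h3 _) (h3 _)) (h3 _)) (h3 _)
  have hcard : Fintype.card (Σ p : Fin 2 × Fin 2, Fin (A p.1 p.2)) = Module.finrank k V := by
    rw [Fintype.card_sigma, ← hA, Fintype.sum_prod_type]
    simp
  let B := basisOfTopLeSpanOfCardEqFinrank e htop2 hcard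
  have hB : ⇑B = e := coe_basisOfTopLeSpanOfCardEqFinrank e htop2 hcard
  have hall (P : (Σ p : Fin 2 × Fin 2, Fin (A p.1 p.2)) → Prop) (hP : ∀ c, P c) :
      Submodule.span k {y | ∃ c, P c ∧ e c = y} = ⊤ := by
    refine eq_top_iff.mpr (htop2.trans (Submodule.span_mono ?_))
    rintro _ ⟨c, rfl⟩
    exact ⟨c, hP c, rfl⟩
  have hall1 (r : Fin (2 + 1)) (hr : (r : ℕ) = 2) :
      Submodule.span k {y | ∃ c, (c.1.1 : ℕ) < (r : ℕ) ∧ e c = y} = ⊤ :=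
    hall _ fun c => c.1.1.2.trans_eq hr.symm
  have hall2 (r : Fin (2 + 1)) (hr : (r : ℕ) = 2) :
      Submodule.span k {y | ∃ c, (c.1.2 : ℕ) < (r : ℕ) ∧ e c = y} = ⊤ :=
    hall _ fun c => c.1.2.2.trans_eq hr.symm
  have he (h : 0 < A 0 0) : (b (0, 0) ⟨0, h⟩ : V) = e ⟨(0, 0), ⟨0, h⟩⟩ := rfl
  clear_value e
  refine ⟨B, ?_, ?_, ?_⟩
  · rw [hB]
    intro r
    have hr : ∀ r : Fin (2 + 1), r = 0 ∨ r = 1 ∨ r = 2 := by decide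
    rcases hr r with rfl | rfl | rfl
    · rw [F.bot]; simp
    rotate_left
    · rw [hall1 2 (by simp)]; exact F.top
    rw [hF]
    refine hspan2 _ _ _ (Set.ext fun y => ⟨?_, ?_⟩)
    · rintro ⟨⟨⟨i, j⟩, l⟩, hc, rfl⟩
      obtain rfl : i = 0 := by
        rcases h2 i with rfl | rfl
        · rfl
        · exact absurd hc (by simp)
      rcases h2 j with rfl | rfl
      · exact Or.inl ⟨l, rfl⟩
      · exact Or.inr ⟨l, rfl⟩
    · rintro (⟨l, rfl⟩ | ⟨l, rfl⟩)
      · exact ⟨_, by simp, rfl⟩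
      · exact ⟨_, by simp, rfl⟩
  · rw [hB]
    intro r
    have hr : ∀ r : Fin (2 + 1), r = 0 ∨ r = 1 ∨ r = 2 := by decide
    rcases hr r with rfl | rfl | rfl
    · rw [H.bot]; simp
    rotate_left
    · rw [hall2 2 (by simp)]; exact H.top
    rw [hH]
    refine hspan2 _ _ _ (Set.ext fun y => ⟨?_, ?_⟩)
    · rintro ⟨⟨⟨i, j⟩, l⟩, hc, rfl⟩
      obtain rfl : j = 0 := by
        rcases h2 j with rfl | rfl
        · rfl
        · exact absurd hc (by simp)
      rcases h2 i with rfl | rfl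
      · exact Or.inl ⟨l, rfl⟩
      · exact Or.inr ⟨l, rfl⟩
    · rintro (⟨l, rfl⟩ | ⟨l, rfl⟩)
      · exact ⟨_, by simp, rfl⟩
      · exact ⟨_, by simp, rfl⟩
  · rcases hb with ⟨rfl, rfl⟩ | ⟨rfl, h, rfl⟩
    · simp
    · rw [Finset.sum_singleton, dif_pos h, hB, he]

/-- The two subspaces of a point of an orbit, as coordinate subspaces. -/
theorem InOrbit.exists_basis {Δ : Finset (Fin 2 × Fin 2)} (h : InOrbit A Δ F H u) :
    ∃ e : Module.Basis (Σ p : Fin 2 × Fin 2, Fin (A p.1 p.2)) k V,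
      F.F 1 = coordSpan e {c | c.1.1 = 0} ∧ H.F 1 = coordSpan e {c | c.1.2 = 0} ∧
      u = ∑ p ∈ Δ, if h : 0 < A p.1 p.2 then e ⟨p, ⟨0, h⟩⟩ else 0 := by
  obtain ⟨e, h1, h2, h3⟩ := h
  have hlt : ∀ i : Fin 2, (i : ℕ) < ((1 : Fin (2 + 1)) : ℕ) ↔ i = 0 := by decide
  refine ⟨e, ?_, ?_, h3⟩
  · rw [h1]; simp only [hlt]; rfl
  · rw [h2]; simp only [hlt]; rfl

theorem finrank_coordSpan_sigma (e : Module.Basis (Σ p : Fin 2 × Fin 2, Fin (A p.1 p.2)) k V)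
    (S : Finset (Fin 2 × Fin 2)) :
    Module.finrank k (coordSpan e {c | c.1 ∈ S}) = ∑ p ∈ S, A p.1 p.2 := by
  have h1 : {c : Σ p : Fin 2 × Fin 2, Fin (A p.1 p.2) | c.1 ∈ S} =
      ((S.sigma fun _ => Finset.univ : Finset (Σ p : Fin 2 × Fin 2, Fin (A p.1 p.2))) :
        Set (Σ p : Fin 2 × Fin 2, Fin (A p.1 p.2))) := by ext c; simp
  rw [h1, finrank_coordSpan, Finset.card_sigma]
  simp

theorem InOrbit.finrank_left {Δ : Finset (Fin 2 × Fin 2)} (h : InOrbit A Δ F H u) :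
    Module.finrank k (F.F 1) = A 0 0 + A 0 1 := by
  obtain ⟨e, h1, -, -⟩ := h.exists_basis
  have h2 : ∀ p : Fin 2 × Fin 2, p.1 = 0 ↔ p ∈ ({(0, 0), (0, 1)} : Finset (Fin 2 × Fin 2)) := by
    decide
  have h3 : {c : Σ p : Fin 2 × Fin 2, Fin (A p.1 p.2) | c.1.1 = 0} =
      {c | c.1 ∈ ({(0, 0), (0, 1)} : Finset (Fin 2 × Fin 2))} := Set.ext fun c => h2 c.1
  rw [h1, h3, finrank_coordSpan_sigma, Finset.sum_pair (by decide)]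

theorem InOrbit.finrank_right {Δ : Finset (Fin 2 × Fin 2)} (h : InOrbit A Δ F H u) :
    Module.finrank k (H.F 1) = A 0 0 + A 1 0 := by
  obtain ⟨e, -, h1, -⟩ := h.exists_basis
  have h2 : ∀ p : Fin 2 × Fin 2, p.2 = 0 ↔ p ∈ ({(0, 0), (1, 0)} : Finset (Fin 2 × Fin 2)) := by
    decide
  have h3 : {c : Σ p : Fin 2 × Fin 2, Fin (A p.1 p.2) | c.1.2 = 0} =
      {c | c.1 ∈ ({(0, 0), (1, 0)} : Finset (Fin 2 × Fin 2))} := Set.ext fun c => h2 c.1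
  rw [h1, h3, finrank_coordSpan_sigma, Finset.sum_pair (by decide)]

theorem InOrbit.le_of_eq_zero {Δ : Finset (Fin 2 × Fin 2)} (h : InOrbit A Δ F H u)
    (hA : A 1 0 = 0) : H.F 1 ≤ F.F 1 := by
  obtain ⟨e, h1, h2, -⟩ := h.exists_basis
  rw [h1, h2]
  refine coordSpan_mono e ?_
  rintro ⟨⟨i, j⟩, l⟩ (rfl : j = 0)
  have hi : i = 0 ∨ i = 1 := by omega
  rcases hi with rfl | rfl
  · rfl
  · have := l.2
    simp only [hA] at this
    omega

theorem InOrbit.ge_of_eq_zero {Δ : Finset (Fin 2 × Fin 2)} (h : InOrbit A Δ F H u)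
    (hA : A 0 1 = 0) : F.F 1 ≤ H.F 1 := by
  obtain ⟨e, h1, h2, -⟩ := h.exists_basis
  rw [h1, h2]
  refine coordSpan_mono e ?_
  rintro ⟨⟨i, j⟩, l⟩ (rfl : i = 0)
  have hi : j = 0 ∨ j = 1 := by omega
  rcases hi with rfl | rfl
  · rfl
  · have := l.2
    simp only [hA] at this
    omega

theorem InOrbit.eq_zero (h : InOrbit A ∅ F H u) : u = 0 := by
  obtain ⟨e, -, -, h3⟩ := h
  simpa using h3

theorem InOrbit.mem_and_ne_zero (h : InOrbit A {(0, 0)} F H u) (hA : 0 < A 0 0) :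
    u ∈ F.F 1 ∧ u ≠ 0 := by
  obtain ⟨e, h1, -, h3⟩ := h.exists_basis
  rw [Finset.sum_singleton, dif_pos hA] at h3
  subst h3
  refine ⟨?_, e.ne_zero _⟩
  rw [h1]
  exact Submodule.subset_span ⟨_, rfl, rfl⟩

theorem exists_sup_eq_of_le [FiniteDimensional k V] {U W : Submodule k V} (h : U ≤ W) :
    ∃ C : Submodule k V, U ⊔ C = W ∧
      Module.finrank k U + Module.finrank k C = Module.finrank k W := by
  obtain ⟨C, hC⟩ := Submodule.exists_isCompl U
  have h1 : U ⊔ C ⊓ W = W := by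
    rw [← sup_inf_assoc_of_le C h, hC.sup_eq_top, top_inf_eq]
  refine ⟨C ⊓ W, h1, ?_⟩
  have h2 := Submodule.finrank_sup_add_finrank_inf_eq U (C ⊓ W)
  have h3 : U ⊓ (C ⊓ W) = ⊥ := by rw [← inf_assoc, hC.inf_eq_bot, bot_inf_eq]
  rw [h1, h3, finrank_bot, add_zero] at h2
  exact h2.symm

/-- Without a block at `(1, 0)` the orbit records an inclusion and two dimensions; complements
supply the remaining blocks. It covers the matrices of `e_r` and `1_r`. -/
theorem inOrbit_iff_of_le [FiniteDimensional k V] (hA : ∑ i, ∑ j, A i j = Module.finrank k V)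
    (hA0 : A 1 0 = 0) : InOrbit A ∅ F H u ↔ (u = 0 ∧ H.F 1 ≤ F.F 1 ∧
      Module.finrank k (F.F 1) = A 0 0 + A 0 1 ∧ Module.finrank k (H.F 1) = A 0 0) := by
  constructor
  · intro h
    exact ⟨h.eq_zero, h.le_of_eq_zero hA0, h.finrank_left, by rw [h.finrank_right, hA0, add_zero]⟩
  · rintro ⟨hu, h1, h2, h3⟩
    obtain ⟨C, hC1, hC2⟩ := exists_sup_eq_of_le h1
    obtain ⟨D, hD1, hD2⟩ := exists_sup_eq_of_le (le_top (a := F.F 1))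
    rw [finrank_top] at hD2
    simp only [Fin.sum_univ_two] at hA
    refine inOrbit_of_blocks (fun p => !![H.F 1, C; ⊥, D] p.1 p.2) ?_ (by simpa using hA)
      ?_ ?_ ?_ (Or.inl ⟨rfl, hu⟩)
    · rintro ⟨i, j⟩
      have hi : i = 0 ∨ i = 1 := by omega
      have hj : j = 0 ∨ j = 1 := by omega
      have h00 : Module.finrank k (H.F 1) = A 0 0 := by omega
      have h01 : Module.finrank k C = A 0 1 := by omega
      have h10 : Module.finrank k (⊥ : Submodule k V) = A 1 0 := by rw [finrank_bot, hA0]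
      have h11 : Module.finrank k D = A 1 1 := by omega
      rcases hi with rfl | rfl <;> rcases hj with rfl | rfl
      exacts [h00, h01, h10, h11]
    · simp [hC1, hD1]
    · simp [hC1]
    · simp

/-- The transposed case, for `f_r`. -/
theorem inOrbit_iff_of_ge [FiniteDimensional k V] (hA : ∑ i, ∑ j, A i j = Module.finrank k V)
    (hA0 : A 0 1 = 0) : InOrbit A ∅ F H u ↔ (u = 0 ∧ F.F 1 ≤ H.F 1 ∧
      Module.finrank k (F.F 1) = A 0 0 ∧ Module.finrank k (H.F 1) = A 0 0 + A 1 0) := by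
  constructor
  · intro h
    exact ⟨h.eq_zero, h.ge_of_eq_zero hA0, by rw [h.finrank_left, hA0, add_zero], h.finrank_right⟩
  · rintro ⟨hu, h1, h2, h3⟩
    obtain ⟨C, hC1, hC2⟩ := exists_sup_eq_of_le h1
    obtain ⟨D, hD1, hD2⟩ := exists_sup_eq_of_le (le_top (a := H.F 1))
    rw [finrank_top] at hD2
    simp only [Fin.sum_univ_two] at hA
    refine inOrbit_of_blocks (fun p => !![F.F 1, ⊥; C, D] p.1 p.2) ?_ (by simpa using hA)
      ?_ ?_ ?_ (Or.inl ⟨rfl, hu⟩)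
    · rintro ⟨i, j⟩
      have hi : i = 0 ∨ i = 1 := by omega
      have hj : j = 0 ∨ j = 1 := by omega
      have h00 : Module.finrank k (F.F 1) = A 0 0 := by omega
      have h01 : Module.finrank k (⊥ : Submodule k V) = A 0 1 := by rw [finrank_bot, hA0]
      have h10 : Module.finrank k C = A 1 0 := by omega
      have h11 : Module.finrank k D = A 1 1 := by omega
      rcases hi with rfl | rfl <;> rcases hj with rfl | rfl
      exacts [h00, h01, h10, h11]
    · simp [hC1, hD1]
    · simp
    · simp [hC1]

/-- The diagonal case with a decoration, for `x_r`: any nonzero vector of the subspace can be the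
first basis vector of its block. -/
theorem inOrbit_iff_of_mem [FiniteDimensional k V] (hA : ∑ i, ∑ j, A i j = Module.finrank k V)
    (h01 : A 0 1 = 0) (h10 : A 1 0 = 0) (h00 : 0 < A 0 0) :
    InOrbit A {(0, 0)} F H u ↔ (u ∈ F.F 1 ∧ u ≠ 0 ∧ F.F 1 = H.F 1 ∧
      Module.finrank k (F.F 1) = A 0 0) := by
  constructor
  · intro h
    exact ⟨(h.mem_and_ne_zero h00).1, (h.mem_and_ne_zero h00).2,
      le_antisymm (h.ge_of_eq_zero h01) (h.le_of_eq_zero h10),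
      by rw [h.finrank_left, h01, add_zero]⟩
  · rintro ⟨hu, hu0, h1, h2⟩
    obtain ⟨D, hD1, hD2⟩ := exists_sup_eq_of_le (le_top (a := F.F 1))
    rw [finrank_top] at hD2
    simp only [Fin.sum_univ_two] at hA
    refine inOrbit_of_blocks (fun p => !![F.F 1, ⊥; ⊥, D] p.1 p.2) ?_ (by simpa using hA)
      ?_ ?_ ?_ (Or.inr ⟨rfl, by simpa using hu, hu0⟩)
    · rintro ⟨i, j⟩
      have hi : i = 0 ∨ i = 1 := by omega
      have hj : j = 0 ∨ j = 1 := by omega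
      have k00 : Module.finrank k (F.F 1) = A 0 0 := by omega
      have k01 : Module.finrank k (⊥ : Submodule k V) = A 0 1 := by rw [finrank_bot, h01]
      have k10 : Module.finrank k (⊥ : Submodule k V) = A 1 0 := by rw [finrank_bot, h10]
      have h11 : Module.finrank k D = A 1 1 := by omega
      rcases hi with rfl | rfl <;> rcases hj with rfl | rfl
      exacts [k00, k01, k10, h11]
    · simp [hD1]
    · simp
    · simp [h1]

end TwoStep

end

section

/-! ### Counting subspaces -/

section Count

variable {k V : Type} [Field k] [AddCommGroup V] [Module k V]

theorem covBy_iff_finrank [FiniteDimensional k V] {U W : Submodule k V} :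
    U ⋖ W ↔ U ≤ W ∧ Module.finrank k W = Module.finrank k U + 1 := by
  constructor
  · intro h
    refine ⟨h.le, ?_⟩
    obtain ⟨x, hx, hx2⟩ := SetLike.exists_of_lt h.lt
    have h1 := Submodule.covBy_span_singleton_sup (K := k) hx2
    have h2 : U ⊔ Submodule.span k {x} = W := by
      rw [sup_comm]
      refine (h.eq_or_eq h1.lt.le (sup_le ?_ h.le)).resolve_left h1.lt.ne'
      rwa [Submodule.span_singleton_le_iff_mem]
    rw [← h2, Submodule.finrank_sup_span_singleton hx2]
  · rintro ⟨h1, h2⟩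
    refine ⟨lt_of_le_of_ne h1 fun h => ?_, fun H hU hW => ?_⟩
    · rw [h] at h2; omega
    · have h3 := Submodule.finrank_lt_finrank_of_lt hU
      have h4 := Submodule.finrank_lt_finrank_of_lt hW
      omega

theorem sup_span_eq_of_covBy {U H : Submodule k V} (h : U ⋖ H) {x : V} (hx : x ∈ H)
    (hx2 : x ∉ U) : U ⊔ Submodule.span k {x} = H := by
  refine (h.eq_or_eq le_sup_left (sup_le h.le ?_)).resolve_left fun h => hx2 ?_
  · rwa [Submodule.span_singleton_le_iff_mem]
  · rw [← h]
    exact Submodule.mem_sup_right (Submodule.mem_span_singleton_self x)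

theorem covBy_sup_span {U : Submodule k V} {x : V} (hx : x ∉ U) :
    U ⋖ U ⊔ Submodule.span k {x} := by
  rw [sup_comm]
  exact Submodule.covBy_span_singleton_sup hx

theorem card_submodule [Finite V] (U : Submodule k V) :
    Nat.card U = Nat.card k ^ Module.finrank k U :=
  Module.natCard_eq_pow_finrank

theorem card_sdiff_submodule [Finite V] {U W : Submodule k V} (h : U ≤ W) :
    Nat.card {x // x ∈ W ∧ x ∉ U} + Nat.card k ^ Module.finrank k U =
      Nat.card k ^ Module.finrank k W := by
  classical
  have h1 : Nat.card W = Nat.card {x : W // (x : V) ∈ U} + Nat.card {x : W // (x : V) ∉ U} := by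
    rw [← Nat.card_sum]
    exact Nat.card_congr (Equiv.sumCompl _).symm
  have h2 : Nat.card {x : W // (x : V) ∈ U} = Nat.card U :=
    Nat.card_congr ((Equiv.subtypeSubtypeEquivSubtype fun {_} hx => h hx))
  have h3 : Nat.card {x : W // (x : V) ∉ U} = Nat.card {x // x ∈ W ∧ x ∉ U} :=
    Nat.card_congr (Equiv.subtypeSubtypeEquivSubtypeInter (fun x => x ∈ W) fun x => x ∉ U)
  rw [← card_submodule, ← card_submodule, h1, h2, h3, add_comm]

variable [Finite k] [Finite V]

/-- The number of subspaces covering `U` and contained in `W`. -/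
theorem card_covBy_le {U W : Submodule k V} (h : U ≤ W) :
    Nat.card {H : Submodule k V // U ⋖ H ∧ H ≤ W} =
      ∑ t ∈ Finset.range (Module.finrank k W - Module.finrank k U), Nat.card k ^ t := by
  classical
  -- A vector of `W` outside `U` spans with `U` exactly one such `H`, and each `H` arises from `q ^
  -- dim U * (q - 1)` vectors.
  have e : {x // x ∈ W ∧ x ∉ U} ≃
      Σ H : {H : Submodule k V // U ⋖ H ∧ H ≤ W}, {x // x ∈ H.1 ∧ x ∉ U} :=
    { toFun := fun x => ⟨⟨U ⊔ Submodule.span k {x.1}, covBy_sup_span x.2.2, sup_le h (by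
        rw [Submodule.span_singleton_le_iff_mem]; exact x.2.1)⟩,
        ⟨x.1, Submodule.mem_sup_right (Submodule.mem_span_singleton_self _), x.2.2⟩⟩
      invFun := fun y => ⟨y.2.1, y.1.2.2 y.2.2.1, y.2.2.2⟩
      left_inv := fun x => rfl
      right_inv := by
        rintro ⟨⟨H, hH⟩, ⟨x, hx⟩⟩
        obtain rfl := sup_span_eq_of_covBy hH.1 hx.1 hx.2
        rfl }
  have hk : 1 < Nat.card k := Finite.one_lt_card
  set q := Nat.card k
  have h1 : ∀ H : {H : Submodule k V // U ⋖ H ∧ H ≤ W},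
      Nat.card {x // x ∈ H.1 ∧ x ∉ U} = q ^ Module.finrank k U * (q - 1) := by
    intro H
    have h2 := card_sdiff_submodule H.2.1.le
    rw [(covBy_iff_finrank.mp H.2.1).2, pow_succ] at h2
    rw [Nat.mul_sub, mul_one]
    exact Nat.eq_sub_of_add_eq h2
  have h2 := Nat.card_congr e
  have : Fintype {H : Submodule k V // U ⋖ H ∧ H ≤ W} := Fintype.ofFinite _
  rw [Nat.card_sigma, Finset.sum_congr rfl fun H _ => h1 H, Finset.sum_const, smul_eq_mul,
    Finset.card_univ, ← Nat.card_eq_fintype_card] at h2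
  have h3 := card_sdiff_submodule h
  rw [h2] at h3
  have h4 := Submodule.finrank_mono h
  obtain ⟨n, hn⟩ := Nat.exists_eq_add_of_le h4
  rw [hn, Nat.add_sub_cancel_left]
  rw [hn, pow_add] at h3
  have h5 := Nat.geomSum_eq (m := q) (by omega) n
  have h6 : (∑ t ∈ Finset.range n, q ^ t) * (q - 1) + 1 = q ^ n := by
    have h7 : 1 ≤ q ^ n := Nat.one_le_pow _ _ (by omega)
    rw [h5, Nat.div_mul_cancel]
    · omega
    · simpa using Nat.sub_dvd_pow_sub_pow q 1 n
  have h7 : 0 < q ^ Module.finrank k U * (q - 1) :=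
    Nat.mul_pos (pow_pos (by omega) _) (by omega)
  refine Nat.eq_of_mul_eq_mul_right h7 ?_
  have h8 : q ^ Module.finrank k U * ((∑ t ∈ Finset.range n, q ^ t) * (q - 1) + 1) =
      q ^ Module.finrank k U * q ^ n := by rw [h6]
  rw [← h3] at h8
  linarith

/-- The number of subspaces containing `U` and covered by `W`. -/
theorem card_le_covBy {U W : Submodule k V} (h : U ≤ W) :
    Nat.card {H : Submodule k V // U ≤ H ∧ H ⋖ W} =
      ∑ t ∈ Finset.range (Module.finrank k W - Module.finrank k U), Nat.card k ^ t := by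
  -- Annihilators in the dual space reverse inclusions and exchange the two counts.
  have : Finite (Module.Dual k V) := Finite.of_injective _ DFunLike.coe_injective
  have h1 := Subspace.finrank_add_finrank_dualAnnihilator_eq U
  have h2 := Subspace.finrank_add_finrank_dualAnnihilator_eq W
  have h3 := Submodule.finrank_mono h
  have h4 := card_covBy_le (Submodule.dualAnnihilator_anti h)
  have h5 : Module.finrank k U.dualAnnihilator - Module.finrank k W.dualAnnihilator =
      Module.finrank k W - Module.finrank k U := by omega
  rw [← h5, ← h4]
  refine Nat.card_congr (Equiv.subtypeEquiv
    (Subspace.orderIsoFiniteDimensional.toEquiv.trans OrderDual.ofDual) fun H => ?_)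
  rw [and_comm]
  refine and_congr ?_ ?_
  · rw [← apply_covBy_apply_iff (Subspace.orderIsoFiniteDimensional (K := k) (V := V)),
      ← ofDual_covBy_ofDual_iff]
    rfl
  · exact Subspace.dualAnnihilator_le_dualAnnihilator_iff.symm

end Count

end

/-! ### Incidence counts for a subspace, a flag and a vector -/

section

section Incidence

variable {k V : Type} [Field k] [AddCommGroup V] [Module k V] {d : ℕ}
  {F : Fin (d + 1) → Submodule k V} {W H : Submodule k V} {x : V}

open Classical in
-- By modularity the intersection with `U` is unchanged or drops by one. Ranks of `H` are thereby
-- expressed through incidence conditions.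
theorem finrank_inf_of_covBy [FiniteDimensional k V] (h : H ⋖ W) (U : Submodule k V) :
    Module.finrank k (H ⊓ U : Submodule k V) + (if W ⊓ U ≤ H then 0 else 1) =
      Module.finrank k (W ⊓ U : Submodule k V) := by
  split_ifs with h1
  · have : H ⊓ U = W ⊓ U :=
      le_antisymm (inf_le_inf_right U h.le) (le_inf h1 inf_le_right)
    rw [this, add_zero]
  · have h2 : H ⊔ W ⊓ U = W :=
      (h.eq_or_eq le_sup_left (sup_le h.le inf_le_left)).resolve_left fun h3 => h1 (h3 ▸ le_sup_right)
    have h3 : H ⊓ (W ⊓ U) ⋖ W ⊓ U := inf_covBy_of_covBy_sup_left (by rwa [h2])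
    rw [← inf_assoc, inf_eq_left.mpr h.le] at h3
    exact (covBy_iff_finrank.mp h3).2.symm

open Classical in
-- The dual of `finrank_inf_of_covBy`, for a subspace covering `W`.
theorem finrank_inf_of_covBy' [FiniteDimensional k V] (h : W ⋖ H) (U : Submodule k V) :
    Module.finrank k (H ⊓ U : Submodule k V) =
      Module.finrank k (W ⊓ U : Submodule k V) + if H ≤ W ⊔ U then 1 else 0 := by
  split_ifs with h1
  · have h2 : W ⊔ H ⊓ U = H := by
      rw [inf_comm, ← sup_inf_assoc_of_le U h.le, inf_eq_right.mpr h1]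
    have h3 : W ⊓ (H ⊓ U) ⋖ H ⊓ U := inf_covBy_of_covBy_sup_left (by rwa [h2])
    rw [← inf_assoc, inf_eq_left.mpr h.le] at h3
    exact (covBy_iff_finrank.mp h3).2
  · have h2 : H ⊓ U ≤ W := by
      by_contra h3
      have h4 : W ⊔ H ⊓ U = H :=
        (h.eq_or_eq le_sup_left (sup_le h.le inf_le_left)).resolve_left
          fun h5 => h3 (h5 ▸ le_sup_right)
      refine h1 ?_
      calc H = W ⊔ H ⊓ U := h4.symm
        _ ≤ W ⊔ U := sup_le_sup_left inf_le_right W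
    have : H ⊓ U = W ⊓ U :=
      le_antisymm (le_inf h2 inf_le_right) (inf_le_inf_right U h.le)
    rw [this, add_zero]

/-- The sums of the first powers of `q`, as polynomials in `q`. -/
noncomputable def geomPoly (n : ℕ) : Polynomial ℤ := ∑ t ∈ Finset.range n, Polynomial.X ^ t

theorem eval_geomPoly (n m : ℕ) :
    (geomPoly n).eval (m : ℤ) = ((∑ t ∈ Finset.range n, m ^ t : ℕ) : ℤ) := by
  simp [geomPoly, Polynomial.eval_finsetSum]

variable [Finite k] [Finite V]

theorem ncard_covBy_le {U W : Submodule k V} (h : U ≤ W) :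
    ({H : Submodule k V | U ⋖ H ∧ H ≤ W}.ncard : ℤ) =
      (geomPoly (Module.finrank k W - Module.finrank k U)).eval (Nat.card k : ℤ) := by
  rw [eval_geomPoly, ← card_covBy_le h]; rfl

theorem ncard_le_covBy {U W : Submodule k V} (h : U ≤ W) :
    ({H : Submodule k V | U ≤ H ∧ H ⋖ W}.ncard : ℤ) =
      (geomPoly (Module.finrank k W - Module.finrank k U)).eval (Nat.card k : ℤ) := by
  rw [eval_geomPoly, ← card_le_covBy h]; rfl

open Classical in
/-- The number of hyperplanes of `W` satisfying two incidence conditions with a flag and a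
vector. -/
theorem ncard_hyperplanes (hF : Monotone F) (j b : Fin (d + 1)) (hx : x ∈ W ⊔ F b) :
    ({H : Submodule k V | H ⋖ W ∧ W ⊓ F j ≤ H ∧ x ∈ H ⊔ F b}.ncard : ℤ) =
      (geomPoly (Module.finrank k W - Module.finrank k (W ⊓ F j : Submodule k V)) -
        geomPoly (Module.finrank k W - Module.finrank k (W ⊓ F (max j b) : Submodule k V)) +
        geomPoly (Module.finrank k W - (Module.finrank k (W ⊓ F (max j b) : Submodule k V) +
          if x ∈ F (max j b) then 0 else 1))).eval (Nat.card k : ℤ) := by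
  obtain ⟨w, hw, y, hy, rfl⟩ := Submodule.mem_sup.mp hx
  have hym : y ∈ F (max j b) := hF (le_max_right j b) hy
  have hwm : w + y ∈ F (max j b) ↔ w ∈ W ⊓ F (max j b) := by
    rw [Submodule.mem_inf, add_mem_cancel_right hym]
    exact ⟨fun h => ⟨hw, h⟩, fun h => h.2⟩
  set U := W ⊓ F (max j b) with hU
  have hUw : U ⊔ Submodule.span k {w} ≤ W := sup_le inf_le_left (by
    rwa [Submodule.span_singleton_le_iff_mem])
  have hjU : W ⊓ F j ≤ U := inf_le_inf_left W (hF (le_max_left j b))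
  have hfin : Module.finrank k U + (if w + y ∈ F (max j b) then 0 else 1) =
      Module.finrank k (U ⊔ Submodule.span k {w} : Submodule k V) := by
    rw [hwm]
    split_ifs with h
    · have : U ⊔ Submodule.span k {w} = U := sup_eq_left.mpr (by
        rwa [Submodule.span_singleton_le_iff_mem])
      rw [this, add_zero]
    · rw [Submodule.finrank_sup_span_singleton h]
  rw [hfin, Polynomial.eval_add, Polynomial.eval_sub, ← ncard_le_covBy (W := W) inf_le_left,
    ← ncard_le_covBy (W := W) (U := U) inf_le_left, ← ncard_le_covBy hUw]
  -- A hyperplane containing `W ⊓ F j` but not `U` satisfies the condition on the vector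
  -- automatically, since then `max j b = b` and `H ⊔ U = W`. For one containing `U` the condition
  -- says `w ∈ H`.
  have hset : {H : Submodule k V | H ⋖ W ∧ W ⊓ F j ≤ H ∧ w + y ∈ H ⊔ F b} =
      ({H | W ⊓ F j ≤ H ∧ H ⋖ W} \ {H | U ≤ H ∧ H ⋖ W}) ∪
        {H | U ⊔ Submodule.span k {w} ≤ H ∧ H ⋖ W} := by
    ext H
    simp only [Set.mem_ofPred_eq, Set.mem_union, Set.mem_sdiff]
    by_cases hHW : H ⋖ W
    swap
    · simp [hHW]
    by_cases hUH : U ≤ H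
    · have h1 : W ⊓ F b ≤ H := (inf_le_inf_left W (hF (le_max_right j b))).trans hUH
      have h2 : w + y ∈ H ⊔ F b ↔ w ∈ H := by
        rw [add_mem_cancel_right (Submodule.mem_sup_right hy)]
        refine ⟨fun h => ?_, fun h => Submodule.mem_sup_left h⟩
        have h3 : w ∈ (H ⊔ F b) ⊓ W := ⟨h, hw⟩
        rw [sup_inf_assoc_of_le (F b) hHW.le, inf_comm, sup_eq_left.mpr h1] at h3
        exact h3
      simp [hHW, hUH, h2, hjU.trans hUH]
    · have h1 : ¬ U ⊔ Submodule.span k {w} ≤ H := fun h => hUH (le_sup_left.trans h)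
      simp only [hHW, hUH, h1, and_true, true_and, not_false_eq_true, or_false]
      refine ⟨fun h => h.1, fun h => ⟨h, ?_⟩⟩
      have hb : max j b = b := by
        rcases max_choice j b with h2 | h2
        · rw [hU, h2] at hUH; exact absurd h hUH
        · exact h2
      have h2 : H ⊔ U = W := (hHW.eq_or_eq le_sup_left (sup_le hHW.le inf_le_left)).resolve_left
        fun h3 => hUH (h3 ▸ le_sup_right)
      have h3 : w ∈ H ⊔ F b := by
        rw [← h2] at hw
        refine (sup_le_sup_left (?_ : U ≤ F b) H) hw
        rw [hU, hb]; exact inf_le_right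
      exact add_mem h3 (Submodule.mem_sup_right hy)
  have hBA : {H : Submodule k V | U ≤ H ∧ H ⋖ W} ⊆ {H | W ⊓ F j ≤ H ∧ H ⋖ W} :=
    fun H h => ⟨hjU.trans h.1, h.2⟩
  have hCB : {H : Submodule k V | U ⊔ Submodule.span k {w} ≤ H ∧ H ⋖ W} ⊆
      {H | U ≤ H ∧ H ⋖ W} := fun H h => ⟨le_sup_left.trans h.1, h.2⟩
  rw [hset, Set.ncard_union_eq (Set.disjoint_sdiff_left.mono_right hCB), Nat.cast_add,
    Set.ncard_sdiff hBA, Nat.cast_sub (Set.ncard_le_ncard hBA)]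

omit [Finite k] in
theorem ncard_hyperplanes_of_notMem (j b : Fin (d + 1)) (hx : x ∉ W ⊔ F b) :
    {H : Submodule k V | H ⋖ W ∧ W ⊓ F j ≤ H ∧ x ∈ H ⊔ F b}.ncard = 0 := by
  rw [Set.ncard_eq_zero]
  ext H
  simp only [Set.mem_ofPred_eq, Set.mem_empty_iff_false, iff_false]
  exact fun h => hx (sup_le_sup_right h.1.le _ h.2.2)

theorem ncard_covers (j b : Fin (d + 1)) (hx : x ∈ W ⊔ F b) :
    ({H : Submodule k V | W ⋖ H ∧ H ≤ W ⊔ F j ∧ x ∈ H ⊔ F b}.ncard : ℤ) =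
      (geomPoly (Module.finrank k (W ⊔ F j : Submodule k V) - Module.finrank k W)).eval
        (Nat.card k : ℤ) := by
  rw [← ncard_covBy_le le_sup_left]
  congr 2
  ext H
  simp only [Set.mem_ofPred_eq]
  exact ⟨fun h => ⟨h.1, h.2.1⟩, fun h => ⟨h.1, h.2, sup_le_sup_right h.1.le _ hx⟩⟩

/-- With `N = W ⊔ F b` and `x ∉ N`, the condition `x ∈ H ⊔ F b` says that `H` lies in `N ⊔ ⟨x⟩` but
not in `N`. The bound by `W ⊔ F j` is then automatic, as `N ⊔ ⟨x⟩` lies below it. -/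
theorem ncard_covers_of_notMem_of_mem (hF : Monotone F) {j b : Fin (d + 1)} (hx : x ∉ W ⊔ F b)
    (hbj : b ≤ j) (hx2 : x ∈ W ⊔ F j) :
    ({H : Submodule k V | W ⋖ H ∧ H ≤ W ⊔ F j ∧ x ∈ H ⊔ F b}.ncard : ℤ) =
      (geomPoly (Module.finrank k (W ⊔ F b : Submodule k V) + 1 - Module.finrank k W) -
        geomPoly (Module.finrank k (W ⊔ F b : Submodule k V) - Module.finrank k W)).eval
        (Nat.card k : ℤ) := by
  set N := W ⊔ F b with hN
  have hT := covBy_sup_span (k := k) hx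
  have hTj : N ⊔ Submodule.span k {x} ≤ W ⊔ F j := sup_le (sup_le_sup_left (hF hbj) W) (by
    rwa [Submodule.span_singleton_le_iff_mem])
  rw [← (covBy_iff_finrank.mp hT).2, Polynomial.eval_sub,
    ← ncard_covBy_le (U := W) (W := N) le_sup_left,
    ← ncard_covBy_le (U := W) (le_sup_left.trans hT.le)]
  have hset : {H : Submodule k V | W ⋖ H ∧ H ≤ W ⊔ F j ∧ x ∈ H ⊔ F b} =
      {H | W ⋖ H ∧ H ≤ N ⊔ Submodule.span k {x}} \ {H | W ⋖ H ∧ H ≤ N} := by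
    ext H
    simp only [Set.mem_ofPred_eq, Set.mem_sdiff]
    by_cases hWH : W ⋖ H
    swap
    · simp [hWH]
    have hHN : H ⊔ F b = H ⊔ N := by rw [hN, ← sup_assoc, sup_eq_left.mpr hWH.le]
    simp only [hWH, true_and, hHN]
    by_cases h1 : H ≤ N
    · simp only [h1, not_true_eq_false, and_false, iff_false, not_and]
      rw [sup_eq_right.mpr h1]
      exact fun _ => hx
    · have h2 : H ⊓ N = W := (hWH.eq_or_eq (le_inf hWH.le le_sup_left) inf_le_left).resolve_right
        fun h => h1 (h ▸ inf_le_right)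
      have h3 : N ⋖ H ⊔ N := covBy_sup_of_inf_covBy_left (by rwa [h2])
      simp only [h1, not_false_eq_true, and_true]
      constructor
      · rintro ⟨-, h4⟩
        rw [sup_span_eq_of_covBy h3 h4 hx]
        exact le_sup_left
      · intro h4
        refine ⟨h4.trans hTj, ?_⟩
        have h5 : H ⊔ N = N ⊔ Submodule.span k {x} :=
          (hT.eq_or_eq le_sup_right (sup_le h4 le_sup_left)).resolve_left h3.lt.ne'
        rw [h5]
        exact Submodule.mem_sup_right (Submodule.mem_span_singleton_self x)
  have hBA : {H : Submodule k V | W ⋖ H ∧ H ≤ N} ⊆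
      {H | W ⋖ H ∧ H ≤ N ⊔ Submodule.span k {x}} := fun H h => ⟨h.1, h.2.trans hT.le⟩
  rw [hset, Set.ncard_sdiff hBA, Nat.cast_sub (Set.ncard_le_ncard hBA)]

omit [Finite k] in
theorem ncard_covers_of_notMem (hF : Monotone F) {j b : Fin (d + 1)} (hx : x ∉ W ⊔ F b)
    (h : ¬ (b ≤ j ∧ x ∈ W ⊔ F j)) :
    {H : Submodule k V | W ⋖ H ∧ H ≤ W ⊔ F j ∧ x ∈ H ⊔ F b}.ncard = 0 := by
  rw [Set.ncard_eq_zero]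
  ext H
  simp only [Set.mem_ofPred_eq, Set.mem_empty_iff_false, iff_false]
  rintro ⟨h1, h2, h3⟩
  rcases le_total b j with hbj | hbj
  · exact h ⟨hbj, sup_le h2 ((hF hbj).trans le_sup_right) h3⟩
  · exact hx (sup_le (h2.trans (sup_le_sup_left (hF hbj) W)) le_sup_right h3)

open Classical in
omit [Finite k] in
-- The solutions form a coset of `W ⊓ U` or do not exist.
theorem ncard_translates (U : Submodule k V) : ({u : V | u ∈ W ∧ x - u ∈ U}.ncard : ℤ) =
    if x ∈ W ⊔ U then (Nat.card k : ℤ) ^ Module.finrank k (W ⊓ U : Submodule k V) else 0 := by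
  split_ifs with h
  · obtain ⟨w, hw, y, hy, rfl⟩ := Submodule.mem_sup.mp h
    have e : {u : V | u ∈ W ∧ w + y - u ∈ U} = (w + ·) '' ((W ⊓ U : Submodule k V) : Set V) := by
      ext u
      simp only [Set.mem_ofPred_eq, Set.mem_image, SetLike.mem_coe, Submodule.mem_inf]
      constructor
      · rintro ⟨h1, h2⟩
        refine ⟨u - w, ⟨W.sub_mem h1 hw, ?_⟩, by abel⟩
        have := U.sub_mem hy h2
        rwa [show y - (w + y - u) = u - w by abel] at this
      · rintro ⟨z, ⟨h1, h2⟩, rfl⟩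
        refine ⟨W.add_mem hw h1, ?_⟩
        rw [show w + y - (w + z) = y - z by abel]
        exact U.sub_mem hy h2
    rw [e, Set.ncard_image_of_injective _ (add_right_injective w), ← Nat.cast_pow,
      ← card_submodule]
    rfl
  · rw [Nat.cast_eq_zero, Set.ncard_eq_zero]
    ext u
    simp only [Set.mem_ofPred_eq, Set.mem_empty_iff_false, iff_false]
    rintro ⟨h1, h2⟩
    refine h ?_
    have := Submodule.add_mem_sup h1 h2
    rwa [add_sub_cancel] at this

end Incidence

end

/-! ### Polynomiality of the counts in `q` -/

section

open Polynomial in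
/-- If conjunctions of conditions are counted by polynomials in `q`, then so are conjunctions of
conditions and negated conditions. -/
theorem exists_poly_of_conditions {σ : Type*} {α : σ → Type*} [∀ s, Finite (α s)] {ι : Type*}
    [DecidableEq ι] (q : σ → ℤ) (C : ι → ∀ s, α s → Prop)
    (h : ∀ S : Finset ι, ∃ P : ℤ[X], ∀ s, (Nat.card {a : α s // ∀ c ∈ S, C c s a} : ℤ) =
      P.eval (q s)) (S T : Finset ι) :
    ∃ P : ℤ[X], ∀ s, (Nat.card {a : α s // (∀ c ∈ S, C c s a) ∧ ∀ c ∈ T, ¬ C c s a} : ℤ) =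
      P.eval (q s) := by
  induction T using Finset.induction_on generalizing S with
  | empty => simpa using h S
  | insert t T ht ih =>
    obtain ⟨P, hP⟩ := ih S
    obtain ⟨Q, hQ⟩ := ih (insert t S)
    -- Inclusion-exclusion: imposing `¬ C t` removes the elements that satisfy `C t`.
    refine ⟨P - Q, fun s => ?_⟩
    rw [eval_sub, ← hP, ← hQ, eq_sub_iff_add_eq, ← Nat.cast_add, ← Nat.card_sum]
    congr 1
    classical
    refine Nat.card_congr (((Equiv.sumCompl fun a : {a : α s // (∀ c ∈ S, C c s a) ∧
      ∀ c ∈ T, ¬ C c s a} => ¬ C t s a.1).symm.trans (Equiv.sumCongr ?_ ?_)).symm)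
    · refine (Equiv.subtypeSubtypeEquivSubtypeInter _ fun a => ¬ C t s a).trans
        (Equiv.subtypeEquivRight fun a => ?_)
      simp only [Finset.mem_insert, forall_eq_or_imp]
      tauto
    · refine (Equiv.subtypeSubtypeEquivSubtypeInter _ fun a => ¬ ¬ C t s a).trans
        (Equiv.subtypeEquivRight fun a => ?_)
      simp only [Finset.mem_insert, forall_eq_or_imp]
      tauto

/-- Nested conditions reduce to the strictest one. The index `b` depends only on `S` and not on the
predicate, so that one polynomial serves all fields. -/
theorem exists_forall_iff_of_monotone {n : ℕ} (S : Finset (Fin (n + 1))) :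
    ∃ b, ∀ p : Fin (n + 1) → Prop, Monotone p → p (Fin.last n) → ((∀ c ∈ S, p c) ↔ p b) := by
  induction S using Finset.induction_on with
  | empty => exact ⟨Fin.last n, fun p _ h => by simp [h]⟩
  | insert t T ht ih =>
    obtain ⟨b, hb⟩ := ih
    refine ⟨min t b, fun p h1 h2 => ?_⟩
    rw [Finset.forall_mem_insert, hb p h1 h2]
    refine ⟨fun h => ?_, fun h => ⟨h1 (min_le_left t b) h, h1 (min_le_right t b) h⟩⟩
    rcases min_choice t b with h3 | h3 <;> rw [h3]
    exacts [h.1, h.2]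

theorem exists_forall_iff_of_antitone {n : ℕ} (S : Finset (Fin (n + 1))) :
    ∃ b, ∀ p : Fin (n + 1) → Prop, Antitone p → p 0 → ((∀ c ∈ S, p c) ↔ p b) := by
  induction S using Finset.induction_on with
  | empty => exact ⟨0, fun p _ h => by simp [h]⟩
  | insert t T ht ih =>
    obtain ⟨b, hb⟩ := ih
    refine ⟨max t b, fun p h1 h2 => ?_⟩
    rw [Finset.forall_mem_insert, hb p h1 h2]
    refine ⟨fun h => ?_, fun h => ⟨h1 (le_max_left t b) h, h1 (le_max_right t b) h⟩⟩
    rcases max_choice t b with h3 | h3 <;> rw [h3]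
    exacts [h.1, h.2]

theorem forall_mem_sum_elim {α β : Type*} (S : Finset (α ⊕ β)) (p : α → Prop) (p' : β → Prop) :
    (∀ c ∈ S, Sum.elim p p' c) ↔ (∀ a ∈ S.toLeft, p a) ∧ ∀ b ∈ S.toRight, p' b := by
  simp

/-- A subspace, a complete flag and a vector over a finite field, in relative position `Z`. -/
structure Position {d : ℕ} (Z : XiMT 2 d) where
  k : Type
  field : Field k
  finite : Finite k
  F : Fin (d + 1) → Submodule k (Fin d → k)
  complete : IsComplete F
  W : Submodule k (Fin d → k)
  x : Fin d → k
  hasType : HasType Z W F x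

attribute [instance] Position.field Position.finite

namespace Position

variable {d : ℕ} {Y Z : XiMT 2 d} (s : Position Z)

theorem finrank_W : Module.finrank s.k s.W = Z.rk d := by
  have h := s.hasType.rank (Fin.last d)
  rwa [s.complete.top, inf_top_eq] at h

theorem finrank_sup (j : Fin (d + 1)) :
    Module.finrank s.k (s.W ⊔ s.F j : Submodule s.k _) = Z.rk d + j - Z.rk j := by
  have h := Submodule.finrank_sup_add_finrank_inf_eq s.W (s.F j)
  rw [s.hasType.rank, s.finrank_W, s.complete.finrank] at h
  omega

end Position

variable {d : ℕ}

open Polynomial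

/-- All dimensions and case distinctions in `ncard_hyperplanes` are functions of `Z` alone. -/
theorem exists_poly_hyperplanes (Z : XiMT 2 d) (j b : Fin (d + 1)) : ∃ P : ℤ[X],
    ∀ s : Position Z, ({H | H ⋖ s.W ∧ s.W ⊓ s.F j ≤ H ∧ s.x ∈ H ⊔ s.F b}.ncard : ℤ) =
      P.eval (Nat.card s.k : ℤ) := by
  by_cases hb : ∀ i ∈ Z.1.2, Z.1.1 i = 1 → (i : ℕ) < b
  · classical
    refine ⟨geomPoly (Z.rk d - Z.rk j) - geomPoly (Z.rk d - Z.rk (max j b : Fin (d + 1))) +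
      geomPoly (Z.rk d - (Z.rk (max j b : Fin (d + 1)) +
        if ∀ i ∈ Z.1.2, (i : ℕ) < (max j b : Fin (d + 1)) then 0 else 1)), fun s => ?_⟩
    rw [ncard_hyperplanes s.complete.mono j b ((s.hasType.mem_sup b).mpr hb), s.finrank_W,
      s.hasType.rank, s.hasType.rank]
    simp only [s.hasType.mem]
  · refine ⟨0, fun s => ?_⟩
    rw [ncard_hyperplanes_of_notMem j b (mt (s.hasType.mem_sup b).mp hb)]
    simp

theorem exists_poly_covers (Z : XiMT 2 d) (j b : Fin (d + 1)) : ∃ P : ℤ[X],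
    ∀ s : Position Z, ({H | s.W ⋖ H ∧ H ≤ s.W ⊔ s.F j ∧ s.x ∈ H ⊔ s.F b}.ncard : ℤ) =
      P.eval (Nat.card s.k : ℤ) := by
  by_cases hb : ∀ i ∈ Z.1.2, Z.1.1 i = 1 → (i : ℕ) < b
  · refine ⟨geomPoly (Z.rk d + j - Z.rk j - Z.rk d), fun s => ?_⟩
    rw [ncard_covers j b ((s.hasType.mem_sup b).mpr hb), s.finrank_W, s.finrank_sup]
  · by_cases hj : b ≤ j ∧ ∀ i ∈ Z.1.2, Z.1.1 i = 1 → (i : ℕ) < j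
    · refine ⟨geomPoly (Z.rk d + b - Z.rk b + 1 - Z.rk d) - geomPoly (Z.rk d + b - Z.rk b - Z.rk d),
        fun s => ?_⟩
      rw [ncard_covers_of_notMem_of_mem s.complete.mono (mt (s.hasType.mem_sup b).mp hb) hj.1
        ((s.hasType.mem_sup j).mpr hj.2), s.finrank_W, s.finrank_sup]
    · refine ⟨0, fun s => ?_⟩
      rw [ncard_covers_of_notMem s.complete.mono (mt (s.hasType.mem_sup b).mp hb)
        (mt (And.imp_right (s.hasType.mem_sup j).mp) hj)]
      simp

theorem exists_poly_translates (Z : XiMT 2 d) (b : Fin (d + 1)) : ∃ P : ℤ[X],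
    ∀ s : Position Z, ({u | u ∈ s.W ∧ s.x - u ∈ s.F b}.ncard : ℤ) =
      P.eval (Nat.card s.k : ℤ) := by
  classical
  refine ⟨if ∀ i ∈ Z.1.2, Z.1.1 i = 1 → (i : ℕ) < b then X ^ Z.rk b else 0, fun s => ?_⟩
  rw [ncard_translates, s.hasType.rank]
  simp only [s.hasType.mem_sup]
  split_ifs <;> simp

/-- The numbers of hyperplanes of the subspace in a given relative position. -/
theorem exists_poly_e (Y Z : XiMT 2 d) : ∃ P : ℤ[X], ∀ s : Position Z,
    (Nat.card {H // H ⋖ s.W ∧ HasType Y H s.F s.x} : ℤ) = P.eval (Nat.card s.k : ℤ) := by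
  classical
  -- Passing to a hyperplane lowers each rank by at most one and does not affect the memberships `x
  -- ∈ F s`; for any other `Y` the count is zero over every field.
  by_cases hg : (∀ s : Fin (d + 1), (Y.rk s = Z.rk s ∨ Y.rk s + 1 = Z.rk s)) ∧
    ∀ s : Fin (d + 1), (∀ j ∈ Z.1.2, (j : ℕ) < s) ↔ ∀ j ∈ Y.1.2, (j : ℕ) < s
  swap
  · refine ⟨0, fun s => ?_⟩
    have : IsEmpty {H // H ⋖ s.W ∧ HasType Y H s.F s.x} := by
      refine ⟨fun H => hg ⟨fun t => ?_, fun t => ?_⟩⟩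
      · have h := finrank_inf_of_covBy H.2.1 (s.F t)
        rw [s.hasType.rank, H.2.2.rank] at h
        split_ifs at h
        exacts [Or.inl h, Or.inr h]
      · rw [← s.hasType.mem, H.2.2.mem]
    simp
  -- The prescribed truth values: under `hg`, `H` has type `Y` exactly when each incidence condition
  -- `c` holds if and only if `p c` does.
  let p : Fin (d + 1) ⊕ Fin (d + 1) → Prop := Sum.elim (fun t => Y.rk t = Z.rk t)
    fun t => ∀ j ∈ Y.1.2, Y.1.1 j = 1 → (j : ℕ) < t
  obtain ⟨P, hP⟩ := exists_poly_of_conditions (σ := Position Z) (α := fun s => {H // H ⋖ s.W})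
    (fun s => (Nat.card s.k : ℤ))
    (fun c s H => Sum.elim (fun t => s.W ⊓ s.F t ≤ H) (fun t => s.x ∈ H.1 ⊔ s.F t) c) (fun S => by
      obtain ⟨j, hj⟩ := exists_forall_iff_of_antitone S.toLeft
      obtain ⟨b, hb⟩ := exists_forall_iff_of_monotone S.toRight
      obtain ⟨P, hP⟩ := exists_poly_hyperplanes Z j b
      refine ⟨P, fun s => ?_⟩
      rw [← hP, ← Nat.card_coe_set_eq]
      congr 1
      refine Nat.card_congr ((Equiv.subtypeSubtypeEquivSubtypeInter _ fun H =>
        ∀ c ∈ S, Sum.elim (fun t => s.W ⊓ s.F t ≤ H) (fun t => s.x ∈ H ⊔ s.F t) c).trans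
          (Equiv.subtypeEquivRight fun H => ?_))
      rw [forall_mem_sum_elim, hj, hb]
      · rfl
      · exact fun t u htu h => sup_le_sup_left (s.complete.mono htu) H h
      · rw [s.complete.top]; simp
      · exact fun t u htu h => (inf_le_inf_left s.W (s.complete.mono htu)).trans h
      · rw [s.complete.bot]; simp)
    (Finset.univ.filter p) (Finset.univ.filter fun c => ¬ p c)
  refine ⟨P, fun s => ?_⟩
  rw [← hP]
  congr 1
  refine Nat.card_congr ((Equiv.subtypeSubtypeEquivSubtypeInter _ fun H => HasType Y H s.F s.x).symm.trans
    (Equiv.subtypeEquivRight fun H => ?_))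
  have h1 (c) : ((c ∈ Finset.univ.filter p → Sum.elim (fun t => s.W ⊓ s.F t ≤ H.1)
      (fun t => s.x ∈ H.1 ⊔ s.F t) c) ∧ (c ∈ Finset.univ.filter (fun c => ¬ p c) →
      ¬ Sum.elim (fun t => s.W ⊓ s.F t ≤ H.1) (fun t => s.x ∈ H.1 ⊔ s.F t) c)) ↔
      (Sum.elim (fun t => s.W ⊓ s.F t ≤ H.1) (fun t => s.x ∈ H.1 ⊔ s.F t) c ↔ p c) := by
    simp only [Finset.mem_filter, Finset.mem_univ, true_and]
    tauto
  rw [← forall_and, forall_congr' h1, Sum.forall]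
  simp only [Sum.elim_inl, Sum.elim_inr, p]
  have h2 (t : Fin (d + 1)) : Module.finrank s.k (H.1 ⊓ s.F t : Submodule s.k _) = Y.rk t ↔
      (s.W ⊓ s.F t ≤ H.1 ↔ Y.rk t = Z.rk t) := by
    have h := finrank_inf_of_covBy H.2 (s.F t)
    rw [s.hasType.rank] at h
    have h3 := hg.1 t
    split_ifs at h with h4
    · simp only [h4, true_iff]; omega
    · simp only [h4, false_iff]; omega
  exact ⟨fun h => ⟨fun t => (h2 t).mp (h.rank t), h.mem_sup⟩, fun h => ⟨fun t => (h2 t).mpr (h.1 t),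
    fun t => (s.hasType.mem t).trans (hg.2 t), h.2⟩⟩

/-- The numbers of subspaces in a given relative position in which the subspace is a hyperplane. -/
theorem exists_poly_f (Y Z : XiMT 2 d) : ∃ P : ℤ[X], ∀ s : Position Z,
    (Nat.card {H // s.W ⋖ H ∧ HasType Y H s.F s.x} : ℤ) = P.eval (Nat.card s.k : ℤ) := by
  classical
  by_cases hg : (∀ s : Fin (d + 1), (Y.rk s = Z.rk s ∨ Y.rk s = Z.rk s + 1)) ∧
    ∀ s : Fin (d + 1), (∀ j ∈ Z.1.2, (j : ℕ) < s) ↔ ∀ j ∈ Y.1.2, (j : ℕ) < s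
  swap
  · refine ⟨0, fun s => ?_⟩
    have : IsEmpty {H // s.W ⋖ H ∧ HasType Y H s.F s.x} := by
      refine ⟨fun H => hg ⟨fun t => ?_, fun t => ?_⟩⟩
      · have h := finrank_inf_of_covBy' H.2.1 (s.F t)
        rw [s.hasType.rank, H.2.2.rank] at h
        split_ifs at h
        exacts [Or.inr h, Or.inl h]
      · rw [← s.hasType.mem, H.2.2.mem]
    simp
  let p : Fin (d + 1) ⊕ Fin (d + 1) → Prop := Sum.elim (fun t => Y.rk t = Z.rk t + 1)
    fun t => ∀ j ∈ Y.1.2, Y.1.1 j = 1 → (j : ℕ) < t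
  obtain ⟨P, hP⟩ := exists_poly_of_conditions (σ := Position Z) (α := fun s => {H // s.W ⋖ H})
    (fun s => (Nat.card s.k : ℤ))
    (fun c s H => Sum.elim (fun t => H ≤ s.W ⊔ s.F t) (fun t => s.x ∈ H.1 ⊔ s.F t) c) (fun S => by
      obtain ⟨j, hj⟩ := exists_forall_iff_of_monotone S.toLeft
      obtain ⟨b, hb⟩ := exists_forall_iff_of_monotone S.toRight
      obtain ⟨P, hP⟩ := exists_poly_covers Z j b
      refine ⟨P, fun s => ?_⟩
      rw [← hP, ← Nat.card_coe_set_eq]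
      congr 1
      refine Nat.card_congr ((Equiv.subtypeSubtypeEquivSubtypeInter _ fun H =>
        ∀ c ∈ S, Sum.elim (fun t => H ≤ s.W ⊔ s.F t) (fun t => s.x ∈ H ⊔ s.F t) c).trans
          (Equiv.subtypeEquivRight fun H => ?_))
      rw [forall_mem_sum_elim, hj, hb]
      · rfl
      · exact fun t u htu h => sup_le_sup_left (s.complete.mono htu) H h
      · rw [s.complete.top]; simp
      · exact fun t u htu h => le_trans h (sup_le_sup_left (s.complete.mono htu) s.W)
      · rw [s.complete.top]; simp)
    (Finset.univ.filter p) (Finset.univ.filter fun c => ¬ p c)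
  refine ⟨P, fun s => ?_⟩
  rw [← hP]
  congr 1
  refine Nat.card_congr ((Equiv.subtypeSubtypeEquivSubtypeInter _ fun H => HasType Y H s.F s.x).symm.trans
    (Equiv.subtypeEquivRight fun H => ?_))
  have h1 (c) : ((c ∈ Finset.univ.filter p → Sum.elim (fun t => H.1 ≤ s.W ⊔ s.F t)
      (fun t => s.x ∈ H.1 ⊔ s.F t) c) ∧ (c ∈ Finset.univ.filter (fun c => ¬ p c) →
      ¬ Sum.elim (fun t => H.1 ≤ s.W ⊔ s.F t) (fun t => s.x ∈ H.1 ⊔ s.F t) c)) ↔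
      (Sum.elim (fun t => H.1 ≤ s.W ⊔ s.F t) (fun t => s.x ∈ H.1 ⊔ s.F t) c ↔ p c) := by
    simp only [Finset.mem_filter, Finset.mem_univ, true_and]
    tauto
  rw [← forall_and, forall_congr' h1, Sum.forall]
  simp only [Sum.elim_inl, Sum.elim_inr, p]
  have h2 (t : Fin (d + 1)) : Module.finrank s.k (H.1 ⊓ s.F t : Submodule s.k _) = Y.rk t ↔
      (H.1 ≤ s.W ⊔ s.F t ↔ Y.rk t = Z.rk t + 1) := by
    have h := finrank_inf_of_covBy' H.2 (s.F t)
    rw [s.hasType.rank] at h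
    have h3 := hg.1 t
    split_ifs at h with h4
    · simp only [h4, true_iff]; omega
    · simp only [h4, false_iff]; omega
  exact ⟨fun h => ⟨fun t => (h2 t).mp (h.rank t), h.mem_sup⟩, fun h => ⟨fun t => (h2 t).mpr (h.1 t),
    fun t => (s.hasType.mem t).trans (hg.2 t), h.2⟩⟩

theorem sub_mem_sup_iff {k V : Type} [Field k] [AddCommGroup V] [Module k V] {W U : Submodule k V}
    {x u : V} (hu : u ∈ W) : x - u ∈ W ⊔ U ↔ x ∈ W ⊔ U := by
  rw [sub_eq_add_neg, add_mem_cancel_right (neg_mem (Submodule.mem_sup_left hu))]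

/-- The numbers of translates of the vector in a given relative position. -/
theorem exists_poly_a (Y Z : XiMT 2 d) : ∃ P : ℤ[X], ∀ s : Position Z,
    (Nat.card {u // u ∈ s.W ∧ HasType Y s.W s.F (s.x - u)} : ℤ) = P.eval (Nat.card s.k : ℤ) := by
  classical
  -- Translation by `W` changes neither the ranks nor the memberships in `W ⊔ F s`; only those in `F
  -- s` remain to be prescribed.
  by_cases hg : (∀ s : Fin (d + 1), Z.rk s = Y.rk s) ∧
    ∀ s : Fin (d + 1), (∀ j ∈ Z.1.2, Z.1.1 j = 1 → (j : ℕ) < s) ↔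
      ∀ j ∈ Y.1.2, Y.1.1 j = 1 → (j : ℕ) < s
  swap
  · refine ⟨0, fun s => ?_⟩
    have : IsEmpty {u // u ∈ s.W ∧ HasType Y s.W s.F (s.x - u)} := by
      refine ⟨fun u => hg ⟨fun t => ?_, fun t => ?_⟩⟩
      · rw [← s.hasType.rank, u.2.2.rank]
      · rw [← s.hasType.mem_sup, ← u.2.2.mem_sup, sub_mem_sup_iff u.2.1]
    simp
  let p : Fin (d + 1) → Prop := fun t => ∀ j ∈ Y.1.2, (j : ℕ) < t
  obtain ⟨P, hP⟩ := exists_poly_of_conditions (σ := Position Z) (α := fun s => {u // u ∈ s.W})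
    (fun s => (Nat.card s.k : ℤ)) (fun c s u => s.x - u ∈ s.F c) (fun S => by
      obtain ⟨b, hb⟩ := exists_forall_iff_of_monotone S
      obtain ⟨P, hP⟩ := exists_poly_translates Z b
      refine ⟨P, fun s => ?_⟩
      rw [← hP, ← Nat.card_coe_set_eq]
      congr 1
      refine Nat.card_congr ((Equiv.subtypeSubtypeEquivSubtypeInter _ fun u =>
        ∀ c ∈ S, s.x - u ∈ s.F c).trans (Equiv.subtypeEquivRight fun u => ?_))
      rw [hb]
      · rfl
      · exact fun t u htu h => s.complete.mono htu h
      · rw [s.complete.top]; simp)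
    (Finset.univ.filter p) (Finset.univ.filter fun c => ¬ p c)
  refine ⟨P, fun s => ?_⟩
  rw [← hP]
  congr 1
  refine Nat.card_congr ((Equiv.subtypeSubtypeEquivSubtypeInter _ fun u =>
    HasType Y s.W s.F (s.x - u)).symm.trans (Equiv.subtypeEquivRight fun u => ?_))
  have h1 (c) : ((c ∈ Finset.univ.filter p → s.x - u ∈ s.F c) ∧
      (c ∈ Finset.univ.filter (fun c => ¬ p c) → ¬ s.x - u ∈ s.F c)) ↔
      (s.x - u ∈ s.F c ↔ p c) := by
    simp only [Finset.mem_filter, Finset.mem_univ, true_and]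
    tauto
  rw [← forall_and, forall_congr' h1]
  exact ⟨fun h => h.mem, fun h => ⟨fun t => (s.hasType.rank t).trans (hg.1 t), h,
    fun t => ((sub_mem_sup_iff u.2).trans (s.hasType.mem_sup t)).trans (hg.2 t)⟩⟩

end

section

/-! ### Operators on functions of a subspace and a vector -/

section Operators

open Classical

variable {k V : Type} [Field k] [AddCommGroup V] [Module k V] [Fintype V]
  [Fintype (Submodule k V)]

/-- Summation over the hyperplanes of a subspace. -/
noncomputable def opE (φ : Submodule k V → V → ℤ) (W : Submodule k V) (x : V) : ℤ :=
  ∑ H with H ⋖ W, φ H x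

/-- Summation over the subspaces containing a subspace as a hyperplane. -/
noncomputable def opF (φ : Submodule k V → V → ℤ) (W : Submodule k V) (x : V) : ℤ :=
  ∑ H with W ⋖ H, φ H x

/-- Summation over the translates of the vector by a subspace. -/
noncomputable def opA (φ : Submodule k V → V → ℤ) (W : Submodule k V) (x : V) : ℤ :=
  ∑ u with u ∈ W, φ W (x - u)

omit [Fintype (Submodule k V)] in
theorem sum_translate (ψ : V → ℤ) {W : Submodule k V} (x : V) {u : V} (hu : u ∈ W) :
    ∑ w with w ∈ W, ψ (x - u - w) = ∑ w with w ∈ W, ψ (x - w) := by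
  refine Finset.sum_equiv (Equiv.addLeft u) (fun w => ?_) fun w _ => ?_
  · simp [add_mem_cancel_left hu]
  · simp [sub_sub]

omit [Fintype (Submodule k V)] in
theorem card_filter_mem (W : Submodule k V) :
    (Finset.univ.filter fun x => x ∈ W).card = Nat.card k ^ Module.finrank k W := by
  rw [← card_submodule, ← Fintype.card_subtype, ← Nat.card_eq_fintype_card]

omit [Fintype (Submodule k V)] in
-- `opA φ` is invariant under translation by `W`, so a second sum multiplies it by the cardinality
-- of `W`.
theorem opA_opA (φ : Submodule k V → V → ℤ) (W : Submodule k V) (x : V) :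
    opA (opA φ) W x = (Nat.card k : ℤ) ^ Module.finrank k W * opA φ W x := by
  have h : opA (opA φ) W x = ∑ u with u ∈ W, opA φ W x :=
    Finset.sum_congr rfl fun u hu => sum_translate (φ W) x (Finset.mem_filter.mp hu).2
  rw [h, Finset.sum_const, card_filter_mem, nsmul_eq_mul, Nat.cast_pow]

/-- For `H ⋖ W` the sum over `H` is absorbed by the sum over `W` and leaves the factor `|H| = |W| /
q`. -/
theorem opA_opE_opA (φ : Submodule k V → V → ℤ) (W : Submodule k V) (x : V) :
    Nat.card k * opA (opE (opA φ)) W x =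
      (Nat.card k : ℤ) ^ Module.finrank k W * opA (opE φ) W x := by
  have h1 : opA (opE (opA φ)) W x =
      ∑ H with H ⋖ W, (Nat.card k : ℤ) ^ Module.finrank k H * ∑ u with u ∈ W, φ H (x - u) := by
    simp only [opA, opE]
    rw [Finset.sum_comm]
    refine Finset.sum_congr rfl fun H hH => ?_
    rw [Finset.sum_comm]
    have h2 : ∀ h ∈ Finset.univ.filter (fun h => h ∈ H),
        ∑ u with u ∈ W, φ H (x - u - h) = ∑ u with u ∈ W, φ H (x - u) := by
      intro h hh
      rw [← sum_translate (φ H) x ((Finset.mem_filter.mp hH).2.le (Finset.mem_filter.mp hh).2)]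
      exact Finset.sum_congr rfl fun u _ => by rw [sub_right_comm]
    rw [Finset.sum_congr rfl h2, Finset.sum_const, card_filter_mem, nsmul_eq_mul, Nat.cast_pow]
  have h3 : opA (opE φ) W x = ∑ H with H ⋖ W, ∑ u with u ∈ W, φ H (x - u) := by
    simp only [opA, opE]
    rw [Finset.sum_comm]
  rw [h1, h3, Finset.mul_sum, Finset.mul_sum]
  refine Finset.sum_congr rfl fun H hH => ?_
  rw [(covBy_iff_finrank.mp (Finset.mem_filter.mp hH).2).2, pow_succ]
  ring

/-- For `W ⋖ H` the value of `opA φ` at `H` is already invariant under `W`. -/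
theorem opA_opF_opA (φ : Submodule k V → V → ℤ) (W : Submodule k V) (x : V) :
    opA (opF (opA φ)) W x = (Nat.card k : ℤ) ^ Module.finrank k W * opF (opA φ) W x := by
  have h1 : opA (opF (opA φ)) W x = ∑ u with u ∈ W, opF (opA φ) W x := by
    refine Finset.sum_congr rfl fun u hu => Finset.sum_congr rfl fun H hH => ?_
    exact sum_translate (φ H) x ((Finset.mem_filter.mp hH).2.le (Finset.mem_filter.mp hu).2)
  rw [h1, Finset.sum_const, card_filter_mem, nsmul_eq_mul, Nat.cast_pow]

theorem sum_filter_comm {α β : Type*} [Fintype α] [Fintype β] (p : α → Prop) (r : α → β → Prop)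
    [DecidablePred p] [∀ a, DecidablePred (r a)] [∀ b, DecidablePred fun a => p a ∧ r a b]
    (f : α → β → ℤ) : ∑ a with p a, ∑ b with r a b, f a b =
      ∑ b, ∑ a with p a ∧ r a b, f a b := by
  simp only [Finset.sum_filter]
  rw [Finset.sum_comm]
  refine Finset.sum_congr rfl fun a _ => ?_
  by_cases h : p a <;> simp [h]

theorem card_filter_eq_natCard {α : Type*} [Fintype α] (p : α → Prop) [DecidablePred p] :
    (Finset.univ.filter p).card = Nat.card {a // p a} := by
  rw [← Fintype.card_subtype, ← Nat.card_eq_fintype_card]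

variable [Finite k]

theorem card_covBy_filter (W : Submodule k V) :
    ((Finset.univ.filter fun H => H ⋖ W).card : ℤ) =
      (geomPoly (Module.finrank k W)).eval (Nat.card k : ℤ) := by
  have h := ncard_le_covBy (bot_le (a := W))
  rw [finrank_bot, Nat.sub_zero] at h
  rw [← h, card_filter_eq_natCard, ← Nat.card_coe_set_eq]
  congr 1
  exact Nat.card_congr (Equiv.subtypeEquivRight fun H => by simp)

theorem card_covBy_filter' (W : Submodule k V) :
    ((Finset.univ.filter fun H => W ⋖ H).card : ℤ) =
      (geomPoly (Module.finrank k V - Module.finrank k W)).eval (Nat.card k : ℤ) := by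
  have h := ncard_covBy_le (le_top (a := W))
  rw [finrank_top] at h
  rw [← h, card_filter_eq_natCard, ← Nat.card_coe_set_eq]
  congr 1
  exact Nat.card_congr (Equiv.subtypeEquivRight fun H => by simp)

omit [Fintype V] [Finite k] in
-- The only candidates are `W ⊓ G` and `W ⊔ G`, and by modularity one qualifies exactly when the
-- other does.
theorem card_covBy_inf {G W : Submodule k V} (h : G ≠ W) :
    (Finset.univ.filter fun H => H ⋖ W ∧ H ⋖ G).card =
      (Finset.univ.filter fun H => W ⋖ H ∧ G ⋖ H).card := by
  have h1 : ∀ H, (H ⋖ W ∧ H ⋖ G) → H = W ⊓ G := by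
    rintro H ⟨h1, h2⟩
    refine ((h1.eq_or_eq (le_inf h1.le h2.le) inf_le_left).resolve_right fun h3 => ?_).symm
    rcases h2.eq_or_eq h1.le (inf_eq_left.mp h3) with h4 | h4
    · exact h1.lt.ne' h4
    · exact h h4.symm
  have h2 : ∀ H, (W ⋖ H ∧ G ⋖ H) → H = W ⊔ G := by
    rintro H ⟨h1, h2⟩
    refine ((h1.eq_or_eq le_sup_left (sup_le h1.le h2.le)).resolve_left fun h3 => ?_).symm
    rcases h2.eq_or_eq (sup_eq_left.mp h3) h1.le with h4 | h4
    · exact h h4.symm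
    · exact h1.lt.ne h4
  have h3 : (W ⊓ G ⋖ W ∧ W ⊓ G ⋖ G) ↔ (W ⋖ W ⊔ G ∧ G ⋖ W ⊔ G) := by
    constructor
    · rintro ⟨h4, h5⟩
      exact ⟨covBy_sup_of_inf_covBy_right h5, covBy_sup_of_inf_covBy_left h4⟩
    · rintro ⟨h4, h5⟩
      exact ⟨inf_covBy_of_covBy_sup_right h5, inf_covBy_of_covBy_sup_left h4⟩
  by_cases h4 : W ⊓ G ⋖ W ∧ W ⊓ G ⋖ G
  · have e1 : (Finset.univ.filter fun H => H ⋖ W ∧ H ⋖ G) = {W ⊓ G} := by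
      ext H
      simp only [Finset.mem_filter, Finset.mem_univ, true_and, Finset.mem_singleton]
      exact ⟨h1 H, fun h => h ▸ h4⟩
    have e2 : (Finset.univ.filter fun H => W ⋖ H ∧ G ⋖ H) = {W ⊔ G} := by
      ext H
      simp only [Finset.mem_filter, Finset.mem_univ, true_and, Finset.mem_singleton]
      exact ⟨h2 H, fun h => h ▸ h3.mp h4⟩
    rw [e1, e2, Finset.card_singleton, Finset.card_singleton]
  · rw [Finset.filter_false_of_mem fun H _ h5 => h4 (h1 H h5 ▸ h5),
      Finset.filter_false_of_mem fun H _ h5 => h4 (h3.mpr (h2 H h5 ▸ h5))]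

/-- Off the diagonal the two compositions agree by `card_covBy_inf`; on it they count the
hyperplanes and the covers of `W`. -/
theorem opE_opF_sub (φ : Submodule k V → V → ℤ) (W : Submodule k V) (x : V) :
    opE (opF φ) W x - opF (opE φ) W x =
      (geomPoly (Module.finrank k W) - geomPoly (Module.finrank k V - Module.finrank k W)).eval
        (Nat.card k : ℤ) * φ W x := by
  have h1 : opE (opF φ) W x = ∑ G, ((Finset.univ.filter fun H => H ⋖ W ∧ H ⋖ G).card : ℤ) * φ G x := by
    simp only [opE, opF]
    rw [sum_filter_comm]
    simp
  have h2 : opF (opE φ) W x = ∑ G, ((Finset.univ.filter fun H => W ⋖ H ∧ G ⋖ H).card : ℤ) * φ G x := by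
    simp only [opE, opF]
    rw [sum_filter_comm]
    simp
  rw [h1, h2, ← Finset.sum_sub_distrib, Finset.sum_eq_single W]
  · simp only [and_self]
    rw [card_covBy_filter, card_covBy_filter', Polynomial.eval_sub, sub_mul]
  · intro G _ hG
    rw [card_covBy_inf hG, sub_self]
  · exact fun h => absurd (Finset.mem_univ _) h

/-- If an intermediate `H` exists, then `T / U` is a plane and there are `q + 1` of them; vectors of
`U` lie in all, the other vectors of `T` in exactly one. Keeping the number of `H` as a factor also
covers the pairs without any. -/
theorem sum_covBy_covBy (ψ : V → ℤ) (U T : Submodule k V) :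
    ((Nat.card k : ℤ) + 1) * ∑ H with U ⋖ H ∧ H ⋖ T, ∑ u with u ∈ H, ψ u =
      ((Finset.univ.filter fun H => U ⋖ H ∧ H ⋖ T).card : ℤ) *
        (Nat.card k * ∑ u with u ∈ U, ψ u + ∑ u with u ∈ T, ψ u) := by
  rcases (Finset.univ.filter fun H => U ⋖ H ∧ H ⋖ T).eq_empty_or_nonempty with h0 | ⟨H₀, h0⟩
  · rw [h0]; simp
  simp only [Finset.mem_filter, Finset.mem_univ, true_and] at h0
  have hUT : U ≤ T := h0.1.le.trans h0.2.le
  have hr : Module.finrank k T = Module.finrank k U + 2 := by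
    rw [(covBy_iff_finrank.mp h0.2).2, (covBy_iff_finrank.mp h0.1).2]
  have hiff (H : Submodule k V) : U ⋖ H ∧ H ⋖ T ↔ U ⋖ H ∧ H ≤ T := by
    refine and_congr_right fun h => ⟨fun h2 => h2.le, fun h2 => ?_⟩
    rw [covBy_iff_finrank, hr, (covBy_iff_finrank.mp h).2]
    exact ⟨h2, rfl⟩
  have hN : (Finset.univ.filter fun H => U ⋖ H ∧ H ⋖ T).card = Nat.card k + 1 := by
    simp only [hiff]
    rw [card_filter_eq_natCard, card_covBy_le hUT, hr, Nat.add_sub_cancel_left]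
    simp [Finset.sum_range_succ, add_comm]
  have hu (u : V) : (∑ H with (U ⋖ H ∧ H ⋖ T) ∧ u ∈ H, ψ u) =
      Nat.card k * (if u ∈ U then ψ u else 0) + if u ∈ T then ψ u else 0 := by
    rw [Finset.sum_const, nsmul_eq_mul]
    by_cases h1 : u ∈ U
    · have : (Finset.univ.filter fun H => (U ⋖ H ∧ H ⋖ T) ∧ u ∈ H) =
          (Finset.univ.filter fun H => U ⋖ H ∧ H ⋖ T) :=
        Finset.filter_congr fun H _ => ⟨fun h => h.1, fun h => ⟨h, h.1.le h1⟩⟩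
      rw [this, hN, if_pos h1, if_pos (hUT h1)]
      push_cast
      ring
    by_cases h2 : u ∈ T
    · have : (Finset.univ.filter fun H => (U ⋖ H ∧ H ⋖ T) ∧ u ∈ H) =
          {U ⊔ Submodule.span k {u}} := by
        ext H
        simp only [Finset.mem_filter, Finset.mem_univ, true_and, Finset.mem_singleton, hiff]
        constructor
        · rintro ⟨⟨h3, -⟩, h4⟩
          exact (sup_span_eq_of_covBy h3 h4 h1).symm
        · rintro rfl
          refine ⟨⟨covBy_sup_span h1, sup_le hUT ?_⟩,
            Submodule.mem_sup_right (Submodule.mem_span_singleton_self u)⟩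
          rwa [Submodule.span_singleton_le_iff_mem]
      rw [this, if_neg h1, if_pos h2]
      simp
    · have : (Finset.univ.filter fun H => (U ⋖ H ∧ H ⋖ T) ∧ u ∈ H) = ∅ :=
        Finset.filter_false_of_mem fun H _ h => h2 (h.1.2.le h.2)
      rw [this, if_neg h1, if_neg h2]
      simp
  rw [sum_filter_comm, Finset.sum_congr rfl fun u _ => hu u, hN, Finset.sum_add_distrib,
    ← Finset.mul_sum, ← Finset.sum_filter, ← Finset.sum_filter]
  push_cast
  ring

/-- Fix the bottom `G` of a chain `G ⋖ H ⋖ W`: the three terms sum over translates by `H`, `G` and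
`W`, which `sum_covBy_covBy` relates. -/
theorem opE_opA_opE (φ : Submodule k V → V → ℤ) (W : Submodule k V) (x : V) :
    ((Nat.card k : ℤ) + 1) * opE (opA (opE φ)) W x =
      Nat.card k * opE (opE (opA φ)) W x + opA (opE (opE φ)) W x := by
  have h1 : opE (opA (opE φ)) W x =
      ∑ G, ∑ H with G ⋖ H ∧ H ⋖ W, ∑ u with u ∈ H, φ G (x - u) := by
    simp only [opE, opA]
    rw [Finset.sum_congr rfl fun H _ => Finset.sum_comm, sum_filter_comm]
    simp only [and_comm]
  have h2 : opE (opE (opA φ)) W x =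
      ∑ G, ((Finset.univ.filter fun H => G ⋖ H ∧ H ⋖ W).card : ℤ) * ∑ u with u ∈ G, φ G (x - u) := by
    simp only [opE, opA]
    rw [sum_filter_comm]
    simp [and_comm]
  have h3 : opA (opE (opE φ)) W x =
      ∑ G, ((Finset.univ.filter fun H => G ⋖ H ∧ H ⋖ W).card : ℤ) * ∑ u with u ∈ W, φ G (x - u) := by
    simp only [opE, opA]
    have (u : V) : (∑ H with H ⋖ W, ∑ G with G ⋖ H, φ G (x - u)) =
        ∑ G, ((Finset.univ.filter fun H => G ⋖ H ∧ H ⋖ W).card : ℤ) * φ G (x - u) := by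
      rw [sum_filter_comm]
      simp [and_comm]
    rw [Finset.sum_congr rfl fun u _ => this u, Finset.sum_comm]
    simp only [Finset.mul_sum]
  rw [h1, h2, h3, Finset.mul_sum, Finset.mul_sum, ← Finset.sum_add_distrib]
  refine Finset.sum_congr rfl fun G _ => ?_
  rw [sum_covBy_covBy (fun u => φ G (x - u))]
  ring

/-- The same argument for ascending chains `W ⋖ H ⋖ G`, where the outer sums over `G` and `W` trade
places. -/
theorem opF_opA_opF (φ : Submodule k V → V → ℤ) (W : Submodule k V) (x : V) :
    ((Nat.card k : ℤ) + 1) * opF (opA (opF φ)) W x =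
      Nat.card k * opA (opF (opF φ)) W x + opF (opF (opA φ)) W x := by
  have h1 : opF (opA (opF φ)) W x =
      ∑ G, ∑ H with W ⋖ H ∧ H ⋖ G, ∑ u with u ∈ H, φ G (x - u) := by
    simp only [opF, opA]
    rw [Finset.sum_congr rfl fun H _ => Finset.sum_comm, sum_filter_comm]
  have h2 : opF (opF (opA φ)) W x =
      ∑ G, ((Finset.univ.filter fun H => W ⋖ H ∧ H ⋖ G).card : ℤ) * ∑ u with u ∈ G, φ G (x - u) := by
    simp only [opF, opA]
    rw [sum_filter_comm]
    simp
  have h3 : opA (opF (opF φ)) W x =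
      ∑ G, ((Finset.univ.filter fun H => W ⋖ H ∧ H ⋖ G).card : ℤ) * ∑ u with u ∈ W, φ G (x - u) := by
    simp only [opF, opA]
    have (u : V) : (∑ H with W ⋖ H, ∑ G with H ⋖ G, φ G (x - u)) =
        ∑ G, ((Finset.univ.filter fun H => W ⋖ H ∧ H ⋖ G).card : ℤ) * φ G (x - u) := by
      rw [sum_filter_comm]
      simp
    rw [Finset.sum_congr rfl fun u _ => this u, Finset.sum_comm]
    simp only [Finset.mul_sum]
  rw [h1, h2, h3, Finset.mul_sum, Finset.mul_sum, ← Finset.sum_add_distrib]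
  refine Finset.sum_congr rfl fun G _ => ?_
  rw [sum_covBy_covBy (fun u => φ G (x - u))]
  ring

end Operators

end

section

open Polynomial

variable {d : ℕ}

/-! ### Standard positions -/

section Standard

variable (k : Type) [Field k]

/-- The standard complete flag. -/
noncomputable def stdFlag (d : ℕ) (s : Fin (d + 1)) : Submodule k (Fin d → k) :=
  coordSpan (Pi.basisFun k (Fin d)) {j | (j : ℕ) < s}

/-- The coordinate subspace of a relative position. -/
noncomputable def XiMT.stdSubspace (Z : XiMT 2 d) : Submodule k (Fin d → k) :=
  coordSpan (Pi.basisFun k (Fin d)) {j | Z.1.1 j = 0}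

/-- The standard vector of a relative position. -/
noncomputable def XiMT.stdVector (Z : XiMT 2 d) : Fin d → k := ∑ j ∈ Z.1.2, Pi.basisFun k (Fin d) j

theorem adapted_std (Z : XiMT 2 d) :
    Adapted Z (Z.stdSubspace k) (stdFlag k d) (Z.stdVector k) (Pi.basisFun k (Fin d)) :=
  ⟨fun _ => rfl, rfl, rfl⟩

theorem isComplete_stdFlag : IsComplete (stdFlag k d) :=
  (adapted_std k (⟨(fun _ => 0, ∅), by simp⟩ : XiMT 2 d)).isComplete

/-- The relative position of a subspace and a vector with respect to the standard flag. -/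
noncomputable def relPos {k : Type} [Field k] (W : Submodule k (Fin d → k)) (x : Fin d → k) :
    XiMT 2 d :=
  ((isComplete_stdFlag k).exists_hasType W x).choose

variable {k}

theorem hasType_relPos (W : Submodule k (Fin d → k)) (x : Fin d → k) :
    HasType (relPos W x) W (stdFlag k d) x :=
  ((isComplete_stdFlag k).exists_hasType W x).choose_spec

theorem relPos_eq_iff {W : Submodule k (Fin d → k)} {x : Fin d → k} {Y : XiMT 2 d} :
    relPos W x = Y ↔ HasType Y W (stdFlag k d) x :=
  ⟨fun h => h ▸ hasType_relPos W x, fun h => (hasType_relPos W x).unique h⟩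

variable (k) in
theorem relPos_std (Z : XiMT 2 d) : relPos (Z.stdSubspace k) (Z.stdVector k) = Z :=
  relPos_eq_iff.mpr (adapted_std k Z).hasType

theorem rk_relPos (W : Submodule k (Fin d → k)) (x : Fin d → k) :
    (relPos W x).rk d = Module.finrank k W := by
  have h := (hasType_relPos W x).rank (Fin.last d)
  rw [(isComplete_stdFlag k).top, inf_top_eq] at h
  exact h.symm

/-- The position of a subspace and a vector with respect to the standard flag. -/
noncomputable def Position.std [Finite k] (W : Submodule k (Fin d → k)) (x : Fin d → k) :
    Position (relPos W x) :=
  { k := k, field := inferInstance, finite := inferInstance, F := stdFlag k d,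
    complete := isComplete_stdFlag k, W := W, x := x, hasType := hasType_relPos W x }

end Standard

/-! ### The matrices of structure polynomials -/

/-- The matrix counting hyperplanes. -/
noncomputable def matE (d : ℕ) : Matrix (XiMT 2 d) (XiMT 2 d) ℤ[X] :=
  fun Z Y => (exists_poly_e Y Z).choose

/-- The matrix counting subspaces in which the subspace is a hyperplane. -/
noncomputable def matF (d : ℕ) : Matrix (XiMT 2 d) (XiMT 2 d) ℤ[X] :=
  fun Z Y => (exists_poly_f Y Z).choose

/-- The matrix counting translates of the vector. -/
noncomputable def matA (d : ℕ) : Matrix (XiMT 2 d) (XiMT 2 d) ℤ[X] :=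
  fun Z Y => (exists_poly_a Y Z).choose

theorem eval_matE {Y Z : XiMT 2 d} (s : Position Z) : (matE d Z Y).eval (Nat.card s.k : ℤ) =
    Nat.card {H // H ⋖ s.W ∧ HasType Y H s.F s.x} :=
  ((exists_poly_e Y Z).choose_spec s).symm

theorem eval_matF {Y Z : XiMT 2 d} (s : Position Z) : (matF d Z Y).eval (Nat.card s.k : ℤ) =
    Nat.card {H // s.W ⋖ H ∧ HasType Y H s.F s.x} :=
  ((exists_poly_f Y Z).choose_spec s).symm

theorem eval_matA {Y Z : XiMT 2 d} (s : Position Z) : (matA d Z Y).eval (Nat.card s.k : ℤ) =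
    Nat.card {u // u ∈ s.W ∧ HasType Y s.W s.F (s.x - u)} :=
  ((exists_poly_a Y Z).choose_spec s).symm

theorem poly_ext {P Q : ℤ[X]} (h : ∀ p : ℕ, p.Prime → P.eval (p : ℤ) = Q.eval (p : ℤ)) : P = Q := by
  refine Polynomial.eq_of_infinite_eval_eq P Q ?_
  refine (Nat.infinite_setOfPred_prime.image Nat.cast_injective.injOn).mono ?_
  rintro _ ⟨p, hp, rfl⟩
  exact h p hp

/-- The standard configuration realises `Z` over every prime field, and agreement at all primes is
enough. -/
theorem poly_ext_position {Z : XiMT 2 d} {P Q : ℤ[X]}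
    (h : ∀ s : Position Z, P.eval (Nat.card s.k : ℤ) = Q.eval (Nat.card s.k : ℤ)) : P = Q := by
  refine poly_ext fun p hp => ?_
  have : Fact p.Prime := ⟨hp⟩
  have h1 : ∀ s : Position Z, s.k = ZMod p → P.eval (p : ℤ) = Q.eval (p : ℤ) := by
    intro s hs
    have := h s
    rwa [hs, Nat.card_zmod] at this
  rw [← relPos_std (ZMod p) Z] at h1
  exact h1 (Position.std _ _) rfl

/-- The grading by rank, which lets diagonal matrices be moved past `matE`. -/
theorem matE_eq_zero {Y Z : XiMT 2 d} (h : Z.rk d ≠ Y.rk d + 1) : matE d Z Y = 0 := by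
  refine poly_ext_position (Z := Z) fun s => ?_
  have : IsEmpty {H // H ⋖ s.W ∧ HasType Y H s.F s.x} := by
    refine ⟨fun H => h ?_⟩
    have h1 := H.2.2.rank (Fin.last d)
    rw [s.complete.top, inf_top_eq, Fin.val_last] at h1
    rw [← s.finrank_W, (covBy_iff_finrank.mp H.2.1).2, h1]
  rw [eval_matE]
  simp

theorem matF_eq_zero {Y Z : XiMT 2 d} (h : Z.rk d + 1 ≠ Y.rk d) : matF d Z Y = 0 := by
  refine poly_ext_position (Z := Z) fun s => ?_
  have : IsEmpty {H // s.W ⋖ H ∧ HasType Y H s.F s.x} := by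
    refine ⟨fun H => h ?_⟩
    have h1 := H.2.2.rank (Fin.last d)
    rw [s.complete.top, inf_top_eq, Fin.val_last] at h1
    rw [← s.finrank_W, ← h1, (covBy_iff_finrank.mp H.2.1).2]
  rw [eval_matF]
  simp

theorem matA_eq_zero {Y Z : XiMT 2 d} (h : Z.1.1 ≠ Y.1.1) : matA d Z Y = 0 := by
  refine poly_ext_position (Z := Z) fun s => ?_
  have : IsEmpty {u // u ∈ s.W ∧ HasType Y s.W s.F (s.x - u)} :=
    ⟨fun u => h (XiMT.fst_eq_of_rk fun t => by rw [← s.hasType.rank, u.2.2.rank])⟩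
  rw [eval_matA]
  simp

/-! ### Relations between the matrices -/

section Transfer

variable (k : Type) [Field k] [Finite k] [Fintype (Fin d → k)] [Fintype (Submodule k (Fin d → k))]

/-- Evaluation of a matrix of polynomials at the number of elements of a finite field. -/
noncomputable def evalMat (d : ℕ) :
    Matrix (XiMT 2 d) (XiMT 2 d) ℤ[X] →+* Matrix (XiMT 2 d) (XiMT 2 d) ℤ :=
  (evalRingHom (Nat.card k : ℤ)).mapMatrix

omit [Field k] [Finite k] [Fintype (Fin d → k)] [Fintype (Submodule k (Fin d → k))] in
theorem evalMat_smul (P : ℤ[X]) (M : Matrix (XiMT 2 d) (XiMT 2 d) ℤ[X]) :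
    evalMat k d (P • M) = P.eval (Nat.card k : ℤ) • evalMat k d M := by
  ext Z Y
  simp [evalMat]

omit [Field k] [Finite k] [Fintype (Fin d → k)] [Fintype (Submodule k (Fin d → k))] in
theorem evalMat_diagonal (P : XiMT 2 d → ℤ[X]) :
    evalMat k d (Matrix.diagonal P) = Matrix.diagonal fun Z => (P Z).eval (Nat.card k : ℤ) := by
  simp [evalMat, Matrix.diagonal_map]

/-- The function of a subspace and a vector attached to a function of the relative position. -/
noncomputable def pull (c : XiMT 2 d → ℤ) (W : Submodule k (Fin d → k)) (x : Fin d → k) : ℤ :=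
  c (relPos W x)

omit [Finite k] [Fintype (Fin d → k)] [Fintype (Submodule k (Fin d → k))] in
theorem pull_injective {c c' : XiMT 2 d → ℤ} (h : ∀ W x, pull k c W x = pull k c' W x) : c = c' := by
  funext Z
  have := h (Z.stdSubspace k) (Z.stdVector k)
  rwa [pull, pull, relPos_std] at this

open Classical in
theorem sum_comp_eq_sum_card {α β : Type*} [Fintype α] [Fintype β] (p : α → Prop)
    (f : α → β) (c : β → ℤ) : ∑ a with p a, c (f a) =
      ∑ b, (Nat.card {a // p a ∧ f a = b} : ℤ) * c b := by
  rw [← Finset.sum_fiberwise' _ f c]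
  refine Finset.sum_congr rfl fun b _ => ?_
  rw [Finset.sum_const, Finset.filter_filter, card_filter_eq_natCard, nsmul_eq_mul]

omit [Fintype (Fin d → k)] in
-- Grouping the hyperplanes by relative position shows that `opE` preserves functions of the
-- relative position and acts on them by the evaluated matrix.
theorem opE_pull (c : XiMT 2 d → ℤ) :
    opE (pull k c) = pull k ((evalMat k d (matE d)).mulVec c) := by
  funext W x
  have h (Y) : (Nat.card {H // H ⋖ W ∧ relPos H x = Y} : ℤ) =
      (matE d (relPos W x) Y).eval (Nat.card k : ℤ) := by
    rw [show (Nat.card k : ℤ) = Nat.card (Position.std W x).k from rfl, eval_matE]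
    simp only [relPos_eq_iff]
    rfl
  simp only [opE, pull]
  rw [sum_comp_eq_sum_card]
  exact Finset.sum_congr rfl fun Y _ => by rw [h]; rfl

omit [Fintype (Fin d → k)] in
theorem opF_pull (c : XiMT 2 d → ℤ) :
    opF (pull k c) = pull k ((evalMat k d (matF d)).mulVec c) := by
  funext W x
  have h (Y) : (Nat.card {H // W ⋖ H ∧ relPos H x = Y} : ℤ) =
      (matF d (relPos W x) Y).eval (Nat.card k : ℤ) := by
    rw [show (Nat.card k : ℤ) = Nat.card (Position.std W x).k from rfl, eval_matF]
    simp only [relPos_eq_iff]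
    rfl
  simp only [opF, pull]
  rw [sum_comp_eq_sum_card]
  exact Finset.sum_congr rfl fun Y _ => by rw [h]; rfl

omit [Fintype (Submodule k (Fin d → k))] in
theorem opA_pull (c : XiMT 2 d → ℤ) :
    opA (pull k c) = pull k ((evalMat k d (matA d)).mulVec c) := by
  funext W x
  have h (Y) : (Nat.card {u // u ∈ W ∧ relPos W (x - u) = Y} : ℤ) =
      (matA d (relPos W x) Y).eval (Nat.card k : ℤ) := by
    rw [show (Nat.card k : ℤ) = Nat.card (Position.std W x).k from rfl, eval_matA]
    simp only [relPos_eq_iff]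
    rfl
  simp only [opA, pull]
  rw [sum_comp_eq_sum_card]
  exact Finset.sum_congr rfl fun Y _ => by rw [h]; rfl

end Transfer

/-- Polynomial matrices are determined by their values at primes, and these by their action on
functions of the relative position. Operator identities over finite fields thus lift to matrices. -/
theorem mat_ext {M N : Matrix (XiMT 2 d) (XiMT 2 d) ℤ[X]}
    (h : ∀ (k : Type) [Field k] [Finite k] [Fintype (Fin d → k)] [Fintype (Submodule k (Fin d → k))]
      (c : XiMT 2 d → ℤ) (W : Submodule k (Fin d → k)) (x : Fin d → k),
      pull k ((evalMat k d M).mulVec c) W x = pull k ((evalMat k d N).mulVec c) W x) : M = N := by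
  ext1 Z Y
  refine poly_ext fun p hp => ?_
  have : Fact p.Prime := ⟨hp⟩
  have : Fintype (Fin d → ZMod p) := Fintype.ofFinite _
  have : Fintype (Submodule (ZMod p) (Fin d → ZMod p)) := Fintype.ofFinite _
  have h1 : evalMat (ZMod p) d M = evalMat (ZMod p) d N := by
    refine Matrix.mulVec_injective ?_
    funext c
    exact pull_injective (ZMod p) (h (ZMod p) c)
  have h2 := congrFun (congrFun h1 Z) Y
  simpa [evalMat] using h2

theorem pull_add (k : Type) [Field k] (c c' : XiMT 2 d → ℤ) (W : Submodule k (Fin d → k))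
    (x : Fin d → k) : pull k (c + c') W x = pull k c W x + pull k c' W x := rfl

theorem pull_sub (k : Type) [Field k] (c c' : XiMT 2 d → ℤ) (W : Submodule k (Fin d → k))
    (x : Fin d → k) : pull k (c - c') W x = pull k c W x - pull k c' W x := rfl

theorem pull_smul (k : Type) [Field k] (a : ℤ) (c : XiMT 2 d → ℤ) (W : Submodule k (Fin d → k))
    (x : Fin d → k) : pull k (a • c) W x = a * pull k c W x := rfl

theorem pull_diagonal (k : Type) [Field k] (g : ℕ → ℤ) (c : XiMT 2 d → ℤ)
    (W : Submodule k (Fin d → k)) (x : Fin d → k) :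
    pull k ((Matrix.diagonal fun Z => g (Z.rk d)).mulVec c) W x =
      g (Module.finrank k W) * pull k c W x := by
  rw [pull, Matrix.mulVec_diagonal, rk_relPos]
  rfl

/-- This and the following relations are the operator identities of the same shape, transported by
`mat_ext`. -/
theorem matE_matF : matE d * matF d - matF d * matE d =
    Matrix.diagonal fun Z => geomPoly (Z.rk d) - geomPoly (d - Z.rk d) := by
  refine mat_ext fun k _ _ _ _ c W x => ?_
  rw [map_sub, map_mul, map_mul, evalMat_diagonal, Matrix.sub_mulVec, ← Matrix.mulVec_mulVec,
    ← Matrix.mulVec_mulVec, pull_sub, ← opE_pull, ← opF_pull, ← opF_pull, ← opE_pull, opE_opF_sub,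
    pull_diagonal k fun n => (geomPoly n - geomPoly (d - n)).eval (Nat.card k : ℤ),
    Module.finrank_fin_fun]

theorem matA_matA : matA d * matA d = Matrix.diagonal (fun Z => X ^ Z.rk d) * matA d := by
  refine mat_ext fun k _ _ _ _ c W x => ?_
  rw [map_mul, map_mul, evalMat_diagonal, ← Matrix.mulVec_mulVec, ← Matrix.mulVec_mulVec,
    pull_diagonal k fun n => (X ^ n : ℤ[X]).eval (Nat.card k : ℤ), ← opA_pull, ← opA_pull, opA_opA]
  simp

theorem matA_matE_matA : (X : ℤ[X]) • (matA d * matE d * matA d) =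
    Matrix.diagonal (fun Z => X ^ Z.rk d) * (matA d * matE d) := by
  refine mat_ext fun k _ _ _ _ c W x => ?_
  simp only [map_mul, evalMat_smul, evalMat_diagonal, Matrix.smul_mulVec, ← Matrix.mulVec_mulVec,
    pull_smul]
  rw [pull_diagonal k fun n => (X ^ n : ℤ[X]).eval (Nat.card k : ℤ)]
  simp only [← opA_pull, ← opE_pull]
  rw [eval_X, opA_opE_opA, eval_pow, eval_X]

theorem matA_matF_matA : matA d * matF d * matA d =
    Matrix.diagonal (fun Z => X ^ Z.rk d) * (matF d * matA d) := by
  refine mat_ext fun k _ _ _ _ c W x => ?_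
  simp only [map_mul, evalMat_diagonal, ← Matrix.mulVec_mulVec]
  rw [pull_diagonal k fun n => (X ^ n : ℤ[X]).eval (Nat.card k : ℤ)]
  simp only [← opA_pull, ← opF_pull]
  rw [opA_opF_opA, eval_pow, eval_X]

theorem matE_matA_matE : (X + 1 : ℤ[X]) • (matE d * matA d * matE d) =
    (X : ℤ[X]) • (matE d * matE d * matA d) + matA d * matE d * matE d := by
  refine mat_ext fun k _ _ _ _ c W x => ?_
  simp only [map_mul, map_add, evalMat_smul, Matrix.smul_mulVec, ← Matrix.mulVec_mulVec,
    Matrix.add_mulVec, pull_smul, pull_add]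
  simp only [← opA_pull, ← opE_pull]
  rw [eval_add, eval_X, eval_one, opE_opA_opE]

theorem matF_matA_matF : (X + 1 : ℤ[X]) • (matF d * matA d * matF d) =
    (X : ℤ[X]) • (matA d * matF d * matF d) + matF d * matF d * matA d := by
  refine mat_ext fun k _ _ _ _ c W x => ?_
  simp only [map_mul, map_add, evalMat_smul, Matrix.smul_mulVec, ← Matrix.mulVec_mulVec,
    Matrix.add_mulVec, pull_smul, pull_add]
  simp only [← opA_pull, ← opF_pull]
  rw [eval_add, eval_X, eval_one, opF_opA_opF]

end

section

variable {d : ℕ}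

/-! ### Counting relative positions -/

/-- The zeros outside `A` form an arbitrary `r`-element set of positions outside `A ∪ B`. -/
theorem card_functions {A B : Finset (Fin d)} (hAB : Disjoint A B) (r : ℕ) :
    (Finset.univ.filter fun i : Fin d → Fin 2 => ((∀ a ∈ A, i a = 0) ∧ ∀ b ∈ B, i b = 1) ∧
      (Finset.univ.filter fun j => i j = 0).card = A.card + r).card =
      (d - A.card - B.card).choose r := by
  have h2 : ∀ x : Fin 2, x ≠ 0 → x = 1 := by decide
  have h1 : (Finset.powersetCard r (Finset.univ \ (A ∪ B))).card =
      (d - A.card - B.card).choose r := by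
    rw [Finset.card_powersetCard, Finset.card_sdiff_of_subset (Finset.subset_univ _),
      Finset.card_union_of_disjoint hAB, Finset.card_univ, Fintype.card_fin, Nat.sub_sub]
  rw [← h1]
  refine Finset.card_bij' (fun i _ => (Finset.univ.filter fun j => i j = 0) \ A)
    (fun S _ j => if j ∈ A ∪ S then 0 else 1) ?_ ?_ ?_ ?_
  · intro i hi
    simp only [Finset.mem_filter, Finset.mem_univ, true_and] at hi
    rw [Finset.mem_powersetCard]
    constructor
    · intro j hj
      simp only [Finset.mem_sdiff, Finset.mem_filter, Finset.mem_univ, true_and] at hj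
      simp only [Finset.mem_sdiff, Finset.mem_univ, true_and, Finset.mem_union, not_or]
      refine ⟨hj.2, fun h => ?_⟩
      have := hi.1.2 j h
      rw [hj.1] at this
      exact absurd this (by decide)
    · rw [Finset.card_sdiff_of_subset, hi.2, Nat.add_sub_cancel_left]
      intro a ha
      simpa using hi.1.1 a ha
  · intro S hS
    rw [Finset.mem_powersetCard] at hS
    simp only [Finset.mem_filter, Finset.mem_univ, true_and]
    refine ⟨⟨fun a ha => if_pos (Finset.mem_union_left _ ha), fun b hb => if_neg fun h => ?_⟩, ?_⟩
    · rcases Finset.mem_union.mp h with h | h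
      · exact Finset.disjoint_left.mp hAB h hb
      · have := hS.1 h
        simp [hb] at this
    · have : (Finset.univ.filter fun j => (if j ∈ A ∪ S then (0 : Fin 2) else 1) = 0) = A ∪ S := by
        ext j
        simp only [Finset.mem_filter, Finset.mem_univ, true_and]
        split_ifs with h <;> simp [h]
      rw [this, Finset.card_union_of_disjoint, hS.2]
      refine Finset.disjoint_left.mpr fun a ha h => ?_
      have := hS.1 h
      simp [ha] at this
  · intro i hi
    simp only [Finset.mem_filter, Finset.mem_univ, true_and] at hi
    funext j
    by_cases hj : i j = 0
    · simp [hj]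
    · have hA : j ∉ A := fun h => hj (hi.1.1 j h)
      simp [hA, h2 _ hj]
  · intro S hS
    rw [Finset.mem_powersetCard] at hS
    ext j
    simp only [Finset.mem_sdiff, Finset.mem_filter, Finset.mem_univ, true_and]
    constructor
    · rintro ⟨h, hA⟩
      have : j ∈ A ∪ S := by by_contra h3; simp [h3] at h
      exact (Finset.mem_union.mp this).resolve_left hA
    · intro h
      refine ⟨if_pos (Finset.mem_union_right _ h), fun hA => ?_⟩
      have := hS.1 h
      simp [hA] at this

theorem XiMT.rk_eq (Y : XiMT 2 d) : Y.rk d = (Finset.univ.filter fun j => Y.1.1 j = 0).card := by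
  rw [XiMT.rk]
  congr 1
  ext j
  simp

theorem XiMT.rk_le (Y : XiMT 2 d) : Y.rk d ≤ d := by
  rw [Y.rk_eq]
  exact (Finset.card_le_univ _).trans_eq (Fintype.card_fin d)

/-- Relative positions whose decorations all lie in the second row. -/
def XiMT.Reduced (Y : XiMT 2 d) : Prop := ∀ j ∈ Y.1.2, Y.1.1 j = 1

instance : DecidablePred (XiMT.Reduced (d := d)) := fun Y =>
  inferInstanceAs (Decidable (∀ j ∈ Y.1.2, Y.1.1 j = 1))

theorem sum_powerset_card_le_two (f : ℕ → ℕ) (hf : ∀ m, 3 ≤ m → f m = 0) :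
    ∑ J : Finset (Fin d), f J.card = f 0 + d * f 1 + d.choose 2 * f 2 := by
  rw [← Finset.powerset_univ, Finset.sum_powerset_apply_card, Finset.card_univ, Fintype.card_fin]
  have h1 : ∑ m ∈ Finset.range (d + 1), d.choose m • f m =
      ∑ m ∈ Finset.range (d + 3), d.choose m • f m := by
    refine Finset.sum_subset (Finset.range_mono (by omega)) fun m _ hm => ?_
    rw [Nat.choose_eq_zero_of_lt (by simpa using hm), zero_smul]
  have h2 : ∑ m ∈ Finset.range d, d.choose (m + 1 + 1 + 1) • f (m + 1 + 1 + 1) = 0 :=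
    Finset.sum_eq_zero fun m _ => by rw [hf _ (by omega), smul_zero]
  rw [h1, Finset.sum_range_succ', Finset.sum_range_succ', Finset.sum_range_succ', h2]
  simp only [smul_eq_mul, zero_add, Nat.choose_zero_right, Nat.choose_one_right]
  ring

theorem card_filter_XiMT (p : (Fin d → Fin 2) × Finset (Fin d) → Prop) [DecidablePred p]
    (f : ℕ → ℕ) (hf : ∀ m, 3 ≤ m → f m = 0)
    (h : ∀ J : Finset (Fin d), (Finset.univ.filter fun i : Fin d → Fin 2 =>
      (∀ a ∈ J, ∀ b ∈ J, a < b → i b < i a) ∧ p (i, J)).card = f J.card) :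
    (Finset.univ.filter fun Y : XiMT 2 d => p Y.1).card = f 0 + d * f 1 + d.choose 2 * f 2 := by
  rw [← sum_powerset_card_le_two f hf, ← Finset.sum_congr rfl fun J _ => h J, ← Finset.card_sigma]
  refine Finset.card_bij' (fun Y _ => ⟨Y.1.2, Y.1.1⟩)
    (fun s hs => ⟨(s.2, s.1), (Finset.mem_filter.mp (Finset.mem_sigma.mp hs).2).2.1⟩) ?_ ?_ ?_ ?_
  · intro Y hY
    simp only [Finset.mem_filter, Finset.mem_univ, true_and, Finset.mem_sigma] at hY ⊢
    exact ⟨Y.2, hY⟩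
  · intro s hs
    simp only [Finset.mem_filter, Finset.mem_univ, true_and, Finset.mem_sigma] at hs ⊢
    exact hs.2
  · intro Y _; rfl
  · intro s _; rfl

/-- The function `i` is injective on `J` and has only two values. -/
theorem not_antichain_of_three_le {J : Finset (Fin d)} (hJ : 3 ≤ J.card) {i : Fin d → Fin 2}
    (h : ∀ a ∈ J, ∀ b ∈ J, a < b → i b < i a) : False := by
  have h1 : ∀ a ∈ J, ∀ b ∈ J, i a = i b → a = b := by
    intro a ha b hb hab
    rcases lt_trichotomy a b with h2 | h2 | h2
    · exact absurd (h a ha b hb h2) (by rw [hab]; exact lt_irrefl _)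
    · exact h2
    · exact absurd (h b hb a ha h2) (by rw [hab]; exact lt_irrefl _)
  have h2 : J.card ≤ (Finset.univ : Finset (Fin 2)).card :=
    Finset.card_le_card_of_injOn i (fun _ _ => Finset.mem_univ _) fun a ha b hb => h1 a ha b hb
  simp at h2
  omega

/-- `J` is empty or a single position with value `1`; the zeros are then chosen among the other
positions. -/
theorem card_reduced (r : ℕ) :
    (Finset.univ.filter fun Y : XiMT 2 d => Y.Reduced ∧ Y.rk d = r).card =
      d.choose r + d * (d - 1).choose r := by
  have h := card_filter_XiMT (d := d) (fun y => (∀ j ∈ y.2, y.1 j = 1) ∧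
    (Finset.univ.filter fun j => y.1 j = 0).card = r)
    (fun m => if m = 0 then d.choose r else if m = 1 then (d - 1).choose r else 0)
    (fun m hm => by rw [if_neg (by omega), if_neg (by omega)]) (fun J => by
      have h0 := card_functions (A := ∅) (B := J) (Finset.disjoint_empty_left J) r
      simp only [Finset.card_empty, Nat.sub_zero, zero_add, Finset.notMem_empty, false_implies,
        implies_true, true_and] at h0
      rcases Nat.lt_or_ge J.card 2 with h1 | h1
      · have h2 : ∀ i : Fin d → Fin 2, ∀ a ∈ J, ∀ b ∈ J, a < b → i b < i a :=
          fun i a ha b hb hab => absurd (Finset.card_le_one.mp (by omega) a ha b hb) hab.ne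
        rw [Finset.filter_congr fun i _ => and_iff_right (h2 i)]
        refine h0.trans ?_
        have h3 : J.card = 0 ∨ J.card = 1 := by omega
        rcases h3 with h3 | h3 <;> simp [h3]
      · obtain ⟨a, ha, b, hb, hab⟩ := Finset.one_lt_card.mp h1
        rw [if_neg (by omega), if_neg (by omega), Finset.card_eq_zero,
          Finset.filter_eq_empty_iff]
        rintro i - ⟨h2, h3, -⟩
        simp only at h3
        rcases lt_or_gt_of_ne hab with h4 | h4
        · have := h2 a ha b hb h4
          rw [h3 a ha, h3 b hb] at this
          exact lt_irrefl _ this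
        · have := h2 b hb a ha h4
          rw [h3 a ha, h3 b hb] at this
          exact lt_irrefl _ this)
  simp only [← XiMT.rk_eq] at h
  refine Eq.trans ?_ (h.trans (by simp))
  rfl

/-- `J` is a single position with value `0`, or two positions with values `1` and `0` in this order.
The decorated zero accounts for the shift in the rank `r + 1`. -/
theorem card_not_reduced (r : ℕ) :
    (Finset.univ.filter fun Y : XiMT 2 d => ¬ Y.Reduced ∧ Y.rk d = r + 1).card =
      d * (d - 1).choose r + d.choose 2 * (d - 2).choose r := by
  have h := card_filter_XiMT (d := d) (fun y => (¬ ∀ j ∈ y.2, y.1 j = 1) ∧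
    (Finset.univ.filter fun j => y.1 j = 0).card = r + 1)
    (fun m => if m = 1 then (d - 1).choose r else if m = 2 then (d - 2).choose r else 0)
    (fun m hm => by rw [if_neg (by omega), if_neg (by omega)]) (fun J => by
      have hc : J.card = 0 ∨ J.card = 1 ∨ J.card = 2 ∨ 3 ≤ J.card := by omega
      have h10 : ∀ x : Fin 2, x ≠ 1 ↔ x = 0 := by decide
      rcases hc with hc | hc | hc | hc
      · rw [if_neg (by omega), if_neg (by omega), Finset.card_eq_zero, Finset.filter_eq_empty_iff]
        rintro i - ⟨-, h3, -⟩
        rw [Finset.card_eq_zero.mp hc] at h3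
        simp at h3
      · obtain ⟨a, rfl⟩ := Finset.card_eq_one.mp hc
        have h0 := card_functions (A := {a}) (B := ∅) (Finset.disjoint_empty_right _) r
        simp only [Finset.card_empty, Nat.sub_zero, Finset.notMem_empty, false_implies,
          implies_true, and_true, Finset.mem_singleton, forall_eq, Finset.card_singleton] at h0
        rw [if_pos hc, ← h0]
        congr 1
        refine Finset.filter_congr fun i _ => ?_
        simp [h10, add_comm]
      · obtain ⟨a, b, hab, hJ⟩ : ∃ a b, a < b ∧ J = {a, b} := by
          obtain ⟨x, y, hxy, hJ⟩ := Finset.card_eq_two.mp hc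
          rcases lt_or_gt_of_ne hxy with h | h
          · exact ⟨x, y, h, hJ⟩
          · exact ⟨y, x, h, by rw [hJ, Finset.pair_comm]⟩
        have h0 := card_functions (A := {b}) (B := {a})
          (Finset.disjoint_singleton.mpr hab.ne') r
        simp only [Finset.mem_singleton, forall_eq, Finset.card_singleton] at h0
        rw [if_neg (by omega), if_pos hc, show d - 2 = d - 1 - 1 by omega, ← h0]
        congr 1
        refine Finset.filter_congr fun i _ => ?_
        have h3 : ∀ x y : Fin 2, x < y ↔ (x = 0 ∧ y = 1) := by decide
        rw [hJ]
        simp only [Finset.mem_insert, Finset.mem_singleton, forall_eq_or_imp, forall_eq, lt_irrefl,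
          false_implies, true_and, hab, hab.not_gt, and_true, true_implies, h3, add_comm 1 r]
        constructor
        · rintro ⟨h4, -, h5⟩
          exact ⟨h4, h5⟩
        · rintro ⟨h4, h5⟩
          refine ⟨h4, fun h6 => ?_, h5⟩
          rw [h4.1] at h6
          exact absurd h6.2 (by decide)
      · rw [if_neg (by omega), if_neg (by omega), Finset.card_eq_zero, Finset.filter_eq_empty_iff]
        rintro i - ⟨h3, -⟩
        exact not_antichain_of_three_le hc h3)
  simp only [← XiMT.rk_eq] at h
  refine Eq.trans ?_ (h.trans (by simp))
  rfl

theorem card_not_reduced_zero :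
    (Finset.univ.filter fun Y : XiMT 2 d => ¬ Y.Reduced ∧ Y.rk d = 0).card = 0 := by
  rw [Finset.card_eq_zero, Finset.filter_eq_empty_iff]
  rintro Y - ⟨h1, h2⟩
  refine h1 fun j _ => ?_
  rw [Y.rk_eq, Finset.card_eq_zero, Finset.filter_eq_empty_iff] at h2
  have := h2 (Finset.mem_univ j)
  omega

theorem card_XiMT (hd : 0 < d) :
    Fintype.card (XiMT 2 d) = 2 ^ d + d * 2 ^ d + d.choose 2 * 2 ^ (d - 2) := by
  have h1 : Fintype.card (XiMT 2 d) = ∑ r ∈ Finset.range (d + 1),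
      ((Finset.univ.filter fun Y : XiMT 2 d => Y.Reduced ∧ Y.rk d = r).card +
        (Finset.univ.filter fun Y : XiMT 2 d => ¬ Y.Reduced ∧ Y.rk d = r).card) := by
    rw [← Finset.card_univ, Finset.card_eq_sum_card_fiberwise (f := fun Y : XiMT 2 d => Y.rk d)
      (t := Finset.range (d + 1)) fun Y _ => by simpa using Nat.lt_succ_of_le Y.rk_le]
    refine Finset.sum_congr rfl fun r _ => ?_
    rw [← Finset.card_filter_add_card_filter_not (fun Y : XiMT 2 d => Y.Reduced),
      Finset.filter_filter, Finset.filter_filter]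
    simp only [and_comm]
  obtain ⟨e, rfl⟩ : ∃ e, d = e + 1 := ⟨d - 1, by omega⟩
  rw [h1, Finset.sum_add_distrib, Finset.sum_congr rfl fun r _ => card_reduced r,
    Finset.sum_range_succ' (fun r => (Finset.univ.filter fun Y : XiMT 2 (e + 1) =>
      ¬ Y.Reduced ∧ Y.rk (e + 1) = r).card), card_not_reduced_zero,
    Finset.sum_congr rfl fun r _ => card_not_reduced r]
  simp only [Finset.sum_add_distrib, ← Finset.mul_sum, Nat.add_sub_cancel]
  rw [Nat.sum_range_choose, Nat.sum_range_choose]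
  have h2 : ∑ r ∈ Finset.range (e + 1 + 1), e.choose r = 2 ^ e := by
    rw [Finset.sum_range_succ, Nat.sum_range_choose, Nat.choose_succ_self, add_zero]
  have h3 : (e + 1).choose 2 * ∑ r ∈ Finset.range (e + 1), (e + 1 - 2).choose r =
      (e + 1).choose 2 * 2 ^ (e + 1 - 2) := by
    rcases e with _ | e
    · simp
    · rw [show e + 1 + 1 - 2 = e by omega, Finset.sum_range_succ, Nat.sum_range_choose,
        Nat.choose_succ_self, add_zero]
  rw [h2, h3, pow_succ]
  ring

end

section

variable {d : ℕ}

/-! ### The diagonal of `matA` -/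

/-- The reduced relative position obtained by forgetting the decorations in the first row. -/
def XiMT.ones (Y : XiMT 2 d) : XiMT 2 d :=
  ⟨(Y.1.1, Y.1.2.filter fun j => Y.1.1 j = 1),
    fun a ha b hb => Y.2 a (Finset.mem_filter.mp ha).1 b (Finset.mem_filter.mp hb).1⟩

theorem XiMT.mem_ones {Y : XiMT 2 d} {j : Fin d} : j ∈ Y.ones.1.2 ↔ j ∈ Y.1.2 ∧ Y.1.1 j = 1 :=
  Finset.mem_filter

theorem XiMT.reduced_ones (Y : XiMT 2 d) : Y.ones.Reduced := fun _ hj => (XiMT.mem_ones.mp hj).2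

section

variable {k : Type} [Field k]

theorem stdVector_sub_ones (Y : XiMT 2 d) :
    Y.stdVector k - Y.ones.stdVector k ∈ Y.stdSubspace k := by
  have h10 : ∀ x : Fin 2, x ≠ 1 → x = 0 := by decide
  have h : Y.stdVector k = Y.ones.stdVector k +
      ∑ j ∈ Y.1.2.filter (fun j => ¬ Y.1.1 j = 1), Pi.basisFun k (Fin d) j :=
    (Finset.sum_filter_add_sum_filter_not _ _ _).symm
  rw [h, add_sub_cancel_left]
  refine Submodule.sum_mem _ fun j hj => Submodule.subset_span ⟨j, ?_, rfl⟩
  exact h10 _ (Finset.mem_filter.mp hj).2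

/-- Translation by the subspace preserves the ranks and the memberships in `W ⊔ F s`, and these
determine the reduced position. -/
theorem ones_eq {Y Z : XiMT 2 d} (hZ : Z.Reduced) {z : Fin d → k} (hz : z ∈ Z.stdSubspace k)
    (hY : HasType Y (Z.stdSubspace k) (stdFlag k d) (Z.stdVector k + z)) : Y.ones = Z := by
  have h0 := (adapted_std k Z).hasType
  have e : Y.1.1 = Z.1.1 := XiMT.fst_eq_of_rk fun s => (hY.rank s).symm.trans (h0.rank s)
  have h2 (s : Fin (d + 1)) : (∀ j ∈ Y.1.2, Y.1.1 j = 1 → (j : ℕ) < s) ↔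
      ∀ j ∈ Z.1.2, Z.1.1 j = 1 → (j : ℕ) < s := by
    rw [← hY.mem_sup, ← h0.mem_sup, add_mem_cancel_right (Submodule.mem_sup_left hz)]
  refine XiMT.ext_of_bounds e (fun s => ?_) fun s => ?_
  · have h3 : (∀ j ∈ Z.1.2, (j : ℕ) < s) ↔ ∀ j ∈ Z.1.2, Z.1.1 j = 1 → (j : ℕ) < s :=
      forall₂_congr fun j hj => by simp [hZ j hj]
    rw [h3, ← h2]
    simp only [XiMT.mem_ones, and_imp]
  · rw [← h2]
    simp only [XiMT.mem_ones, and_imp]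
    exact forall₂_congr fun j _ => ⟨fun h h4 => h h4 h4, fun h _ => h⟩

theorem stdSubspace_eq {Y Z : XiMT 2 d} (h : Y.1.1 = Z.1.1) : Y.stdSubspace k = Z.stdSubspace k := by
  rw [XiMT.stdSubspace, h]; rfl

open Classical in
-- Both sides count the vectors of the cosets `x_Z + W_Z` with `Z` reduced of rank `r`. If `x_Z + z`
-- has position `Y`, then `Y.ones = Z`, and it corresponds to the pair `(Y, u)` with `x_Y - u = x_Z
-- + z`.
theorem sum_card_translates [Fintype (Fin d → k)] (r : ℕ) :
    ∑ Y : XiMT 2 d with Y.rk d = r, (Finset.univ.filter fun u => u ∈ Y.stdSubspace k ∧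
        HasType Y (Y.stdSubspace k) (stdFlag k d) (Y.stdVector k - u)).card =
      ∑ Y : XiMT 2 d with Y.Reduced ∧ Y.rk d = r,
        (Finset.univ.filter fun z => z ∈ Y.stdSubspace k).card := by
  rw [← Finset.card_sigma, ← Finset.card_sigma]
  refine Finset.card_bij'
    (fun s _ => ⟨s.1.ones, s.1.stdVector k - s.2 - s.1.ones.stdVector k⟩)
    (fun s _ => ⟨relPos (s.1.stdSubspace k) (s.1.stdVector k + s.2),
      (relPos (s.1.stdSubspace k) (s.1.stdVector k + s.2)).stdVector k - s.1.stdVector k - s.2⟩)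
    ?_ ?_ ?_ ?_
  · rintro ⟨Y, u⟩ h
    simp only [Finset.mem_sigma, Finset.mem_filter, Finset.mem_univ, true_and] at h ⊢
    refine ⟨⟨Y.reduced_ones, h.1⟩, ?_⟩
    rw [sub_right_comm]
    exact Submodule.sub_mem _ (stdVector_sub_ones Y) h.2.1
  · rintro ⟨Z, z⟩ h
    simp only [Finset.mem_sigma, Finset.mem_filter, Finset.mem_univ, true_and] at h ⊢
    obtain ⟨⟨hZ, hr⟩, hz⟩ := h
    have hY := hasType_relPos (Z.stdSubspace k) (Z.stdVector k + z)
    set Y := relPos (Z.stdSubspace k) (Z.stdVector k + z)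
    have ho := ones_eq hZ hz hY
    have e : Y.1.1 = Z.1.1 := congrArg (fun Y => Y.1.1) ho
    have e2 : Y.stdSubspace k = Z.stdSubspace k := stdSubspace_eq e
    refine ⟨?_, ?_, ?_⟩
    · rw [← hr, XiMT.rk_eq, XiMT.rk_eq, e]
    · refine Submodule.sub_mem _ ?_ (e2 ▸ hz)
      have := stdVector_sub_ones (k := k) Y
      rwa [ho] at this
    · rw [e2, show Y.stdVector k - (Y.stdVector k - Z.stdVector k - z) = Z.stdVector k + z by abel]
      exact hY
  · rintro ⟨Y, u⟩ h
    simp only [Finset.mem_sigma, Finset.mem_filter, Finset.mem_univ, true_and] at h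
    have e : relPos (Y.ones.stdSubspace k)
        (Y.ones.stdVector k + (Y.stdVector k - u - Y.ones.stdVector k)) = Y := by
      rw [add_sub_cancel]
      exact relPos_eq_iff.mpr h.2.2
    simp only [e]
    congr 1
    abel
  · rintro ⟨Z, z⟩ h
    simp only [Finset.mem_sigma, Finset.mem_filter, Finset.mem_univ, true_and] at h
    have hY := hasType_relPos (Z.stdSubspace k) (Z.stdVector k + z)
    have ho := ones_eq h.1.1 h.2 hY
    simp only [ho]
    congr 1
    abel

theorem finrank_stdSubspace (Y : XiMT 2 d) : Module.finrank k (Y.stdSubspace k) = Y.rk d := by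
  rw [← rk_relPos _ (Y.stdVector k), relPos_std]

end

open Polynomial

/-- The trace of `matA` in rank `r`. As `ℓ` is idempotent and equals `v ^ (-2 * r)` times this
operator there, it yields the dimension of the image of `ℓ`. -/
theorem sum_matA_diag (r : ℕ) : ∑ Y : XiMT 2 d with Y.rk d = r, matA d Y Y =
    ((d.choose r + d * (d - 1).choose r : ℕ) : ℤ[X]) * X ^ r := by
  classical
  refine poly_ext fun p hp => ?_
  have : Fact p.Prime := ⟨hp⟩
  have h1 (Y : XiMT 2 d) : (matA d Y Y).eval (p : ℤ) = ((Finset.univ.filter fun u =>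
      u ∈ Y.stdSubspace (ZMod p) ∧ HasType Y (Y.stdSubspace (ZMod p)) (stdFlag (ZMod p) d)
        (Y.stdVector (ZMod p) - u)).card : ℤ) := by
    rw [card_filter_eq_natCard]
    have := eval_matA (Y := Y) (Z := Y)
      ⟨ZMod p, inferInstance, inferInstance, stdFlag (ZMod p) d, isComplete_stdFlag (ZMod p),
        Y.stdSubspace (ZMod p), Y.stdVector (ZMod p), (adapted_std (ZMod p) Y).hasType⟩
    rw [Nat.card_zmod] at this
    exact this
  have h2 (Y : XiMT 2 d) (hY : Y ∈ Finset.univ.filter fun Y : XiMT 2 d => Y.Reduced ∧ Y.rk d = r) :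
      (Finset.univ.filter fun z => z ∈ Y.stdSubspace (ZMod p)).card = p ^ r := by
    rw [card_filter_mem, finrank_stdSubspace, Nat.card_zmod, (Finset.mem_filter.mp hY).2.2]
  rw [eval_finsetSum, Finset.sum_congr rfl fun Y _ => h1 Y, ← Nat.cast_sum, sum_card_translates,
    Finset.sum_congr rfl h2, Finset.sum_const, card_reduced]
  simp

end

section

open Polynomial

variable {d : ℕ}

/-! ### The structure polynomials of the generators -/

/-- `structurePolynomial` is a choice, so uniqueness is what makes it computable; it follows from
the positions of type `Z` over all prime fields. -/
theorem structurePolynomial_eq {X : XiMU 2 d} {Y Z : XiMT 2 d} {P : ℤ[X]}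
    (h : IsStructurePolynomial X Y Z P) : structurePolynomial X Y Z = P := by
  have h0 : ∃ P, IsStructurePolynomial X Y Z P := ⟨P, h⟩
  rw [structurePolynomial, dif_pos h0]
  refine poly_ext_position (Z := Z) fun s => ?_
  have hO : InOrbit Z.mat Z.dec (Flag.ofSubmodule s.W)
      (⟨s.F, s.complete.mono, s.complete.bot, s.complete.top⟩ : Flag s.k (Fin d → s.k) d) s.x :=
    (inOrbit_iff_hasType s.complete).mpr s.hasType
  rw [← h0.choose_spec s.k _ _ _ hO, ← h s.k _ _ _ hO]

theorem structurePolynomial_eq_of_position {X : XiMU 2 d} {Y Z : XiMT 2 d} {P : ℤ[X]}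
    (h : ∀ (s : Position Z) (F : Flag s.k (Fin d → s.k) 2), F.F 1 = s.W →
      (Nat.card {c : Flag s.k (Fin d → s.k) 2 × (Fin d → s.k) // InOrbit X.1.1 X.1.2 F c.1 c.2 ∧
        HasType Y (c.1.F 1) s.F (s.x - c.2)} : ℤ) = P.eval (Nat.card s.k : ℤ)) :
    structurePolynomial X Y Z = P := by
  refine structurePolynomial_eq fun k _ _ F F' x hO => ?_
  have hc := hO.isComplete
  rw [← h ⟨k, inferInstance, inferInstance, F'.F, hc, F.F 1, x, (inOrbit_iff_hasType hc).mp hO⟩ F rfl]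
  simp only [inOrbit_iff_hasType hc]

section

variable {k V : Type} [Field k] [AddCommGroup V] [Module k V]

theorem card_flags_zero (R : Submodule k V → Prop) :
    Nat.card {c : Flag k V 2 × V // c.2 = 0 ∧ R (c.1.F 1)} = Nat.card {H // R H} :=
  Nat.card_congr
    { toFun := fun c => ⟨c.1.1.F 1, c.2.2⟩
      invFun := fun H => ⟨(Flag.ofSubmodule H.1, 0), rfl, H.2⟩
      left_inv := fun ⟨⟨F, u⟩, h1, h2⟩ => by
        simp only at h1
        subst h1
        exact Subtype.ext (Prod.ext (Flag.equivSubmodule.left_inv F) rfl)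
      right_inv := fun _ => rfl }

theorem card_flags_eq (W : Submodule k V) (R : V → Prop) :
    Nat.card {c : Flag k V 2 × V // c.1.F 1 = W ∧ R c.2} = Nat.card {u // R u} :=
  Nat.card_congr
    { toFun := fun c => ⟨c.1.2, c.2.2⟩
      invFun := fun u => ⟨(Flag.ofSubmodule W, u.1), rfl, u.2⟩
      left_inv := fun ⟨⟨F, u⟩, h1, h2⟩ => by
        simp only at h1
        subst h1
        exact Subtype.ext (Prod.ext (Flag.equivSubmodule.left_inv F) rfl)
      right_inv := fun _ => rfl }

end

/-- The empty decoration forces `u = 0`, so the convolution counts hyperplanes; the matrix of `e_r`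
adds only that the subspace has dimension `r + 1`. -/
theorem structurePolynomial_e {X : XiMU 2 d} {r : ℕ} (hX : X.1 = (!![r, 1; 0, d - r - 1], ∅))
    (Y Z : XiMT 2 d) :
    structurePolynomial X Y Z = if Z.rk d = r + 1 then matE d Z Y else 0 := by
  obtain ⟨⟨A, Δ⟩, hA⟩ := X
  obtain ⟨rfl, rfl⟩ := Prod.mk.inj hX
  refine structurePolynomial_eq_of_position fun s F hF => ?_
  have hW := s.finrank_W
  have hO (c : Flag s.k (Fin d → s.k) 2 × (Fin d → s.k)) :
      (InOrbit !![r, 1; 0, d - r - 1] ∅ F c.1 c.2 ∧ HasType Y (c.1.F 1) s.F (s.x - c.2)) ↔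
        (c.2 = 0 ∧ (Z.rk d = r + 1 ∧ c.1.F 1 ⋖ s.W ∧ HasType Y (c.1.F 1) s.F s.x)) := by
    rw [inOrbit_iff_of_le (hA.1.trans (Module.finrank_fin_fun _).symm) rfl, hF, covBy_iff_finrank, hW]
    simp only [Matrix.of_apply, Matrix.cons_val_zero, Matrix.cons_val_one]
    constructor
    · rintro ⟨⟨h1, h2, h3, h4⟩, h5⟩
      rw [h1, sub_zero] at h5
      exact ⟨h1, h3, ⟨h2, by omega⟩, h5⟩
    · rintro ⟨h1, h2, ⟨h3, h4⟩, h5⟩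
      rw [h1, sub_zero]
      exact ⟨⟨rfl, h3, h2, by omega⟩, h5⟩
  simp only [hO]
  rw [card_flags_zero (fun H => Z.rk d = r + 1 ∧ H ⋖ s.W ∧ HasType Y H s.F s.x)]
  split_ifs with h
  · rw [eval_matE]
    simp only [h, true_and]
  · simp [h]

theorem structurePolynomial_f {X : XiMU 2 d} {r : ℕ} (hX : X.1 = (!![r, 0; 1, d - r - 1], ∅))
    (Y Z : XiMT 2 d) :
    structurePolynomial X Y Z = if Z.rk d = r then matF d Z Y else 0 := by
  obtain ⟨⟨A, Δ⟩, hA⟩ := X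
  obtain ⟨rfl, rfl⟩ := Prod.mk.inj hX
  refine structurePolynomial_eq_of_position fun s F hF => ?_
  have hW := s.finrank_W
  have hO (c : Flag s.k (Fin d → s.k) 2 × (Fin d → s.k)) :
      (InOrbit !![r, 0; 1, d - r - 1] ∅ F c.1 c.2 ∧ HasType Y (c.1.F 1) s.F (s.x - c.2)) ↔
        (c.2 = 0 ∧ (Z.rk d = r ∧ s.W ⋖ c.1.F 1 ∧ HasType Y (c.1.F 1) s.F s.x)) := by
    rw [inOrbit_iff_of_ge (hA.1.trans (Module.finrank_fin_fun _).symm) rfl, hF, covBy_iff_finrank, hW]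
    simp only [Matrix.of_apply, Matrix.cons_val_zero, Matrix.cons_val_one]
    constructor
    · rintro ⟨⟨h1, h2, h3, h4⟩, h5⟩
      rw [h1, sub_zero] at h5
      exact ⟨h1, h3, ⟨h2, by omega⟩, h5⟩
    · rintro ⟨h1, h2, ⟨h3, h4⟩, h5⟩
      rw [h1, sub_zero]
      exact ⟨⟨rfl, h3, h2, by omega⟩, h5⟩
  simp only [hO]
  rw [card_flags_zero (fun H => Z.rk d = r ∧ s.W ⋖ H ∧ HasType Y H s.F s.x)]
  split_ifs with h
  · rw [eval_matF]
    simp only [h, true_and]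
  · simp [h]

theorem structurePolynomial_one {X : XiMU 2 d} {r : ℕ} (hX : X.1 = (!![r, 0; 0, d - r], ∅))
    (Y Z : XiMT 2 d) :
    structurePolynomial X Y Z = if Z.rk d = r ∧ Z = Y then 1 else 0 := by
  obtain ⟨⟨A, Δ⟩, hA⟩ := X
  obtain ⟨rfl, rfl⟩ := Prod.mk.inj hX
  refine structurePolynomial_eq_of_position fun s F hF => ?_
  have hW := s.finrank_W
  have hO (c : Flag s.k (Fin d → s.k) 2 × (Fin d → s.k)) :
      (InOrbit !![r, 0; 0, d - r] ∅ F c.1 c.2 ∧ HasType Y (c.1.F 1) s.F (s.x - c.2)) ↔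
        (c.2 = 0 ∧ (c.1.F 1 = s.W ∧ Z.rk d = r ∧ Z = Y)) := by
    rw [inOrbit_iff_of_le (hA.1.trans (Module.finrank_fin_fun _).symm) rfl, hF]
    simp only [Matrix.of_apply, Matrix.cons_val_zero, Matrix.cons_val_one, add_zero]
    constructor
    · rintro ⟨⟨h1, h2, h3, h4⟩, h5⟩
      rw [h1, sub_zero] at h5
      have h6 := Submodule.eq_of_le_of_finrank_eq h2 (h4.trans h3.symm)
      rw [h6] at h5
      exact ⟨h1, h6, hW.symm.trans h3, s.hasType.unique h5⟩
    · rintro ⟨h1, h2, h3, h4⟩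
      rw [h1, sub_zero, h2, ← h4]
      exact ⟨⟨rfl, le_rfl, hW.trans h3, hW.trans h3⟩, s.hasType⟩
  simp only [hO]
  rw [card_flags_zero (fun H => H = s.W ∧ Z.rk d = r ∧ Z = Y)]
  split_ifs with h
  · have h1 : ∀ H, (H = s.W ∧ Z.rk d = r ∧ Z = Y) ↔ H = s.W := fun H => and_iff_left h
    simp only [h1]
    simp
  · simp [h]

/-- The decoration requires `u ≠ 0`. The excluded `u = 0` would contribute exactly when `Z = Y`,
hence the subtracted identity. -/
theorem structurePolynomial_x {X : XiMU 2 d} {r : ℕ}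
    (hX : X.1 = (!![r + 1, 0; 0, d - (r + 1)], {(0, 0)})) (Y Z : XiMT 2 d) :
    structurePolynomial X Y Z =
      if Z.rk d = r + 1 then matA d Z Y - (if Z = Y then 1 else 0) else 0 := by
  classical
  obtain ⟨⟨A, Δ⟩, hA⟩ := X
  obtain ⟨rfl, rfl⟩ := Prod.mk.inj hX
  refine structurePolynomial_eq_of_position fun s F hF => ?_
  have hW := s.finrank_W
  have hO (c : Flag s.k (Fin d → s.k) 2 × (Fin d → s.k)) :
      (InOrbit !![r + 1, 0; 0, d - (r + 1)] {(0, 0)} F c.1 c.2 ∧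
        HasType Y (c.1.F 1) s.F (s.x - c.2)) ↔ (c.1.F 1 = s.W ∧
        (Z.rk d = r + 1 ∧ (c.2 ∈ s.W ∧ HasType Y s.W s.F (s.x - c.2)) ∧ c.2 ≠ 0)) := by
    rw [inOrbit_iff_of_mem (hA.1.trans (Module.finrank_fin_fun _).symm) rfl rfl (Nat.succ_pos r), hF,
      hW]
    simp only [Matrix.of_apply, Matrix.cons_val_zero]
    constructor
    · rintro ⟨⟨h1, h2, h3, h4⟩, h5⟩
      rw [← h3] at h5
      exact ⟨h3.symm, h4, ⟨h1, h5⟩, h2⟩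
    · rintro ⟨h1, h2, ⟨h3, h4⟩, h5⟩
      rw [h1]
      exact ⟨⟨h3, h5, rfl, h2⟩, h4⟩
  simp only [hO]
  rw [card_flags_eq s.W (fun u => Z.rk d = r + 1 ∧ (u ∈ s.W ∧ HasType Y s.W s.F (s.x - u)) ∧ u ≠ 0)]
  by_cases h : Z.rk d = r + 1
  · rw [if_pos h]
    have h0 : (Nat.card {u // (u ∈ s.W ∧ HasType Y s.W s.F (s.x - u)) ∧ u = 0} : ℤ) =
        if Z = Y then 1 else 0 := by
      by_cases hZY : Z = Y
      · rw [if_pos hZY]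
        have : ∀ u, ((u ∈ s.W ∧ HasType Y s.W s.F (s.x - u)) ∧ u = 0) ↔ u = 0 := by
          intro u
          refine ⟨fun h => h.2, fun h => ⟨?_, h⟩⟩
          rw [h, sub_zero, ← hZY]
          exact ⟨zero_mem _, s.hasType⟩
        simp [this]
      · rw [if_neg hZY]
        have : IsEmpty {u // (u ∈ s.W ∧ HasType Y s.W s.F (s.x - u)) ∧ u = 0} := by
          refine ⟨fun u => hZY ?_⟩
          have h1 := u.2.1.2
          rw [u.2.2, sub_zero] at h1
          exact s.hasType.unique h1
        simp
    have h1 : (if Z = Y then (1 : ℤ[X]) else 0).eval (Nat.card s.k : ℤ) =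
        if Z = Y then 1 else 0 := by split_ifs <;> simp
    rw [eval_sub, eval_matA, h1, ← h0, eq_sub_iff_add_eq, ← Nat.cast_add, ← Nat.card_sum]
    congr 1
    simp only [h, true_and]
    refine Nat.card_congr ((Equiv.sumComm _ _).trans ((Equiv.sumCongr
      (Equiv.subtypeSubtypeEquivSubtypeInter (fun u => u ∈ s.W ∧ HasType Y s.W s.F (s.x - u))
        fun u => u = 0).symm
      (Equiv.subtypeSubtypeEquivSubtypeInter (fun u => u ∈ s.W ∧ HasType Y s.W s.F (s.x - u))
        fun u => u ≠ 0).symm).trans (Equiv.sumCompl _)))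
  · rw [if_neg h]
    simp [h]

end

section

open Polynomial

/-! ### The operators over `ℂ(v)` -/

section Hat

variable (d : ℕ)

/-- Specialization of the matrices of polynomials at `q = v ^ 2`. -/
noncomputable def specMat :
    Matrix (XiMT 2 d) (XiMT 2 d) ℤ[X] →+* Matrix (XiMT 2 d) (XiMT 2 d) K :=
  (aeval (v ^ 2) : ℤ[X] →ₐ[ℤ] K).toRingHom.mapMatrix

theorem specMat_apply (M : Matrix (XiMT 2 d) (XiMT 2 d) ℤ[X]) (Z Y : XiMT 2 d) :
    specMat d M Z Y = aeval (v ^ 2) (M Z Y) := rfl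

theorem specMat_smul (P : ℤ[X]) (M : Matrix (XiMT 2 d) (XiMT 2 d) ℤ[X]) :
    specMat d (P • M) = (aeval (v ^ 2) P : K) • specMat d M := by
  ext Z Y
  simp [specMat_apply]

theorem specMat_diagonal (P : XiMT 2 d → ℤ[X]) :
    specMat d (Matrix.diagonal P) = Matrix.diagonal fun Z => (aeval (v ^ 2) (P Z) : K) := by
  ext Z Y
  by_cases h : Z = Y
  · subst h; simp [specMat_apply]
  · simp [specMat_apply, Matrix.diagonal_apply_ne _ h]

noncomputable def hatE : Matrix (XiMT 2 d) (XiMT 2 d) K := specMat d (matE d)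
noncomputable def hatF : Matrix (XiMT 2 d) (XiMT 2 d) K := specMat d (matF d)
noncomputable def hatA : Matrix (XiMT 2 d) (XiMT 2 d) K := specMat d (matA d)

/-- The diagonal matrix with entries `v ^ (a * r + b)`, where `r` is the rank. -/
noncomputable def hatD (a b : ℤ) : Matrix (XiMT 2 d) (XiMT 2 d) K :=
  Matrix.diagonal fun Z => v ^ (a * Z.rk d + b)

variable {d} {a b a' b' : ℤ} {M : Matrix (XiMT 2 d) (XiMT 2 d) K}

theorem hatD_mul : hatD d a b * hatD d a' b' = hatD d (a + a') (b + b') := by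
  rw [hatD, hatD, hatD, Matrix.diagonal_mul_diagonal]
  congr 1
  funext Z
  rw [← zpow_add₀ v_ne_zero]
  congr 1
  ring

theorem hatD_mul_assoc : hatD d a b * (hatD d a' b' * M) = hatD d (a + a') (b + b') * M := by
  rw [← mul_assoc, hatD_mul]

theorem hatD_zero (b : ℤ) : hatD d 0 b = v ^ b • 1 := by
  ext Z Y
  by_cases h : Z = Y
  · subst h; simp [hatD]
  · simp [hatD, h]

theorem smul_hatD (c : ℤ) : v ^ c • hatD d a b = hatD d a (b + c) := by
  have h : hatD d a (b + c) = hatD d 0 c * hatD d a b := by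
    rw [hatD_mul, zero_add, add_comm]
  rw [h, hatD_zero, smul_mul_assoc, one_mul]

/-- Nonzero entries of `hatE` link ranks that differ by one, so a diagonal matrix passes through
with its exponent shifted by `a`. -/
theorem hatE_mul_hatD : hatE d * hatD d a b = hatD d a (b - a) * hatE d := by
  ext Z Y
  rw [hatD, hatD, Matrix.mul_diagonal, Matrix.diagonal_mul, hatE, specMat_apply]
  by_cases h : Z.rk d = Y.rk d + 1
  · rw [mul_comm, h]
    congr 2
    push_cast
    ring
  · rw [matE_eq_zero h]
    simp

theorem hatF_mul_hatD : hatF d * hatD d a b = hatD d a (b + a) * hatF d := by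
  ext Z Y
  rw [hatD, hatD, Matrix.mul_diagonal, Matrix.diagonal_mul, hatF, specMat_apply]
  by_cases h : Z.rk d + 1 = Y.rk d
  · rw [mul_comm, ← h]
    congr 2
    push_cast
    ring
  · rw [matF_eq_zero h]
    simp

theorem hatA_mul_hatD : hatA d * hatD d a b = hatD d a b * hatA d := by
  ext Z Y
  rw [hatD, Matrix.mul_diagonal, Matrix.diagonal_mul, hatA, specMat_apply]
  by_cases h : Z.1.1 = Y.1.1
  · rw [mul_comm, Z.rk_eq, Y.rk_eq, h]
  · rw [matA_eq_zero h]
    simp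

theorem hatE_mul_hatD_assoc : hatE d * (hatD d a b * M) = hatD d a (b - a) * (hatE d * M) := by
  rw [← mul_assoc, hatE_mul_hatD, mul_assoc]

theorem hatF_mul_hatD_assoc : hatF d * (hatD d a b * M) = hatD d a (b + a) * (hatF d * M) := by
  rw [← mul_assoc, hatF_mul_hatD, mul_assoc]

theorem hatA_mul_hatD_assoc : hatA d * (hatD d a b * M) = hatD d a b * (hatA d * M) := by
  rw [← mul_assoc, hatA_mul_hatD, mul_assoc]

theorem specMat_X_pow : specMat d (Matrix.diagonal fun Z => X ^ Z.rk d) = hatD d 2 0 := by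
  rw [specMat_diagonal, hatD]
  congr 1
  funext Z
  rw [map_pow, aeval_X, ← pow_mul, add_zero, ← zpow_natCast]
  push_cast
  rfl

theorem hatA_hatA : hatA d * hatA d = hatD d 2 0 * hatA d := by
  have h := congrArg (specMat d) (matA_matA (d := d))
  rwa [map_mul, map_mul, specMat_X_pow] at h

theorem hatA_hatE_hatA : hatA d * (hatE d * hatA d) = hatD d 2 (-2) * (hatA d * hatE d) := by
  have h := congrArg (specMat d) (matA_matE_matA (d := d))
  rw [specMat_smul, map_mul, map_mul, map_mul, map_mul, specMat_X_pow, aeval_X] at h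
  have h2 := congrArg (fun M => (v ^ (-2 : ℤ)) • M) h
  simp only [smul_smul] at h2
  have h3 : v ^ (-2 : ℤ) * v ^ 2 = 1 := by
    rw [← zpow_natCast, ← zpow_add₀ v_ne_zero]; simp
  rw [h3, one_smul, ← smul_mul_assoc, smul_hatD, zero_add, mul_assoc] at h2
  exact h2

theorem hatA_hatF_hatA : hatA d * (hatF d * hatA d) = hatD d 2 0 * (hatF d * hatA d) := by
  have h := congrArg (specMat d) (matA_matF_matA (d := d))
  rwa [map_mul, map_mul, map_mul, map_mul, specMat_X_pow, mul_assoc] at h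

theorem hatE_hatA_hatE : (v ^ 2 + 1) • (hatE d * (hatA d * hatE d)) =
    v ^ 2 • (hatE d * (hatE d * hatA d)) + hatA d * (hatE d * hatE d) := by
  have h := congrArg (specMat d) (matE_matA_matE (d := d))
  rw [map_add, specMat_smul, specMat_smul] at h
  simp only [map_mul, map_add, aeval_X, map_one, mul_assoc] at h
  exact h

theorem hatF_hatA_hatF : (v ^ 2 + 1) • (hatF d * (hatA d * hatF d)) =
    v ^ 2 • (hatA d * (hatF d * hatF d)) + hatF d * (hatF d * hatA d) := by
  have h := congrArg (specMat d) (matF_matA_matF (d := d))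
  rw [map_add, specMat_smul, specMat_smul] at h
  simp only [map_mul, map_add, aeval_X, map_one, mul_assoc] at h
  exact h

theorem aeval_geomPoly (n : ℕ) :
    (aeval (v ^ 2) (geomPoly n) : K) = (v ^ (2 * n : ℤ) - 1) / (v ^ 2 - 1) := by
  have h1 : v ^ 2 ≠ 1 := v_pow_ne_one 2 (by norm_num)
  rw [geomPoly, map_sum]
  simp only [map_pow, aeval_X]
  rw [geom_sum_eq h1, ← pow_mul, ← zpow_natCast]
  push_cast
  rfl

/-- The factor `v ^ (1 - d)` is the product of the normalisations of `e` and `f`; it makes the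
difference of the two geometric sums symmetric in `v` and `v⁻¹` up to sign. -/
theorem hatE_hatF : v ^ (1 - d : ℤ) • (hatE d * hatF d - hatF d * hatE d) =
    (v - v⁻¹)⁻¹ • (hatD d 2 (-d) - hatD d (-2) d) := by
  have h := congrArg (specMat d) (matE_matF (d := d))
  rw [map_sub, map_mul, map_mul, specMat_diagonal] at h
  rw [hatE, hatF, h]
  ext Z Y
  by_cases hZY : Z = Y
  swap
  · simp [hatD, Matrix.diagonal_apply_ne _ hZY]
  subst hZY
  simp only [hatD, Matrix.smul_apply, Matrix.sub_apply, Matrix.diagonal_apply_eq, smul_eq_mul,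
    map_sub, aeval_geomPoly]
  have h0 := v_ne_zero
  have h1 := v_sub_inv_ne_zero
  have h2 : v ^ 2 - 1 ≠ 0 := sub_ne_zero.mpr (v_pow_ne_one 2 (by norm_num))
  have h3 : v ^ 2 - 1 = v * (v - v⁻¹) := by field_simp
  rw [Nat.cast_sub Z.rk_le, h3]
  have e1 : v ^ (2 * (Z.rk d : ℤ) + -(d : ℤ)) = v⁻¹ * (v ^ (1 - d : ℤ) * v ^ (2 * (Z.rk d : ℤ))) := by
    rw [← zpow_add₀ h0, ← zpow_neg_one, ← zpow_add₀ h0]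
    congr 1; ring
  have e2 : v ^ (-2 * (Z.rk d : ℤ) + (d : ℤ)) =
      v⁻¹ * (v ^ (1 - d : ℤ) * v ^ (2 * ((d : ℤ) - Z.rk d))) := by
    rw [← zpow_add₀ h0, ← zpow_neg_one, ← zpow_add₀ h0]
    congr 1; ring
  rw [e1, e2]
  field_simp
  ring

/-- The matrices of the generators. -/
noncomputable def genMat (d : ℕ) : Gen → Matrix (XiMT 2 d) (XiMT 2 d) K
  -- A row of rank `r + 1` belongs to `e_r`, whose coefficient is `v ^ (-r)`; this explains the
  -- offset `1`.
  | Gen.e => hatD d (-1) 1 * hatE d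
  | Gen.f => hatD d 1 (1 - d) * hatF d
  | Gen.k => hatD d 2 (-d)
  | Gen.kinv => hatD d (-2) d
  | Gen.l => hatD d (-2) 0 * hatA d

theorem qint_two_mul_v : qint 2 = v⁻¹ * (v ^ 2 + 1) := by
  have h0 := v_ne_zero
  rw [qint_two]
  field_simp

/-- Once all diagonal factors are moved to the left, each relation reduces to an identity among
`hatE`, `hatF`, `hatA` and a comparison of exponents. -/
theorem genMat_rel ⦃a b : FreeAlgebra K Gen⦄ (h : Rel a b) :
    FreeAlgebra.lift K (genMat d) a = FreeAlgebra.lift K (genMat d) b := by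
  have h0 := v_ne_zero
  have s1 : v⁻¹ * v ^ 2 = v ^ (1 : ℤ) := by rw [zpow_one]; field_simp
  have s2 : v⁻¹ = v ^ (-1 : ℤ) := (zpow_neg_one v).symm
  have s3 : ∀ M : Matrix (XiMT 2 d) (XiMT 2 d) K, v • M = v ^ (1 : ℤ) • M := fun M => by
    rw [zpow_one]
  cases h <;> simp only [Free.e, Free.f, Free.k, Free.kinv, Free.l, map_mul, map_sub, map_add,
    map_smul, map_one, FreeAlgebra.lift_ι_apply, genMat, mul_assoc, hatE_mul_hatD_assoc,
    hatF_mul_hatD_assoc, hatA_mul_hatD_assoc, hatE_mul_hatD, hatF_mul_hatD, hatA_mul_hatD,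
    hatD_mul_assoc, hatD_mul]
  case k_kinv => simp [hatD_zero]
  case kinv_k => simp [hatD_zero]
  case k_e =>
    rw [← zpow_natCast, ← smul_mul_assoc, smul_hatD]
    congr 2
    push_cast
    ring
  case k_f =>
    rw [← smul_mul_assoc, smul_hatD]
    congr 2
    ring
  case e_f =>
    rw [← hatE_hatF, smul_sub]
    have e1 : hatD d (-1 + 1) (1 + (1 - (d : ℤ) - 1)) = v ^ (1 - d : ℤ) • 1 := by
      rw [← hatD_zero]; congr 1; ring
    have e2 : hatD d (1 + -1) (1 - (d : ℤ) + (1 + -1)) = v ^ (1 - d : ℤ) • 1 := by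
      rw [← hatD_zero]; congr 1; ring
    rw [e1, e2, smul_mul_assoc, smul_mul_assoc, one_mul, one_mul]
  case l_l =>
    rw [hatA_hatA, hatD_mul_assoc]
    norm_num
  case k_l =>
    congr 2
    ring
  case l_e_l =>
    rw [hatA_hatE_hatA, hatD_mul_assoc]
    congr 2
  case l_f_l =>
    rw [hatA_hatF_hatA, hatD_mul_assoc]
    congr 2
    ring
  case e_l_e =>
    rw [qint_two_mul_v, mul_smul, ← mul_smul_comm, hatE_hatA_hatE, mul_add, mul_smul_comm, smul_add]
    simp only [← smul_mul_assoc, smul_smul]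
    rw [s1, s2, s3, smul_hatD, smul_hatD, smul_hatD, smul_hatD]
    congr 3
  case f_l_f =>
    rw [qint_two_mul_v, mul_smul, ← mul_smul_comm, hatF_hatA_hatF, mul_add, mul_smul_comm, smul_add]
    simp only [← smul_mul_assoc, smul_smul]
    rw [s1, s2, s3, smul_hatD, smul_hatD, smul_hatD, smul_hatD]
    congr 3 <;> ring

end Hat

end

section

open Polynomial

variable {d : ℕ}

/-! ### The module `MT_v(2,d)` -/

/-- Matrices as operators on `MT_v(2,d)`. -/
noncomputable def toEnd (d : ℕ) : Matrix (XiMT 2 d) (XiMT 2 d) K ≃ₐ[K] Module.End K (MT 2 d) :=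
  Matrix.toLinAlgEquiv Finsupp.basisSingleOne

theorem toEnd_single (M : Matrix (XiMT 2 d) (XiMT 2 d) K) (Y : XiMT 2 d) :
    toEnd d M (Finsupp.single Y 1) = ∑ Z, Finsupp.single Z (M Z Y) := by
  have h := Matrix.toLinAlgEquiv_self (Finsupp.basisSingleOne : Module.Basis (XiMT 2 d) K (MT 2 d)) M Y
  rw [Finsupp.coe_basisSingleOne] at h
  refine h.trans (Finset.sum_congr rfl fun Z _ => ?_)
  rw [Finsupp.smul_single, smul_eq_mul, mul_one]

theorem toEnd_apply (M : Matrix (XiMT 2 d) (XiMT 2 d) K) (x : MT 2 d) (Z : XiMT 2 d) :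
    toEnd d M x Z = ∑ Y, M Z Y * x Y := by
  have h : x = ∑ Y, x Y • Finsupp.single Y 1 := by
    conv_lhs => rw [← Finsupp.univ_sum_single x]
    simp
  conv_lhs => rw [h]
  rw [map_sum, Finsupp.finsetSum_apply]
  refine Finset.sum_congr rfl fun Y _ => ?_
  rw [map_smul, toEnd_single, Finsupp.smul_apply, Finsupp.finsetSum_apply]
  simp [Finsupp.single_apply, mul_comm]

theorem toEnd_diagonal_apply (g : XiMT 2 d → K) (x : MT 2 d) (Z : XiMT 2 d) :
    toEnd d (Matrix.diagonal g) x Z = g Z * x Z := by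
  rw [toEnd_apply, Finset.sum_eq_single Z]
  · rw [Matrix.diagonal_apply_eq]
  · intro Y _ hY
    rw [Matrix.diagonal_apply_ne _ hY.symm, zero_mul]
  · simp

theorem trace_toEnd (M : Matrix (XiMT 2 d) (XiMT 2 d) K) :
    LinearMap.trace K (MT 2 d) (toEnd d M) = M.trace :=
  Matrix.trace_toLin_eq M Finsupp.basisSingleOne

/-! #### The action of the generators -/

theorem act_sum {ι : Type*} [Fintype ι] {c : ι → K} {X : ι → XiMU 2 d}
    {P : ι → XiMT 2 d → XiMT 2 d → ℤ[X]} {M : Matrix (XiMT 2 d) (XiMT 2 d) K}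
    (hP : ∀ r Y Z, structurePolynomial (X r) Y Z = P r Y Z)
    (h : ∀ Z Y, M Z Y = ∑ r, c r * aeval (v ^ 2) (P r Y Z)) :
    act 2 d (∑ r, c r • Finsupp.single (X r) 1) = toEnd d M := by
  refine Finsupp.lhom_ext' fun Y => LinearMap.ext_ring (Finsupp.ext fun Z => ?_)
  rw [LinearMap.comp_apply, LinearMap.comp_apply, Finsupp.lsingle_apply, toEnd_single, map_sum,
    LinearMap.sum_apply, Finsupp.finsetSum_apply, Finsupp.finsetSum_apply]
  simp only [act, map_smul, Finsupp.linearCombination_single, one_smul, LinearMap.smul_apply,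
    Finsupp.smul_apply, Finsupp.finsetSum_apply, Finsupp.single_apply, Finset.sum_ite_eq',
    Finset.mem_univ, if_true, h, hP, smul_eq_mul]

theorem sum_ite_rk {n : ℕ} (g : ℕ → K) (s m : ℕ) (hm : s ≤ m) (hn : m < s + n) (a : K) :
    ∑ r : Fin n, g r * (if m = r + s then a else 0) = g (m - s) * a := by
  rw [Finset.sum_eq_single ⟨m - s, by omega⟩]
  · rw [if_pos (by simp only; omega)]
  · intro r _ hr
    rw [if_neg, mul_zero]
    intro h
    exact hr (Fin.ext (by simp only; omega))
  · simp

theorem act_chevE : act 2 d (chevE d) = toEnd d (genMat d Gen.e) := by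
  rw [chevE]
  refine act_sum (fun r => structurePolynomial_e (r := r) (by rfl)) fun Z Y => ?_
  rw [genMat, hatD, Matrix.diagonal_mul, hatE, specMat_apply]
  simp only [apply_ite (aeval (v ^ 2)), map_zero]
  by_cases h : Z.rk d = 0
  · rw [matE_eq_zero (by omega)]
    simp
  · have := Z.rk_le
    rw [sum_ite_rk (fun r => v ^ (-(r : ℤ))) 1 (Z.rk d) (by omega) (by omega)]
    congr 2
    rw [Nat.cast_sub (by omega)]
    push_cast
    ring

theorem act_chevF : act 2 d (chevF d) = toEnd d (genMat d Gen.f) := by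
  rw [chevF]
  refine act_sum (fun r => structurePolynomial_f (r := r) (by rfl)) fun Z Y => ?_
  rw [genMat, hatD, Matrix.diagonal_mul, hatF, specMat_apply]
  simp only [apply_ite (aeval (v ^ 2)), map_zero]
  by_cases h : Z.rk d = d
  · have := Y.rk_le
    rw [matF_eq_zero (by omega)]
    simp
  · have := Z.rk_le
    have h2 := sum_ite_rk (n := d) (fun r => v ^ (1 + (r : ℤ) - (d : ℤ))) 0 (Z.rk d) (by omega)
      (by omega) (aeval (v ^ 2) (matF d Z Y))
    simp only [add_zero, Nat.sub_zero] at h2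
    rw [h2]
    congr 2
    ring

theorem act_oneBasis_sum (g : ℕ → K) :
    act 2 d (∑ r : Fin (d + 1), g r • oneBasis d r) = toEnd d (Matrix.diagonal fun Z => g (Z.rk d)) := by
  refine act_sum (fun r => structurePolynomial_one (r := r) (by rfl)) fun Z Y => ?_
  have := Z.rk_le
  by_cases h : Z = Y
  · subst h
    have h2 := sum_ite_rk (n := d + 1) g 0 (Z.rk d) (by omega) (by omega) 1
    simp only [add_zero, Nat.sub_zero, mul_one] at h2
    rw [Matrix.diagonal_apply_eq, ← h2]
    simp only [and_true, apply_ite (aeval (v ^ 2)), map_zero, map_one]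
  · simp [h]

theorem act_chevK : act 2 d (chevK d) = toEnd d (genMat d Gen.k) := by
  refine (act_oneBasis_sum fun r => v ^ (2 * (r : ℤ) - d)).trans ?_
  rfl

theorem act_chevKinv : act 2 d (chevKinv d) = toEnd d (genMat d Gen.kinv) := by
  refine (act_oneBasis_sum fun r => v ^ ((d : ℤ) - 2 * r)).trans ?_
  rw [genMat, hatD]
  congr 2
  funext Z
  congr 1
  ring

/-- The zero subspace has only the trivial translate, which is why `ℓ` contains `1_0` without a
companion `x_0`. -/
theorem matA_of_rk_eq_zero {Y Z : XiMT 2 d} (h : Z.rk d = 0) :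
    matA d Z Y = if Z = Y then 1 else 0 := by
  refine poly_ext_position (Z := Z) fun s => ?_
  have hW := s.finrank_W
  rw [h, Submodule.finrank_eq_zero] at hW
  have h1 (u) : (u ∈ s.W ∧ HasType Y s.W s.F (s.x - u)) ↔ (u = 0 ∧ Z = Y) := by
    constructor
    · rintro ⟨h1, h2⟩
      rw [hW, Submodule.mem_bot] at h1
      rw [h1, sub_zero] at h2
      exact ⟨h1, s.hasType.unique h2⟩
    · rintro ⟨rfl, rfl⟩
      rw [sub_zero]
      exact ⟨zero_mem _, s.hasType⟩
  rw [eval_matA]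
  simp only [h1]
  split_ifs with h2 <;> simp [h2]

/-- Adding `1_r` to `x_r` restores the translate `u = 0`, so that the sum acts by `matA` in rank
`r`. -/
theorem act_chevL : act 2 d (chevL d) = toEnd d (genMat d Gen.l) := by
  have h1 : chevL d = ∑ r : Fin (d + 1), v ^ (-2 * (r : ℤ)) • oneBasis d r +
      ∑ r : Fin d, v ^ (-2 * ((r : ℤ) + 1)) • xBasis d r := by
    rw [chevL, Fin.sum_univ_succ, add_assoc, ← Finset.sum_add_distrib]
    simp [smul_add]
  suffices h2 : act 2 d (∑ r : Fin d, v ^ (-2 * ((r : ℤ) + 1)) • xBasis d r) =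
      toEnd d (genMat d Gen.l - Matrix.diagonal fun Z => v ^ (-2 * (Z.rk d : ℤ))) by
    rw [h1, map_add, act_oneBasis_sum fun r => v ^ (-2 * (r : ℤ)), h2, ← map_add, add_sub_cancel]
  refine act_sum (fun r => structurePolynomial_x (r := r) (by rfl)) fun Z Y => ?_
  rw [Matrix.sub_apply, genMat, hatD, Matrix.diagonal_mul, hatA, specMat_apply, Matrix.diagonal_apply]
  simp only [apply_ite (aeval (v ^ 2)), map_zero]
  have := Z.rk_le
  by_cases h : Z.rk d = 0
  · rw [matA_of_rk_eq_zero h]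
    by_cases h2 : Z = Y
    · subst h2; simp [h]
    · simp [h, h2]
  · have h3 := sum_ite_rk (n := d) (fun r => v ^ (-2 * ((r : ℤ) + 1))) 1 (Z.rk d) (by omega) (by omega)
      (aeval (v ^ 2) (matA d Z Y - if Z = Y then 1 else 0))
    have h4 : (((Z.rk d - 1 : ℕ) : ℤ) + 1) = Z.rk d := by
      rw [Nat.cast_sub (by omega)]; push_cast; ring
    rw [h4] at h3
    rw [h3, add_zero]
    by_cases h2 : Z = Y
    · subst h2
      simp
      ring
    · simp [h2]

end

section

open Polynomial

variable {d : ℕ}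

/-! ### Weight spaces of `MT_v(2,d)` -/

theorem v_zpow_injective {a b : ℤ} (h : v ^ a = v ^ b) : a = b := by
  have key : ∀ a b : ℤ, a < b → v ^ a ≠ v ^ b := by
    intro a b hab h
    have h2 : v ^ (b - a) = 1 := by
      rw [zpow_sub₀ v_ne_zero, h, div_self (zpow_ne_zero _ v_ne_zero)]
    refine v_pow_ne_one (b - a).toNat (by omega) ?_
    rw [← h2, ← zpow_natCast]
    congr 1
    omega
  by_contra hab
  rcases lt_or_gt_of_ne hab with h1 | h1
  · exact key a b h1 h
  · exact key b a h1 h.symm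

/-- Characteristic zero allows dimensions to be read off from traces. -/
instance : CharZero K := charZero_of_injective_algebraMap (algebraMap ℂ K).injective

theorem genMat_k_apply (x : MT 2 d) (Z : XiMT 2 d) :
    toEnd d (genMat d Gen.k) x Z = v ^ (2 * (Z.rk d : ℤ) - d) * x Z :=
  toEnd_diagonal_apply _ x Z

theorem genMat_k_eigen {n : ℤ} {x : MT 2 d} :
    toEnd d (genMat d Gen.k) x = v ^ n • x ↔ ∀ Z, x Z ≠ 0 → n + d = 2 * Z.rk d := by
  constructor
  · intro h Z hZ
    have h1 := DFunLike.congr_fun h Z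
    rw [genMat_k_apply, Finsupp.smul_apply, smul_eq_mul] at h1
    have := v_zpow_injective (mul_right_cancel₀ hZ h1)
    omega
  · intro h
    ext1 Z
    rw [genMat_k_apply, Finsupp.smul_apply, smul_eq_mul]
    by_cases hZ : x Z = 0
    · simp [hZ]
    · congr 2
      have := h Z hZ
      omega

/-- The projection to the basis vectors of rank `r`. -/
noncomputable def rankProj (d r : ℕ) : Matrix (XiMT 2 d) (XiMT 2 d) K :=
  Matrix.diagonal fun Z => if Z.rk d = r then 1 else 0

theorem rankProj_mul_self (r : ℕ) : rankProj d r * rankProj d r = rankProj d r := by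
  rw [rankProj, Matrix.diagonal_mul_diagonal]
  congr 1
  funext Z
  split_ifs <;> simp

theorem rankProj_apply_eq {n : ℤ} {r : ℕ} (h : n + d = 2 * r) {x : MT 2 d} :
    toEnd d (rankProj d r) x = x ↔ toEnd d (genMat d Gen.k) x = v ^ n • x := by
  rw [genMat_k_eigen, DFunLike.ext_iff]
  refine forall_congr' fun Z => ?_
  rw [rankProj, toEnd_diagonal_apply]
  by_cases hZ : Z.rk d = r
  · simp only [hZ, if_true, one_mul, true_iff]
    exact fun _ => h
  · rw [if_neg hZ, zero_mul]
    constructor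
    · intro h1 h2
      exact absurd h1.symm h2
    · intro h1
      by_contra h2
      have := h1 (Ne.symm h2)
      omega

theorem genMat_l_comm (r : ℕ) : rankProj d r * genMat d Gen.l = genMat d Gen.l * rankProj d r := by
  ext Z Y
  rw [rankProj, Matrix.mul_diagonal, Matrix.diagonal_mul, genMat, hatD, Matrix.diagonal_mul, hatA,
    specMat_apply]
  by_cases h : Z.1.1 = Y.1.1
  · rw [mul_comm, Z.rk_eq, Y.rk_eq, h]
  · rw [matA_eq_zero h]
    simp

theorem genMat_l_mul_self : genMat d Gen.l * genMat d Gen.l = genMat d Gen.l := by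
  simpa [Free.l] using genMat_rel (d := d) Rel.l_l

theorem trace_rankProj (r : ℕ) : (rankProj d r).trace =
    ((Finset.univ.filter fun Z : XiMT 2 d => Z.rk d = r).card : K) := by
  rw [rankProj, Matrix.trace_diagonal, Finset.sum_boole]

theorem trace_rankProj_mul (r : ℕ) : (rankProj d r * genMat d Gen.l).trace =
    ((d.choose r + d * (d - 1).choose r : ℕ) : K) := by
  have h := congrArg (aeval (v ^ 2) : ℤ[X] → K) (sum_matA_diag (d := d) r)
  rw [map_sum, map_mul, map_natCast, map_pow, aeval_X, ← pow_mul] at h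
  have h1 : (rankProj d r * genMat d Gen.l).trace =
      v ^ (-2 * (r : ℤ)) * ∑ Z : XiMT 2 d with Z.rk d = r, (aeval (v ^ 2) (matA d Z Z) : K) := by
    rw [Matrix.trace, Finset.mul_sum, Finset.sum_filter]
    refine Finset.sum_congr rfl fun Z _ => ?_
    rw [Matrix.diag_apply, rankProj, genMat, hatD, Matrix.diagonal_mul, Matrix.diagonal_mul, hatA,
      specMat_apply, add_zero]
    split_ifs with hZ
    · rw [one_mul, hZ]
    · rw [zero_mul]
  have h2 : v ^ (-2 * (r : ℤ)) * v ^ (2 * r) = 1 := by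
    rw [← zpow_natCast, ← zpow_add₀ v_ne_zero]
    simp
  rw [h1, h, mul_left_comm, h2, mul_one]

/-- The product of two commuting idempotents is the projection onto their common fixed space. -/
theorem trace_of_commute {N : Type*} [AddCommGroup N] [Module K N] [FiniteDimensional K N]
    {p q : Module.End K N} (hp : p * p = p) (hq : q * q = q) (hpq : p * q = q * p)
    {S : Submodule K N} (hS : ∀ x, x ∈ S ↔ p x = x ∧ q x = x) :
    LinearMap.trace K N (p * q) = Module.finrank K S := by
  have h : LinearMap.IsProj S (p * q) := by
    refine ⟨fun x => ?_, fun x hx => ?_⟩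
    · rw [hS, ← Module.End.mul_apply, ← Module.End.mul_apply, ← mul_assoc, ← mul_assoc, hp, ← hpq,
        mul_assoc, hq]
      exact ⟨rfl, rfl⟩
    · rw [Module.End.mul_apply, ((hS x).mp hx).2, ((hS x).mp hx).1]
  exact h.trace

/-- `MT_v(2,d)` as a representation of the relations of `MU_v(2)`. -/
noncomputable def tensorRep (d : ℕ) : MURep (MT 2 d) where
  φ g := toEnd d (genMat d g)
  rel a b h := by
    have key : ∀ a, FreeAlgebra.lift K (fun g => toEnd d (genMat d g)) a =
        toEnd d (FreeAlgebra.lift K (genMat d) a) := by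
      intro a
      refine AlgHom.congr_fun (φ₁ := FreeAlgebra.lift K (fun g => toEnd d (genMat d g)))
        (φ₂ := (toEnd d).toAlgHom.comp (FreeAlgebra.lift K (genMat d))) ?_ a
      refine FreeAlgebra.hom_ext (funext fun g => ?_)
      simp
    rw [key, key, genMat_rel h]
  B := d
  bound n hn x hx := by
    ext1 Z
    by_contra hZ
    have h1 := genMat_k_eigen.mp hx Z hZ
    have h2 := Z.rk_le
    have h3 : |n| ≤ d := abs_le.mpr (by omega)
    omega

theorem tensorRep_D_eq_bot {n : ℤ} (h : ¬ ∃ r : ℕ, n + d = 2 * r) (ε : K) :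
    (tensorRep d).D ε n = ⊥ := by
  rw [eq_bot_iff]
  intro x hx
  rw [Submodule.mem_bot]
  ext1 Z
  by_contra hZ
  exact h ⟨_, genMat_k_eigen.mp hx.1 Z hZ⟩

theorem finrank_tensorRep_D_one {n : ℤ} {r : ℕ} (h : n + d = 2 * r) :
    Module.finrank K ((tensorRep d).D 1 n) = d.choose r + d * (d - 1).choose r := by
  have h1 := trace_of_commute (p := toEnd d (rankProj d r)) (q := toEnd d (genMat d Gen.l))
    (by rw [← map_mul, rankProj_mul_self]) (by rw [← map_mul, genMat_l_mul_self])
    (by rw [← map_mul, ← map_mul, genMat_l_comm]) (S := (tensorRep d).D 1 n) (fun x => by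
      rw [MURep.mem_D_one, rankProj_apply_eq h]; rfl)
  rw [← map_mul, trace_toEnd, trace_rankProj_mul] at h1
  exact_mod_cast h1.symm

/-- The trace of `1 - ℓ` in rank `r` is the number of all positions of that rank minus the number of
reduced ones. -/
theorem finrank_tensorRep_D_zero {n : ℤ} {r : ℕ} (h : n + d = 2 * r) :
    Module.finrank K ((tensorRep d).D 0 n) =
      (Finset.univ.filter fun Y : XiMT 2 d => ¬ Y.Reduced ∧ Y.rk d = r).card := by
  have hl : (1 - genMat d Gen.l) * (1 - genMat d Gen.l) = 1 - genMat d Gen.l := by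
    rw [mul_sub, mul_one, sub_mul, one_mul, genMat_l_mul_self, sub_self, sub_zero]
  have hc : rankProj d r * (1 - genMat d Gen.l) = (1 - genMat d Gen.l) * rankProj d r := by
    rw [mul_sub, sub_mul, genMat_l_comm, mul_one, one_mul]
  have h1 := trace_of_commute (p := toEnd d (rankProj d r)) (q := toEnd d (1 - genMat d Gen.l))
    (by rw [← map_mul, rankProj_mul_self]) (by rw [← map_mul, hl])
    (by rw [← map_mul, ← map_mul, hc]) (S := (tensorRep d).D 0 n) (fun x => by
      rw [MURep.mem_D_zero, rankProj_apply_eq h, map_sub, map_one, LinearMap.sub_apply,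
        Module.End.one_apply, sub_eq_self]; rfl)
  have h2 := Finset.card_filter_add_card_filter_not (s := Finset.univ.filter fun Z : XiMT 2 d => Z.rk d = r)
    (fun Y => Y.Reduced)
  rw [Finset.filter_filter, Finset.filter_filter] at h2
  simp only [and_comm (a := XiMT.rk _ _ = r)] at h2
  rw [card_reduced] at h2
  rw [← map_mul, trace_toEnd, mul_sub, mul_one, Matrix.trace_sub, trace_rankProj, trace_rankProj_mul,
    ← h2, Nat.cast_add, add_sub_cancel_left] at h1
  exact_mod_cast h1.symm

theorem finrank_tensorRep_one (hd : 0 < d) (n : ℤ) : Module.finrank K ((tensorRep d).D 1 n) =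
    weightMult d n + d * weightMult (d - 1) (n + 1) := by
  by_cases h : ∃ r : ℕ, n + d = 2 * r
  · obtain ⟨r, h⟩ := h
    rw [finrank_tensorRep_D_one h, weightMult_of_eq h, weightMult_of_eq (r := r) (by omega)]
  · rw [tensorRep_D_eq_bot h, finrank_bot]
    have h1 : weightMult d n = 0 := by
      by_contra h2
      obtain ⟨r, h3, -⟩ := weightMult_ne_zero h2
      exact h ⟨r, h3⟩
    have h2 : weightMult (d - 1) (n + 1) = 0 := by
      by_contra h2
      obtain ⟨r, h3, -⟩ := weightMult_ne_zero h2
      exact h ⟨r, by omega⟩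
    rw [h1, h2, mul_zero, add_zero]

theorem finrank_tensorRep_zero (hd : 0 < d) (n : ℤ) : Module.finrank K ((tensorRep d).D 0 n) =
    d.choose 2 * weightMult (d - 2) n + d * weightMult (d - 1) (n - 1) := by
  -- These are the weights of no positive rank. Where `d - 2` is truncated, the factor `d choose 2`
  -- vanishes.
  have h0 (h : ¬ ∃ r : ℕ, n + d = 2 * (r + 1)) :
      d.choose 2 * weightMult (d - 2) n + d * weightMult (d - 1) (n - 1) = 0 := by
    have h1 : d.choose 2 * weightMult (d - 2) n = 0 := by
      by_contra h1
      have h2 : 2 ≤ d := by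
        by_contra h2
        exact left_ne_zero_of_mul h1 (Nat.choose_eq_zero_of_lt (by omega))
      obtain ⟨r, h3, -⟩ := weightMult_ne_zero (right_ne_zero_of_mul h1)
      exact h ⟨r, by omega⟩
    have h2 : weightMult (d - 1) (n - 1) = 0 := by
      by_contra h2
      obtain ⟨r, h3, -⟩ := weightMult_ne_zero h2
      exact h ⟨r, by omega⟩
    rw [h1, h2, mul_zero, add_zero]
  by_cases h : ∃ r : ℕ, n + d = 2 * r
  · obtain ⟨r, h⟩ := h
    rw [finrank_tensorRep_D_zero h]
    cases r with
    | zero => rw [card_not_reduced_zero, h0 (by rintro ⟨r, h1⟩; omega)]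
    | succ r =>
      rw [card_not_reduced, weightMult_of_eq (m := d - 1) (r := r) (by omega), add_comm]
      congr 1
      by_cases h2 : 2 ≤ d
      · rw [weightMult_of_eq (r := r) (by omega)]
      · rw [Nat.choose_eq_zero_of_lt (by omega), zero_mul, zero_mul]
  · rw [tensorRep_D_eq_bot h, finrank_bot, h0 fun ⟨r, h1⟩ => h ⟨r + 1, by omega⟩]

theorem tensorRep_span (S : Submodule K (MT 2 d))
    (h : ∀ n : ℤ, ∀ x, (tensorRep d).k x = v ^ n • x → x ∈ S) : S = ⊤ := by
  rw [eq_top_iff, ← Finsupp.basisSingleOne.span_eq, Submodule.span_le]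
  rintro _ ⟨Y, rfl⟩
  refine h (2 * Y.rk d - d) _ (genMat_k_eigen.mpr fun Z hZ => ?_)
  rw [Finsupp.coe_basisSingleOne] at hZ
  have : Y = Z := by
    by_contra h1
    exact hZ (Finsupp.single_eq_of_ne' h1)
  rw [this]
  ring

end

end Mirabolic

/-! ### The decomposition of `MT_v(2,d)` -/

theorem mainTheorem6 (d : ℕ) (hd : 0 < d) :
    ∃ ρ : MU2 →ₐ[K] Module.End K (MT 2 d),
      ρ (MU2.gen Gen.e) = act 2 d (chevE d) ∧
      ρ (MU2.gen Gen.f) = act 2 d (chevF d) ∧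
      ρ (MU2.gen Gen.k) = act 2 d (chevK d) ∧
      ρ (MU2.gen Gen.kinv) = act 2 d (chevKinv d) ∧
      ρ (MU2.gen Gen.l) = act 2 d (chevL d) ∧
      ∃ Φ : MT 2 d ≃ₗ[K] ⨁ b : Bipartition d, L b.label ⊗[K] M b,
        ∀ (a : MU2) (x : MT 2 d), Φ (ρ a x) = a • Φ x := by
  let ρ := MU2.lift (tensorRep d).φ (tensorRep d).rel
  have hρ (g : Gen) : ρ (MU2.gen g) = toEnd d (genMat d g) := MURep.lift_gen _ _ g
  refine ⟨ρ, (hρ _).trans act_chevE.symm, (hρ _).trans act_chevF.symm, (hρ _).trans act_chevK.symm,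
    (hρ _).trans act_chevKinv.symm, (hρ _).trans act_chevL.symm, ?_⟩
  refine (tensorRep d).exists_equiv hd (finrank_tensorRep_one hd) (finrank_tensorRep_zero hd) ?_
    tensorRep_span ρ hρ
  rw [Module.finrank_finsupp_self, card_XiMT hd]
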